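/- Let $d\ge 1$, let $I=(a,b]$ be a bounded interval, let $\Omega_x,\Omega_v\subset\mathbb{R}^d$ be open, and let $\Omega=I\times\Omega_x\times\Omega_v$. Let $0<\lambda\le\Lambda$. Let $A$ be a measurable field of real symmetric $d\times d$ matrices on $\Omega$ such that, for almost every $z\in\Omega$, $\lambda|\xi|^2\le A(z)\xi\cdot\xi\le\Lambda|\xi|^2$ for all $\xi\in\mathbb{R}^d$; let $B\colon\Omega\to\mathbb{R}^d$ be measurable with $\|B\|_{L^\infty(\Omega)}\le\Lambda$, and let $S\in L^2(\Omega)$. A function $f\colon\Omega\to\mathbb{R}$ is a weak sub-solution of $(\partial_t+v\cdot\nabla_x)f=\mathrm{div}_v(A\nabla_vf)+B\cdot\nabla_vf+S$ in $\Omega$ if $f\in L^2(\Omega)$, its distributional gradient $\nabla_vf$ is in $L^2(\Omega)$, and \[\int_\Omega f\,(\partial_t+v\cdot\nabla_x)\varphi\ \ge\ \int_\Omega A\nabla_vf\cdot\nabla_v\varphi-\int_\Omega(B\cdot\nabla_vf+S)\varphi\] for all non-negative smooth functions $\varphi$ with compact support in the interior $(a,b)\times\Omega_x\times\Omega_v$.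 For $z_0=(t_0,x_0,v_0)\in\mathbb{R}\times\mathbb{R}^d\times\mathbb{R}^d$ and $R>0$, let \[Q_R(z_0)=\{(t,x,v): -R^2<t-t_0\le 0,\ |x-x_0-(t-t_0)v_0|<R^3,\ |v-v_0|<R\},\] and for $\alpha\in(0,1)$ and $p\ge1$ let \[\|f\|_{L^p_{t,v}\dot W^{\alpha,p}_x(Q_R(z_0))}=\left(\int_{(t_0-R^2,t_0]\times B_R(v_0)}\left\{\iint_{Q^{(t,v)}\times Q^{(t,v)}}\frac{|f(t,x,v)-f(t,y,v)|^p}{|x-y|^{d+\alpha p}}\,dx\,dy\right\}dt\,dv\right)^{1/p},\] where $Q^{(t,v)}=B_{R^3}(x_0+(t-t_0)v_0)$ is the slice of $Q_R(z_0)$ at $(t,v)$. Proposition ($x$-regularity of sub-solutions). For every $\varepsilon\in(0,\frac13)$ there is a constant $C$, depending only on $d$, $\Lambda$ and $\varepsilon$, such that for every $p_\varepsilon\in\left(1,1+\frac{2-3\varepsilon}{4d+3\varepsilon}\right)$, all $\lambda,\Omega,A,B,S$ as above, every weak sub-solution $f$ in $\Omega$, every $z_0$ and all $0<r<R<1$ with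 $Q_R(z_0)\subset\Omega$, \[\|f\|_{L^{p_\varepsilon}_{t,v}\dot W^{\varepsilon,p_\varepsilon}_x(Q_r(z_0))}\le C(R-r)^{-1}\|\nabla_vf\|_{L^2(Q_R(z_0))}+C(R-r)^{-2}\|f\|_{L^2(Q_R(z_0))}+C\|S\|_{L^2(Q_R(z_0))}.\] -/

import Mathlib

open MeasureTheory Set
open scoped NNReal ENNReal ContDiff

noncomputable section

namespace Kinetic

/-- The space `ℝ^d` with its Euclidean norm. -/
abbrev E (d : ℕ) : Type := EuclideanSpace ℝ (Fin d)

/-- The space `ℝ × ℝ^d × ℝ^d` of the variables `z = (t, x, v)`, with Lebesgue measure. -/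
abbrev Phase (d : ℕ) : Type := ℝ × E d × E d

/-- The domain `Ω = (a, b] × Ω_x × Ω_v`. -/
def domain {d : ℕ} (a b : ℝ) (Ωx Ωv : Set (E d)) : Set (Phase d) :=
  Ioc a b ×ˢ (Ωx ×ˢ Ωv)

/-- The kinetic cylinder `Q_R(z₀)`: all `(t, x, v)` such that
`-R² < t - t₀ ≤ 0`, `|x - x₀ - (t - t₀) v₀| < R³` and `|v - v₀| < R`. -/
def cylinder {d : ℕ} (R : ℝ) (z₀ : Phase d) : Set (Phase d) :=
  {z | -R ^ 2 < z.1 - z₀.1 ∧ z.1 - z₀.1 ≤ 0 ∧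
    ‖z.2.1 - z₀.2.1 - (z.1 - z₀.1) • z₀.2.2‖ < R ^ 3 ∧ ‖z.2.2 - z₀.2.2‖ < R}

/-- The action `A ξ` of a `d × d` matrix on a vector of `ℝ^d`. -/
def act {d : ℕ} (A : Matrix (Fin d) (Fin d) ℝ) (ξ : E d) : E d :=
  WithLp.toLp 2 (A.mulVec ξ.ofLp)

/-- `A ∈ 𝓔(lam, Lam)`: a measurable field of symmetric matrices on `Ω` such that, almost everywhere
in `Ω`, `lam |ξ|² ≤ A ξ · ξ ≤ Lam |ξ|²` for all `ξ`. Essential boundedness is a consequence of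
the symmetry and of these bounds. -/
structure IsElliptic {d : ℕ} (Ω : Set (Phase d)) (lam Lam : ℝ)
    (A : Phase d → Matrix (Fin d) (Fin d) ℝ) : Prop where
  aestronglyMeasurable : AEStronglyMeasurable A (volume.restrict Ω)
  isSymm : ∀ᵐ z ∂(volume.restrict Ω), (A z).IsSymm
  bounds : ∀ᵐ z ∂(volume.restrict Ω), ∀ ξ : E d,
    lam * ‖ξ‖ ^ 2 ≤ inner ℝ (act (A z) ξ) ξ ∧ inner ℝ (act (A z) ξ) ξ ≤ Lam * ‖ξ‖ ^ 2

/-- Smooth test functions with compact support in the interior of `Ω`. For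
`Ω = (a, b] × Ω_x × Ω_v` with `Ω_x` and `Ω_v` open, they vanish near `t = a` and near `t = b`. -/
structure IsTest {d : ℕ} (Ω : Set (Phase d)) (φ : Phase d → ℝ) : Prop where
  contDiff : ContDiff ℝ ∞ φ
  hasCompactSupport : HasCompactSupport φ
  tsupport_subset : tsupport φ ⊆ interior Ω

/-- The free transport operator `(∂_t + v · ∇_x) φ`. -/
def transport {d : ℕ} (φ : Phase d → ℝ) (z : Phase d) : ℝ :=
  fderiv ℝ φ z (1, z.2.2, 0)

/-- The classical velocity gradient `∇_v φ`. -/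
def gradV {d : ℕ} (φ : Phase d → ℝ) (z : Phase d) : E d :=
  gradient (fun w : E d => φ (z.1, z.2.1, w)) z.2.2

/-- `G` is the weak velocity gradient `∇_v f` of `f` in `Ω`. -/
def HasWeakGradV {d : ℕ} (Ω : Set (Phase d)) (f : Phase d → ℝ) (G : Phase d → E d) : Prop :=
  ∀ φ : Phase d → ℝ, IsTest Ω φ →
    ∫ z in Ω, f z • gradV φ z = -∫ z in Ω, φ z • G z

/-- `f`, with weak velocity gradient `G = ∇_v f`, is a weak sub-solution in `Ω` of
`(∂_t + v · ∇_x) f = div_v (A ∇_v f) + B · ∇_v f + S`. -/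
structure IsWeakSubsolution {d : ℕ} (Ω : Set (Phase d))
    (A : Phase d → Matrix (Fin d) (Fin d) ℝ) (B : Phase d → E d) (S : Phase d → ℝ)
    (f : Phase d → ℝ) (G : Phase d → E d) : Prop where
  memLp : MemLp f 2 (volume.restrict Ω)
  memLp_grad : MemLp G 2 (volume.restrict Ω)
  hasWeakGradV : HasWeakGradV Ω f G
  inequality : ∀ φ : Phase d → ℝ, IsTest Ω φ → (∀ z, 0 ≤ φ z) →
    (∫ z in Ω, inner ℝ (act (A z) (G z)) (gradV φ z))
        - (∫ z in Ω, (inner ℝ (B z) (G z) + S z) * φ z)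
      ≤ ∫ z in Ω, f z * transport φ z

/-- The semi-norm of `L^p_{t,v} Ẇ^{α,p}_x (Q_R(z₀))`, with values in `[0, ∞]`:
the Gagliardo semi-norm in `x` on the slice `B_{R³}(x₀ + (t - t₀) v₀)` of the cylinder, integrated
over `(t, v) ∈ (t₀ - R², t₀] × B_R(v₀)`. -/
def seminormX {d : ℕ} (α p R : ℝ) (z₀ : Phase d) (f : Phase d → ℝ) : ℝ≥0∞ :=
  (∫⁻ q in Ioc (z₀.1 - R ^ 2) z₀.1 ×ˢ Metric.ball z₀.2.2 R,
    ∫⁻ s in Metric.ball (z₀.2.1 + (q.1 - z₀.1) • z₀.2.2) (R ^ 3) ×ˢ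
        Metric.ball (z₀.2.1 + (q.1 - z₀.1) • z₀.2.2) (R ^ 3),
      ENNReal.ofReal (|f (q.1, s.1, q.2) - f (q.1, s.2, q.2)| ^ p
        / ‖s.1 - s.2‖ ^ ((d : ℝ) + α * p))) ^ (1 / p)

end Kinetic

end

/-! Mollify `f` by kernels of velocity scale `σ`, time scale `τ σ²` and position scale `τ σ³`,
transported by the Galilean group, and differentiate in `σ`. The derivative pairs `f` with a kernel
built on `euler ψ`, the divergence of `ψ` times the dilation generator. Write `T` for the transport
operator. Since position derivatives are the commutators of velocity derivatives with `T`, this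
function is `T` of one test function plus a velocity divergence of others (`euler_eq`).
Hypoellipticity enters here and only here. The `T` part is traded, through the equation, for `F = A
∇_v f`, for `b = B · ∇_v f + S` and for the defect of the inequality; the velocity part is traded
for `G = ∇_v f` (`IsSubsolutionOn.integral_mul_kern_euler`). In the `σ`-derivative, `F`, `b` and `G`
carry no negative power of `σ`, while the defect carries a factor `τ σ`.

The defect is a non-negative functional, in effect a measure, so only its mass is available. Its
increments in position are bounded, by positivity alone, by its values on dominating kernels
(`IsSubsolutionOn.abs_functional_kern_sub_le`), and the integral of these values over all centres is
the value of the functional on a cut-off (`lintegral_mass`). The inequality says nothing at the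
final time `t₀`, so the cut-off must vanish near `t₀`. Cutting at distance `τ` costs `τ⁻¹` on a slab
of thickness comparable to `τ`, that is `τ^(-1/2)` against an `L²` function
(`IsControlled.functional_le`).

A position increment `h` changes a kernel of scale `σ` by the factor `min 1 (‖h‖ / (τ σ³))`. With `u
= ‖h‖ / τ` and `β < 1/3`, integration over `σ` yields `u ^ β`, and `τ u ^ (2 β)` when the factor `τ
σ` is present. Hence in the layer at times between `t₀ - 2τ` and `t₀ - τ` the increment of `f` is at
most `Y + Z`, with `Y` of size `u ^ β` in `L²` and `Z` of size `√τ u ^ (2 β)` in `L¹`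
(`IsControlled.exists_bound`). Interpolating `Z` with the trivial `L²` bound on the increment, and
using that the layer has volume of order `τ`, both parts contribute `τ ^ (1 - p/2) u ^ γ` to the
integral of the `p`-th power, for every `γ` below `β p` and `2 β (2 - p)` (`exists_layer_bound`).

Integration against the Gagliardo weight in `h` requires `γ > ε p` and costs `τ ^ (-ε p)`; summation
over `τ = 2^(-j-1)` requires `1 - p/2 - ε p > 0`. For `p < 6 / (4 + 3 ε)`, which is the stated range
when `d = 1` and contains it for larger `d`, both hold with a margin depending only on `ε`
(`exists_seminormX_le`). The constant is therefore uniform in `p`. It does not depend on `lam`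
because ellipticity serves only to bound `A ∇_v f`. -/

noncomputable section

namespace Kinetic

variable {d : ℕ}

/-! ### Galilean translations, kinetic dilations and their Jacobians. -/

/-- The rescaled left translation `δ ∘ (z⁻¹ ∘ z')` of the Galilean group, where the dilation `δ`
multiplies times by `α`, velocities by `γ` and positions by `α γ`. -/
def pull (α γ : ℝ) (z z' : Phase d) : Phase d :=
  (α * (z'.1 - z.1), (α * γ) • (z'.2.1 - z.2.1 - (z'.1 - z.1) • z.2.2), γ • (z'.2.2 - z.2.2))

/-- The Jacobian of `pull α γ z`. -/
def jac (d : ℕ) (α γ : ℝ) : ℝ := α ^ (d + 1) * γ ^ (2 * d)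

theorem jac_pos {α γ : ℝ} (hα : 0 < α) (hγ : 0 < γ) : 0 < jac d α γ := by
  unfold jac; positivity

theorem continuous_pull (α γ : ℝ) :
    Continuous (fun p : Phase d × Phase d => pull α γ p.1 p.2) := by
  unfold pull; fun_prop

theorem continuous_pull_right (α γ : ℝ) (z : Phase d) : Continuous (pull α γ z) := by
  unfold pull; fun_prop

theorem continuous_pull_left (α γ : ℝ) (z' : Phase d) :
    Continuous (fun z : Phase d => pull α γ z z') := by
  unfold pull; fun_prop

theorem contDiff_pull (α γ : ℝ) (z : Phase d) : ContDiff ℝ ∞ (pull α γ z) := by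
  unfold pull; fun_prop

instance isAddHaarMeasure_phase : (volume : Measure (Phase d)).IsAddHaarMeasure := by
  have h : ((volume : Measure (E d)).prod (volume : Measure (E d))).IsAddHaarMeasure :=
    Measure.prod.instIsAddHaarMeasure _ _
  exact Measure.prod.instIsAddHaarMeasure (volume : Measure ℝ)
    ((volume : Measure (E d)).prod (volume : Measure (E d)))

instance isNegInvariant_phase : (volume : Measure (Phase d)).IsNegInvariant :=
  Measure.IsAddHaarMeasure.isNegInvariant_of_regular _

/-- Shears in the position variable preserve the Lebesgue measure. -/
theorem measurePreserving_shear {c : ℝ → E d → E d} (hc : Measurable (Function.uncurry c)) :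
    MeasurePreserving (fun z : Phase d => (z.1, z.2.1 - c z.1 z.2.2, z.2.2)) := by
  have h1 : ∀ s : ℝ, MeasurePreserving (fun p : E d × E d => (p.1 - c s p.2, p.2)) := by
    intro s
    have hs : Measurable (c s) := hc.comp measurable_prodMk_left
    have h2 : MeasurePreserving (fun p : E d × E d => (p.1, p.2 - c s p.1))
        (volume.prod volume) (volume.prod volume) := by
      refine (MeasurePreserving.id volume).skew_product
        (g := fun (w : E d) (y : E d) => y - c s w) ?_ ?_
      · exact measurable_snd.sub (hs.comp measurable_fst)
      · exact Filter.Eventually.of_forall fun w => (measurePreserving_sub_right volume (c s w)).map_eq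
    have h3 := (Measure.measurePreserving_swap (μ := (volume : Measure (E d)))
      (ν := (volume : Measure (E d)))).comp
      (h2.comp (Measure.measurePreserving_swap (μ := (volume : Measure (E d)))
      (ν := (volume : Measure (E d)))))
    exact h3
  refine (MeasurePreserving.id volume).skew_product
    (g := fun (s : ℝ) (p : E d × E d) => (p.1 - c s p.2, p.2)) ?_ ?_
  · refine Measurable.prodMk ?_ (measurable_snd.comp measurable_snd)
    refine (measurable_fst.comp measurable_snd).sub ?_
    exact hc.comp (measurable_fst.prodMk (measurable_snd.comp measurable_snd))
  · exact Filter.Eventually.of_forall fun s => (h1 s).map_eq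

theorem map_dilation {α γ : ℝ} (hα : 0 < α) (hγ : 0 < γ) :
    Measure.map (fun z : Phase d => (α * z.1, (α * γ) • z.2.1, γ • z.2.2)) volume
      = ENNReal.ofReal (jac d α γ)⁻¹ • volume := by
  have hαγ : 0 < α * γ := mul_pos hα hγ
  have e1 : Measure.map (fun s : ℝ => α * s) volume = ENNReal.ofReal α⁻¹ • volume := by
    have := Measure.map_addHaar_smul (volume : Measure ℝ) hα.ne'
    simp only [Module.finrank_self, pow_one, smul_eq_mul] at this
    rw [abs_of_pos (inv_pos.2 hα)] at this
    exact this
  have e2 : ∀ {r : ℝ}, 0 < r → Measure.map (fun y : E d => r • y) volume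
      = ENNReal.ofReal (r ^ d)⁻¹ • volume := by
    intro r hr
    have := Measure.map_addHaar_smul (volume : Measure (E d)) hr.ne'
    rw [finrank_euclideanSpace_fin, abs_of_pos (by positivity)] at this
    exact this
  have h1 : Measure.map (Prod.map (fun y : E d => (α * γ) • y) (fun w : E d => γ • w))
      (volume.prod volume) = ENNReal.ofReal (((α * γ) ^ d)⁻¹ * (γ ^ d)⁻¹) • volume := by
    rw [← Measure.map_prod_map _ _ (by fun_prop) (by fun_prop), e2 hαγ, e2 hγ,
      Measure.prod_smul_left, Measure.prod_smul_right, smul_smul,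
      ENNReal.ofReal_mul (by positivity)]
    rfl
  have h2 : Measure.map (Prod.map (fun s : ℝ => α * s)
      (Prod.map (fun y : E d => (α * γ) • y) (fun w : E d => γ • w)))
      (volume.prod (volume.prod volume))
      = ENNReal.ofReal (jac d α γ)⁻¹ • volume := by
    have : SFinite (Measure.map (Prod.map (fun y : E d => (α * γ) • y) (fun w : E d => γ • w))
      (volume.prod volume)) := by
      rw [h1]; infer_instance
    rw [← Measure.map_prod_map _ _ (by fun_prop) (by fun_prop), e1, h1,
      Measure.prod_smul_left, Measure.prod_smul_right, smul_smul,
      ← ENNReal.ofReal_mul (by positivity)]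
    congr 2
    unfold jac
    rw [mul_pow]
    field_simp
    ring
  exact h2

theorem map_pull_right {α γ : ℝ} (hα : 0 < α) (hγ : 0 < γ) (z : Phase d) :
    Measure.map (pull α γ z) volume = ENNReal.ofReal (jac d α γ)⁻¹ • volume := by
  have h1 := measurePreserving_shear (d := d) (c := fun s _ => s • z.2.2)
    (by unfold Function.uncurry; fun_prop)
  have h2 : MeasurePreserving (fun z' : Phase d => z' - z) := measurePreserving_sub_right volume z
  have h3 := (h1.comp h2).map_eq
  conv_rhs => rw [← map_dilation hα hγ, ← h3]
  rw [Measure.map_map (by fun_prop) (h1.comp h2).measurable]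
  rfl

/-- As a function of the centre, the map is a reflection `z' - z = (s, y, w)`, then a shear with
velocity `v = v' - w`, then a dilation, so its Jacobian is the one of `pull` in the other variable.
Kernels thus have the same mass in both variables, which is what lets the defect be integrated over
all centres. -/
theorem map_pull_left {α γ : ℝ} (hα : 0 < α) (hγ : 0 < γ) (z' : Phase d) :
    Measure.map (fun z => pull α γ z z') volume = ENNReal.ofReal (jac d α γ)⁻¹ • volume := by
  have h1 := measurePreserving_shear (d := d) (c := fun s w => s • (z'.2.2 - w))
    (by unfold Function.uncurry; fun_prop)
  have h2 : MeasurePreserving (fun z : Phase d => z' - z) :=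
    Measure.measurePreserving_sub_left volume z'
  have h3 := (h1.comp h2).map_eq
  conv_rhs => rw [← map_dilation hα hγ, ← h3]
  rw [Measure.map_map (by fun_prop) (h1.comp h2).measurable]
  congr 1
  ext z : 1
  simp [pull]

theorem lintegral_pull_right {α γ : ℝ} (hα : 0 < α) (hγ : 0 < γ) (z : Phase d)
    {g : Phase d → ℝ≥0∞} (hg : Measurable g) :
    ∫⁻ z', g (pull α γ z z') = ENNReal.ofReal (jac d α γ)⁻¹ * ∫⁻ w, g w := by
  rw [← lintegral_map hg (continuous_pull_right α γ z).measurable, map_pull_right hα hγ,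
    lintegral_smul_measure, smul_eq_mul]

theorem lintegral_pull_left {α γ : ℝ} (hα : 0 < α) (hγ : 0 < γ) (z' : Phase d)
    {g : Phase d → ℝ≥0∞} (hg : Measurable g) :
    ∫⁻ z, g (pull α γ z z') = ENNReal.ofReal (jac d α γ)⁻¹ * ∫⁻ w, g w := by
  rw [← lintegral_map hg (continuous_pull_left α γ z').measurable, map_pull_left hα hγ,
    lintegral_smul_measure, smul_eq_mul]

theorem integral_pull_right {F : Type*} [NormedAddCommGroup F] [NormedSpace ℝ F]
    {α γ : ℝ} (hα : 0 < α) (hγ : 0 < γ) (z : Phase d)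
    {g : Phase d → F} (hg : AEStronglyMeasurable g) :
    ∫ z', g (pull α γ z z') = (jac d α γ)⁻¹ • ∫ w, g w := by
  rw [← integral_map (continuous_pull_right α γ z).measurable.aemeasurable
    (by rw [map_pull_right hα hγ]; exact hg.smul_measure _), map_pull_right hα hγ,
    integral_smul_measure, ENNReal.toReal_ofReal (inv_nonneg.2 (jac_pos hα hγ).le)]

theorem integral_pull_left {F : Type*} [NormedAddCommGroup F] [NormedSpace ℝ F]
    {α γ : ℝ} (hα : 0 < α) (hγ : 0 < γ) (z' : Phase d)
    {g : Phase d → F} (hg : AEStronglyMeasurable g) :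
    ∫ z, g (pull α γ z z') = (jac d α γ)⁻¹ • ∫ w, g w := by
  rw [← integral_map (continuous_pull_left α γ z').measurable.aemeasurable
    (by rw [map_pull_left hα hγ]; exact hg.smul_measure _), map_pull_left hα hγ,
    integral_smul_measure, ENNReal.toReal_ofReal (inv_nonneg.2 (jac_pos hα hγ).le)]

/-! ### Behaviour of the transport and velocity derivatives under the group. -/

/-- The derivative of `φ` in the velocity direction `e`. -/
def derivV (e : E d) (φ : Phase d → ℝ) (z : Phase d) : ℝ := fderiv ℝ φ z (0, 0, e)

theorem inner_gradV {φ : Phase d → ℝ} {z : Phase d} (hφ : DifferentiableAt ℝ φ z) (e : E d) :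
    inner ℝ (gradV φ z) e = derivV e φ z := by
  have h1 : HasFDerivAt (fun w : E d => ((z.1, z.2.1, w) : Phase d))
      ((0 : E d →L[ℝ] ℝ).prod ((0 : E d →L[ℝ] E d).prod (ContinuousLinearMap.id ℝ (E d)))) z.2.2 :=
    (hasFDerivAt_const _ _).prodMk ((hasFDerivAt_const _ _).prodMk (hasFDerivAt_id _))
  have h2 := (HasFDerivAt.comp (g := φ) z.2.2 hφ.hasFDerivAt h1)
  have h3 : fderiv ℝ (fun w : E d => φ (z.1, z.2.1, w)) z.2.2 = _ := h2.fderiv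
  unfold gradV gradient
  rw [InnerProductSpace.toDual_symm_apply, h3]
  rfl

theorem gradV_apply {φ : Phase d → ℝ} {z : Phase d} (hφ : DifferentiableAt ℝ φ z) (i : Fin d) :
    gradV φ z i = derivV (EuclideanSpace.single i 1) φ z := by
  rw [← inner_gradV hφ, EuclideanSpace.inner_single_right]
  simp

theorem hasFDerivAt_pull (α γ : ℝ) (z z' : Phase d) :
    HasFDerivAt (pull α γ z)
      ((α • ContinuousLinearMap.fst ℝ ℝ (E d × E d)).prod
        (((α * γ) • ((ContinuousLinearMap.fst ℝ (E d) (E d)).comp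
            (ContinuousLinearMap.snd ℝ ℝ (E d × E d))
          - (ContinuousLinearMap.fst ℝ ℝ (E d × E d)).smulRight z.2.2)).prod
        (γ • (ContinuousLinearMap.snd ℝ (E d) (E d)).comp
          (ContinuousLinearMap.snd ℝ ℝ (E d × E d))))) z' := by
  have h1 : HasFDerivAt (fun z' : Phase d => z'.1 - z.1)
      (ContinuousLinearMap.fst ℝ ℝ (E d × E d)) z' := hasFDerivAt_fst.sub_const _
  have h2 : HasFDerivAt (fun z' : Phase d => z'.2.1 - z.2.1)
      ((ContinuousLinearMap.fst ℝ (E d) (E d)).comp (ContinuousLinearMap.snd ℝ ℝ (E d × E d))) z' :=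
    (HasFDerivAt.comp z' (g := fun q : E d × E d => q.1) hasFDerivAt_fst hasFDerivAt_snd).sub_const _
  have h3 : HasFDerivAt (fun z' : Phase d => z'.2.2 - z.2.2)
      ((ContinuousLinearMap.snd ℝ (E d) (E d)).comp (ContinuousLinearMap.snd ℝ ℝ (E d × E d))) z' :=
    (HasFDerivAt.comp z' (g := fun q : E d × E d => q.2) hasFDerivAt_snd hasFDerivAt_snd).sub_const _
  exact (h1.const_mul α).prodMk (((h2.sub (h1.smul_const z.2.2)).const_smul (α * γ)).prodMk
    (h3.const_smul γ))

theorem fderiv_comp_pull {k : Phase d → ℝ} (hk : Differentiable ℝ k) (α γ : ℝ) (z z' u : Phase d) :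
    fderiv ℝ (fun z' => k (pull α γ z z')) z' u
      = fderiv ℝ k (pull α γ z z') (α * u.1, (α * γ) • (u.2.1 - u.1 • z.2.2), γ • u.2.2) := by
  have h := ((hk (pull α γ z z')).hasFDerivAt.comp z' (hasFDerivAt_pull α γ z z')).fderiv
  have h' : fderiv ℝ (fun z' => k (pull α γ z z')) z' = _ := h
  rw [h']
  rfl

/-- This is Galilean invariance: the differential of `pull` sends the transport field `(1, v', 0)`
to `α (1, γ (v' - v), 0)`, again the transport field, at the image point. -/
theorem transport_comp_pull {k : Phase d → ℝ} (hk : Differentiable ℝ k) (α γ : ℝ)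
    (z z' : Phase d) :
    transport (fun z' => k (pull α γ z z')) z' = α * transport k (pull α γ z z') := by
  unfold transport
  rw [fderiv_comp_pull hk, ← smul_eq_mul α (fderiv ℝ k _ _), ← map_smul]
  congr 1
  simp [pull, mul_smul]

theorem derivV_comp_pull {k : Phase d → ℝ} (hk : Differentiable ℝ k) (α γ : ℝ)
    (z z' : Phase d) (e : E d) :
    derivV e (fun z' => k (pull α γ z z')) z' = γ * derivV e k (pull α γ z z') := by
  unfold derivV
  rw [fderiv_comp_pull hk, ← smul_eq_mul γ (fderiv ℝ k _ _), ← map_smul]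
  congr 1
  simp

theorem gradV_comp_pull {k : Phase d → ℝ} (hk : Differentiable ℝ k) (α γ : ℝ)
    (z z' : Phase d) :
    gradV (fun z' => k (pull α γ z z')) z' = γ • gradV k (pull α γ z z') := by
  have h : DifferentiableAt ℝ (fun z' => k (pull α γ z z')) z' :=
    ((hk (pull α γ z z')).hasFDerivAt.comp z' (hasFDerivAt_pull α γ z z')).differentiableAt
  ext i
  rw [gradV_apply h, derivV_comp_pull hk, PiLp.smul_apply, gradV_apply (hk _), smul_eq_mul]

/-! ### The dilation generator as a combination of transport and velocity derivatives. -/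

/-- The position field `3 y - 2 s w`, which measures the defect between the generator of the
kinetic dilations and a combination of the transport field and the velocity fields. -/
def defect (z : Phase d) : E d := (3 : ℝ) • z.2.1 - (2 * z.1) • z.2.2

/-- The divergence of `ψ` times the generator of the kinetic dilations. -/
def euler (ψ : Phase d → ℝ) (z : Phase d) : ℝ :=
  (4 * d + 2) * ψ z + fderiv ℝ ψ z (2 * z.1, (3 : ℝ) • z.2.1, z.2.2)

/-- The transport potential of `euler ψ`. -/
def potT (ψ : Phase d → ℝ) (z : Phase d) : ℝ :=
  (2 + 2 * d) * (z.1 * ψ z) - fderiv ℝ ψ z (0, 0, defect z)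

/-- The velocity potential of `euler ψ`. -/
def potV (i : Fin d) (ψ : Phase d → ℝ) (z : Phase d) : ℝ :=
  2 * (z.2.2 i * ψ z) + defect z i * transport ψ z

theorem contDiff_fderiv_apply {ψ : Phase d → ℝ} (hψ : ContDiff ℝ ∞ ψ) {V : Phase d → Phase d}
    (hV : ContDiff ℝ ∞ V) : ContDiff ℝ ∞ (fun z => fderiv ℝ ψ z (V z)) :=
  (hψ.fderiv_right (m := ∞) (by simp)).clm_apply hV

theorem contDiff_transport {ψ : Phase d → ℝ} (hψ : ContDiff ℝ ∞ ψ) :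
    ContDiff ℝ ∞ (transport ψ) :=
  contDiff_fderiv_apply hψ (by fun_prop)

theorem contDiff_derivV {ψ : Phase d → ℝ} (hψ : ContDiff ℝ ∞ ψ) (e : E d) :
    ContDiff ℝ ∞ (derivV e ψ) :=
  contDiff_fderiv_apply hψ (by fun_prop)

theorem contDiff_defect : ContDiff ℝ ∞ (defect (d := d)) := by
  unfold defect; fun_prop

theorem contDiff_euler {ψ : Phase d → ℝ} (hψ : ContDiff ℝ ∞ ψ) :
    ContDiff ℝ ∞ (euler ψ) :=
  (contDiff_const.mul hψ).add (contDiff_fderiv_apply hψ (by fun_prop))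

theorem contDiff_potT {ψ : Phase d → ℝ} (hψ : ContDiff ℝ ∞ ψ) :
    ContDiff ℝ ∞ (potT ψ) :=
  (contDiff_const.mul (contDiff_fst.mul hψ)).sub
    (contDiff_fderiv_apply hψ (contDiff_const.prodMk (contDiff_const.prodMk contDiff_defect)))

theorem contDiff_potV {ψ : Phase d → ℝ} (hψ : ContDiff ℝ ∞ ψ) (i : Fin d) :
    ContDiff ℝ ∞ (potV i ψ) := by
  have h1 : ContDiff ℝ ∞ (fun z : Phase d => z.2.2 i) := by fun_prop
  have h2 : ContDiff ℝ ∞ (fun z : Phase d => defect z i) := by unfold defect; fun_prop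
  exact (contDiff_const.mul (h1.mul hψ)).add (h2.mul (contDiff_transport hψ))

theorem tsupport_fderiv_apply_subset (ψ : Phase d → ℝ) (V : Phase d → Phase d) :
    tsupport (fun z => fderiv ℝ ψ z (V z)) ⊆ tsupport ψ := by
  refine closure_minimal (fun z hz => ?_) (isClosed_tsupport _)
  by_contra h
  exact hz (by simp [fderiv_of_notMem_tsupport ℝ h])

theorem eq_zero_of_notMem_tsupport {ψ : Phase d → ℝ} {V : Phase d → Phase d} {z : Phase d}
    (h : z ∉ tsupport ψ) : ψ z = 0 ∧ fderiv ℝ ψ z (V z) = 0 :=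
  ⟨image_eq_zero_of_notMem_tsupport h, by simp [fderiv_of_notMem_tsupport ℝ h]⟩

/-- With `T` the transport operator, the generator is `2 s T + defect · ∇_y + w · ∇_w`, and `∇_y` is
the commutator of `∇_w` with `T`. Hence `defect · ∇_y ψ` is the velocity divergence of `defect · Tψ`
minus `T` of `defect · ∇_w ψ`, up to terms in which the coefficients are differentiated. There `T
defect = w` explains the coefficient `2` of `w ψ` in `potV`, and the velocity divergence `-2 d s` of
`defect` explains the extra `2 d` in `potT`. The zeroth order terms add up to `4 d + 2 = 2 + 3 d +
d`, the homogeneous dimension. -/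
theorem euler_eq {ψ : Phase d → ℝ} (hψ : ContDiff ℝ ∞ ψ) (z : Phase d) :
    euler ψ z = transport (potT ψ) z
      + ∑ i, derivV (EuclideanSpace.single i 1) (potV i ψ) z := by
  set P : Phase d →L[ℝ] ℝ := fderiv ℝ ψ z with hP
  set Q : Phase d →L[ℝ] Phase d →L[ℝ] ℝ := fderiv ℝ (fderiv ℝ ψ) z with hQ
  have hsymm : ∀ u v, Q u v = Q v u := by
    have h2 : ContDiff ℝ 2 ψ := hψ.of_le (by norm_cast)
    have := (h2.contDiffAt (x := z)).isSymmSndFDerivAt (by simp)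
    exact fun u v => this u v
  have hψ1 : HasFDerivAt ψ P z := (hψ.differentiable (by simp) z).hasFDerivAt
  have hψ2 : HasFDerivAt (fderiv ℝ ψ) Q z :=
    ((hψ.fderiv_right (m := ∞) (by simp)).differentiable (by simp) z).hasFDerivAt
  have hw : HasFDerivAt (fun z : Phase d => z.2.2)
      ((ContinuousLinearMap.snd ℝ (E d) (E d)).comp (ContinuousLinearMap.snd ℝ ℝ (E d × E d))) z :=
    HasFDerivAt.comp z (g := fun q : E d × E d => q.2) hasFDerivAt_snd hasFDerivAt_snd
  have hy : HasFDerivAt (fun z : Phase d => z.2.1)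
      ((ContinuousLinearMap.fst ℝ (E d) (E d)).comp (ContinuousLinearMap.snd ℝ ℝ (E d × E d))) z :=
    HasFDerivAt.comp z (g := fun q : E d × E d => q.1) hasFDerivAt_fst hasFDerivAt_snd
  have hs : HasFDerivAt (fun z : Phase d => z.1)
      (ContinuousLinearMap.fst ℝ ℝ (E d × E d)) z := hasFDerivAt_fst
  have hc := ((hy.const_smul (3 : ℝ)).sub ((hs.const_mul 2).smul hw))
  change HasFDerivAt (defect (d := d)) _ z at hc
  have hT : HasFDerivAt (transport ψ) _ z := hψ2.clm_apply
    ((hasFDerivAt_const (1 : ℝ) z).prodMk (hw.prodMk (hasFDerivAt_const (0 : E d) z)))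
  have hC := hψ2.clm_apply
    ((hasFDerivAt_const (0 : ℝ) z).prodMk ((hasFDerivAt_const (0 : E d) z).prodMk hc))
  have e1 : transport (potT ψ) z = (2 + 2 * d) * (ψ z + z.1 * transport ψ z)
      - (P (0, 0, z.2.2) + Q (1, z.2.2, 0) (0, 0, defect z)) := by
    have h := (((hs.mul hψ1).const_mul (2 + 2 * (d : ℝ))).sub hC).fderiv
    change fderiv ℝ (potT ψ) z = _ at h
    unfold transport
    rw [h]
    have : (3 : ℝ) • z.2.2 - (2 : ℝ) • z.2.2 = z.2.2 := by rw [← sub_smul]; norm_num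
    simp [hP, this]
    ring
  have e2 : ∀ i, derivV (EuclideanSpace.single i 1) (potV i ψ) z
      = 2 * ψ z + 2 * (z.2.2 i * P (0, 0, EuclideanSpace.single i 1))
        - 2 * z.1 * transport ψ z + defect z i * P (0, EuclideanSpace.single i 1, 0)
        + defect z i * Q (0, 0, EuclideanSpace.single i 1) (1, z.2.2, 0) := by
    intro i
    have hwi := ((EuclideanSpace.proj i : E d →L[ℝ] ℝ).hasFDerivAt (x := z.2.2)).comp z hw
    have hci := ((EuclideanSpace.proj i : E d →L[ℝ] ℝ).hasFDerivAt (x := defect z)).comp z hc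
    have h := (((hwi.mul hψ1).const_mul 2).add (hci.mul hT)).fderiv
    change fderiv ℝ (potV i ψ) z = _ at h
    unfold derivV
    rw [h]
    simp [hP, transport]
    ring
  have hlin : ∀ (T : E d →L[ℝ] ℝ) (u : E d),
      ∑ i, u i * T (EuclideanSpace.single i 1) = T u := by
    intro T u
    conv_rhs => rw [← (EuclideanSpace.basisFun (Fin d) ℝ).sum_repr u]
    simp [map_sum]
  have f1 : ∑ i, z.2.2 i * P (0, 0, EuclideanSpace.single i 1) = P (0, 0, z.2.2) :=
    hlin (P.comp ((ContinuousLinearMap.inr ℝ ℝ (E d × E d)).comp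
      (ContinuousLinearMap.inr ℝ (E d) (E d)))) z.2.2
  have f2 : ∑ i, defect z i * P (0, EuclideanSpace.single i 1, 0) = P (0, defect z, 0) :=
    hlin (P.comp ((ContinuousLinearMap.inr ℝ ℝ (E d × E d)).comp
      (ContinuousLinearMap.inl ℝ (E d) (E d)))) (defect z)
  have f3 : ∑ i, defect z i * Q (0, 0, EuclideanSpace.single i 1) (1, z.2.2, 0)
      = Q (0, 0, defect z) (1, z.2.2, 0) :=
    hlin ((Q.flip (1, z.2.2, 0)).comp ((ContinuousLinearMap.inr ℝ ℝ (E d × E d)).comp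
      (ContinuousLinearMap.inr ℝ (E d) (E d)))) (defect z)
  have f4 : fderiv ℝ ψ z (2 * z.1, (3 : ℝ) • z.2.1, z.2.2)
      = 2 * z.1 * transport ψ z + P (0, defect z, 0) + P (0, 0, z.2.2) := by
    unfold transport
    rw [← hP, ← smul_eq_mul (2 * z.1) (P _), ← map_smul, ← map_add, ← map_add]
    congr 1
    simp [defect]
  simp only [e2, Finset.sum_add_distrib, Finset.sum_sub_distrib, f2, f3, ← Finset.mul_sum, f1, e1]
  unfold euler
  -- The two mixed second derivatives, transport against `defect` in velocity, cancel by symmetry of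
  -- the Hessian.
  rw [f4, hsymm (0, 0, defect z)]
  simp
  ring

/-! ### Kernels at scale `σ` and their derivatives. -/

/-- The inverse of `pull α⁻¹ γ⁻¹ z`. -/
def push (α γ : ℝ) (z w : Phase d) : Phase d :=
  (z.1 + α * w.1, z.2.1 + (α * w.1) • z.2.2 + (α * γ) • w.2.1, z.2.2 + γ • w.2.2)

theorem push_pull {α γ : ℝ} (hα : α ≠ 0) (hγ : γ ≠ 0) (z z' : Phase d) :
    push α γ z (pull α⁻¹ γ⁻¹ z z') = z' := by
  have h1 : α * γ * (α⁻¹ * γ⁻¹) = 1 := by field_simp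
  simp [push, pull, smul_smul, hα, hγ, h1]

theorem continuous_push (α γ : ℝ) (z : Phase d) : Continuous (push α γ z) := by
  unfold push; fun_prop

/-- The kernel `k`, transplanted to the kinetic cylinder of centre `z`, velocity scale `σ` and
time scale `τ σ²`. -/
def kern (τ σ : ℝ) (k : Phase d → ℝ) (z z' : Phase d) : ℝ :=
  jac d (τ * σ ^ 2)⁻¹ σ⁻¹ * k (pull (τ * σ ^ 2)⁻¹ σ⁻¹ z z')

section kern

variable {τ σ : ℝ} {k : Phase d → ℝ}

theorem jac_kern_pos (hτ : 0 < τ) (hσ : 0 < σ) : 0 < jac d (τ * σ ^ 2)⁻¹ σ⁻¹ :=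
  jac_pos (by positivity) (by positivity)

theorem kern_nonneg (hτ : 0 < τ) (hσ : 0 < σ) (hk : ∀ w, 0 ≤ k w) (z z' : Phase d) :
    0 ≤ kern τ σ k z z' :=
  mul_nonneg (jac_kern_pos hτ hσ).le (hk _)

theorem contDiff_kern (hk : ContDiff ℝ ∞ k) (z : Phase d) : ContDiff ℝ ∞ (kern τ σ k z) :=
  contDiff_const.mul (hk.comp (contDiff_pull _ _ z))

theorem continuous_kern (hk : Continuous k) (z : Phase d) : Continuous (kern τ σ k z) :=
  continuous_const.mul (hk.comp (continuous_pull_right _ _ z))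

theorem continuous_uncurry_kern (hk : Continuous k) :
    Continuous (fun p : Phase d × Phase d => kern τ σ k p.1 p.2) :=
  continuous_const.mul (hk.comp (continuous_pull _ _))

theorem tsupport_kern_subset (z : Phase d) :
    tsupport (kern τ σ k z) ⊆ pull (τ * σ ^ 2)⁻¹ σ⁻¹ z ⁻¹' tsupport k := by
  refine closure_minimal (fun z' hz' => ?_)
    ((isClosed_tsupport k).preimage (continuous_pull_right _ _ z))
  refine subset_tsupport k fun h => hz' ?_
  rw [kern, h, mul_zero]

theorem hasCompactSupport_kern (hτ : 0 < τ) (hσ : 0 < σ) (hk : HasCompactSupport k) (z : Phase d) :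
    HasCompactSupport (kern τ σ k z) := by
  refine (hk.isCompact.image (continuous_push (τ * σ ^ 2) σ z)).of_isClosed_subset
    (isClosed_tsupport _) fun z' hz' => ?_
  exact ⟨_, tsupport_kern_subset z hz', push_pull (by positivity) hσ.ne' z z'⟩

theorem transport_kern (hτ : 0 < τ) (hσ : 0 < σ) (hk : ContDiff ℝ ∞ k) (z z' : Phase d) :
    τ * σ ^ 2 * transport (kern τ σ k z) z' = kern τ σ (transport k) z z' := by
  have hd := hk.differentiable (by simp)
  have h1 : DifferentiableAt ℝ (fun z' => k (pull (τ * σ ^ 2)⁻¹ σ⁻¹ z z')) z' :=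
    ((hk.comp (contDiff_pull _ _ z)).differentiable (by simp)) z'
  have h : transport (kern τ σ k z) z'
      = jac d (τ * σ ^ 2)⁻¹ σ⁻¹ * transport (fun z' => k (pull (τ * σ ^ 2)⁻¹ σ⁻¹ z z')) z' := by
    unfold transport kern
    rw [fderiv_const_mul h1]
    rfl
  rw [h, transport_comp_pull hd]
  unfold kern
  field_simp

theorem derivV_kern (hσ : 0 < σ) (hk : ContDiff ℝ ∞ k) (z z' : Phase d) (e : E d) :
    σ * derivV e (kern τ σ k z) z' = kern τ σ (derivV e k) z z' := by
  have hd := hk.differentiable (by simp)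
  have h1 : DifferentiableAt ℝ (fun z' => k (pull (τ * σ ^ 2)⁻¹ σ⁻¹ z z')) z' :=
    ((hk.comp (contDiff_pull _ _ z)).differentiable (by simp)) z'
  have h : derivV e (kern τ σ k z) z'
      = jac d (τ * σ ^ 2)⁻¹ σ⁻¹ * derivV e (fun z' => k (pull (τ * σ ^ 2)⁻¹ σ⁻¹ z z')) z' := by
    unfold derivV kern
    rw [fderiv_const_mul h1]
    rfl
  rw [h, derivV_comp_pull hd]
  unfold kern
  field_simp

theorem jac_kern_eq (τ σ : ℝ) :
    jac d (τ * σ ^ 2)⁻¹ σ⁻¹ = (τ ^ (d + 1))⁻¹ * (σ⁻¹) ^ (4 * d + 2) := by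
  unfold jac
  rw [mul_inv, mul_pow, inv_pow τ, ← inv_pow σ, ← pow_mul, mul_assoc, ← pow_add]
  congr 2
  ring

/-- Changing `σ` moves the argument of `k` along the dilation generator `(2 s, 3 y, w)`, and the
normalization `σ ^ (-(4 d + 2))` supplies the divergence of that generator; together they form
`euler k`. -/
theorem hasDerivAt_kern (hτ : 0 < τ) (hσ : 0 < σ) (hk : ContDiff ℝ ∞ k) (z z' : Phase d) :
    HasDerivAt (fun σ => kern τ σ k z z') (-(σ⁻¹ * kern τ σ (euler k) z z')) σ := by
  have hi : HasDerivAt (fun σ : ℝ => σ⁻¹) (-(σ ^ 2)⁻¹) σ := hasDerivAt_inv hσ.ne'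
  have hJ : HasDerivAt (fun σ : ℝ => (τ ^ (d + 1))⁻¹ * (σ⁻¹) ^ (4 * d + 2))
      ((τ ^ (d + 1))⁻¹ * (((4 * d + 2 : ℕ) : ℝ) * (σ⁻¹) ^ (4 * d + 1) * (-(σ ^ 2)⁻¹))) σ :=
    (hi.pow (4 * d + 2)).const_mul _
  have hs : HasDerivAt (fun σ : ℝ => (τ * σ ^ 2)⁻¹) (-(σ⁻¹ * (2 * (τ * σ ^ 2)⁻¹))) σ := by
    have h : HasDerivAt (fun σ : ℝ => (τ * σ ^ 2)⁻¹) _ σ :=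
      ((hasDerivAt_pow 2 σ).const_mul τ).inv (by positivity)
    refine h.congr_deriv ?_
    field_simp
    norm_num
    ring
  have hy : HasDerivAt (fun σ : ℝ => (τ * σ ^ 2)⁻¹ * σ⁻¹)
      (-(σ⁻¹ * (3 * ((τ * σ ^ 2)⁻¹ * σ⁻¹)))) σ := by
    refine (hs.mul hi).congr_deriv ?_
    field_simp
    ring
  have hp : HasDerivAt (fun σ : ℝ => pull (τ * σ ^ 2)⁻¹ σ⁻¹ z z')
      (-σ⁻¹ • ((2 * (pull (τ * σ ^ 2)⁻¹ σ⁻¹ z z').1, (3 : ℝ) • (pull (τ * σ ^ 2)⁻¹ σ⁻¹ z z').2.1,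
        (pull (τ * σ ^ 2)⁻¹ σ⁻¹ z z').2.2) : Phase d)) σ := by
    refine ((hs.mul_const (z'.1 - z.1)).prodMk
      ((hy.smul_const (z'.2.1 - z.2.1 - (z'.1 - z.1) • z.2.2)).prodMk
        (hi.smul_const (z'.2.2 - z.2.2)))).congr_deriv ?_
    simp only [pull, Prod.smul_mk, smul_smul, smul_eq_mul, Prod.mk.injEq]
    refine ⟨by ring, ?_, ?_⟩
    · congr 1; ring
    · congr 1; field_simp
  have hkp := ((hk.differentiable (by simp) (pull (τ * σ ^ 2)⁻¹ σ⁻¹ z z')).hasFDerivAt.comp_hasDerivAt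
    σ hp)
  have hfin := hJ.mul hkp
  have hev : (fun σ => kern τ σ k z z') =ᶠ[nhds σ]
      (fun σ => (τ ^ (d + 1))⁻¹ * (σ⁻¹) ^ (4 * d + 2) * k (pull (τ * σ ^ 2)⁻¹ σ⁻¹ z z')) := by
    filter_upwards [lt_mem_nhds hσ] with s hs
    rw [kern, jac_kern_eq]
  refine (hfin.congr_of_eventuallyEq hev).congr_deriv ?_
  rw [map_smul, kern, jac_kern_eq, euler]
  simp only [Function.comp_apply, smul_eq_mul]
  push_cast
  have : (σ ^ 2)⁻¹ = σ⁻¹ * σ⁻¹ := by field_simp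
  rw [this, pow_succ (σ⁻¹) (4 * d + 1)]
  ring

/-- Position translations are central in the Galilean group: moving the centre by `h` moves the
rescaled position by `h / (τ σ³)` and changes neither time nor velocity. Position increments
therefore act on the profile alone. -/
theorem kern_add_position (h : E d) (z z' : Phase d) :
    kern τ σ k (z + (0, h, 0)) z'
      = kern τ σ (fun w => k (w - (0, ((τ * σ ^ 2)⁻¹ * σ⁻¹) • h, 0))) z z' := by
  unfold kern
  congr 2
  simp only [pull, Prod.fst_add, Prod.snd_add, add_zero, Prod.mk_sub_mk, sub_zero, Prod.mk.injEq,
    true_and, and_true]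
  rw [← smul_sub]
  congr 1
  abel

end kern

/-! ### Sub-solutions, the defect functional and its pairing with kernels. -/

theorem integrable_mul_of_hasCompactSupport {f φ : Phase d → ℝ} (hf : Integrable f)
    (hφ : Continuous φ) (hc : HasCompactSupport φ) : Integrable (fun z => f z * φ z) := by
  obtain ⟨C, hC⟩ := hφ.bounded_above_of_compact_support hc
  exact hf.mul_bdd (c := C) hφ.aestronglyMeasurable (Filter.Eventually.of_forall hC)

/-- The defect functional of an inequality `(∂_t + v · ∇_x) f ≤ div_v F + b`. -/
def functional (f b : Phase d → ℝ) (F : Phase d → E d) (φ : Phase d → ℝ) : ℝ :=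
  ∫ z, (f z * transport φ z - inner ℝ (F z) (gradV φ z) + b z * φ z)

/-- `f` satisfies `(∂_t + v · ∇_x) f ≤ div_v F + b` and `∇_v f = G` weakly in the open set `O`;
the data are defined and integrable on the whole space. -/
structure IsSubsolutionOn (O : Set (Phase d)) (f b : Phase d → ℝ) (F G : Phase d → E d) : Prop where
  measurable_f : Measurable f
  measurable_b : Measurable b
  measurable_F : Measurable F
  measurable_G : Measurable G
  integrable_f : Integrable f
  integrable_b : Integrable b
  integrable_F : Integrable F
  integrable_G : Integrable G
  grad : ∀ φ, IsTest O φ → ∀ i, ∫ z, f z * derivV (EuclideanSpace.single i 1) φ z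
    = -∫ z, G z i * φ z
  nonneg : ∀ φ, IsTest O φ → (∀ z, 0 ≤ φ z) → 0 ≤ functional f b F φ

theorem hasCompactSupport_transport {φ : Phase d → ℝ} (hc : HasCompactSupport φ) :
    HasCompactSupport (transport φ) :=
  hc.mono' ((subset_tsupport _).trans (tsupport_fderiv_apply_subset φ _))

theorem hasCompactSupport_derivV {φ : Phase d → ℝ} (hc : HasCompactSupport φ) (e : E d) :
    HasCompactSupport (derivV e φ) :=
  hc.mono' ((subset_tsupport _).trans (tsupport_fderiv_apply_subset φ _))

theorem inner_eq_sum (u v : E d) : inner ℝ u v = ∑ i, u i * v i := by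
  simp [PiLp.inner_apply, mul_comm]

theorem integrable_apply {F : Phase d → E d} (hF : Integrable F) (i : Fin d) :
    Integrable (fun z => F z i) :=
  (EuclideanSpace.proj i : E d →L[ℝ] ℝ).integrable_comp hF

theorem functional_eq {f b : Phase d → ℝ} {F : Phase d → E d} (hf : Integrable f)
    (hb : Integrable b) (hF : Integrable F) {φ : Phase d → ℝ} (hφ : ContDiff ℝ ∞ φ)
    (hc : HasCompactSupport φ) :
    functional f b F φ = (∫ z, f z * transport φ z)
      - (∑ i, ∫ z, F z i * derivV (EuclideanSpace.single i 1) φ z) + ∫ z, b z * φ z := by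
  have h1 := integrable_mul_of_hasCompactSupport hf (contDiff_transport hφ).continuous
    (hasCompactSupport_transport hc)
  have h3 := integrable_mul_of_hasCompactSupport hb hφ.continuous hc
  have h2 : ∀ i ∈ (Finset.univ : Finset (Fin d)),
      Integrable (fun z => F z i * derivV (EuclideanSpace.single i 1) φ z) :=
    fun i _ => integrable_mul_of_hasCompactSupport (integrable_apply hF i)
      (contDiff_derivV hφ _).continuous (hasCompactSupport_derivV hc _)
  rw [← integral_finsetSum _ h2, ← integral_sub h1 (integrable_finsetSum _ h2),
    ← integral_add (f := fun z => _ - _) (h1.sub (integrable_finsetSum _ h2)) h3]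
  unfold functional
  congr 1 with z
  have hd : DifferentiableAt ℝ φ z := hφ.differentiable (by simp) z
  rw [inner_eq_sum]
  simp only [gradV_apply hd]

theorem tsupport_potT_subset (ψ : Phase d → ℝ) : tsupport (potT ψ) ⊆ tsupport ψ := by
  refine closure_minimal (fun w hw => ?_) (isClosed_tsupport _)
  by_contra h
  obtain ⟨h1, h2⟩ := eq_zero_of_notMem_tsupport (V := fun w => (0, 0, defect w)) h
  exact hw (by simp [potT, h1, h2])

theorem tsupport_potV_subset (ψ : Phase d → ℝ) (i : Fin d) : tsupport (potV i ψ) ⊆ tsupport ψ := by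
  refine closure_minimal (fun w hw => ?_) (isClosed_tsupport _)
  by_contra h
  obtain ⟨h1, h2⟩ := eq_zero_of_notMem_tsupport (V := fun w => (1, w.2.2, 0)) h
  exact hw (by simp [potV, h1, transport, h2])

/-- The pairing of `f` with the derivative of a kernel in its scale, in terms of the defect
functional and of the data. -/
theorem IsSubsolutionOn.integral_mul_kern_euler {O : Set (Phase d)} {f b : Phase d → ℝ}
    {F G : Phase d → E d} (hO : IsOpen O) (H : IsSubsolutionOn O f b F G) {τ σ : ℝ}
    (hτ : 0 < τ) (hσ : 0 < σ) {ψ : Phase d → ℝ} (hψ : ContDiff ℝ ∞ ψ) (hc : HasCompactSupport ψ)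
    {z : Phase d} (hz : pull (τ * σ ^ 2)⁻¹ σ⁻¹ z ⁻¹' tsupport ψ ⊆ O) :
    ∫ z', f z' * kern τ σ (euler ψ) z z'
      = τ * σ ^ 2 * functional f b F (kern τ σ (potT ψ) z)
        + τ * σ * (∑ i, ∫ z', F z' i * kern τ σ (derivV (EuclideanSpace.single i 1) (potT ψ)) z z')
        - τ * σ ^ 2 * (∫ z', b z' * kern τ σ (potT ψ) z z')
        - σ * ∑ i, ∫ z', G z' i * kern τ σ (potV i ψ) z z' := by
  have hT := contDiff_potT hψ
  have hV := contDiff_potV hψ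
  have sT := tsupport_potT_subset ψ
  have sV := tsupport_potV_subset ψ
  have cT : HasCompactSupport (potT ψ) := hc.of_isClosed_subset (isClosed_tsupport _) sT
  have cV : ∀ i, HasCompactSupport (potV i ψ) :=
    fun i => hc.of_isClosed_subset (isClosed_tsupport _) (sV i)
  -- The kernels on `potV` are test functions for the weak gradient. Those on `potT` have no sign,
  -- so the inequality does not apply to them and the value of the defect functional is kept as an
  -- unknown.
  have tV : ∀ i, IsTest O (kern τ σ (potV i ψ) z) := fun i =>
    { contDiff := contDiff_kern (hV i) z
      hasCompactSupport := hasCompactSupport_kern hτ hσ (cV i) z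
      tsupport_subset := by
        rw [hO.interior_eq]
        exact (tsupport_kern_subset z).trans ((preimage_mono (sV i)).trans hz) }
  have e1 : ∀ z', kern τ σ (euler ψ) z z' = τ * σ ^ 2 * transport (kern τ σ (potT ψ) z) z'
      + ∑ i, σ * derivV (EuclideanSpace.single i 1) (kern τ σ (potV i ψ) z) z' := by
    intro z'
    rw [transport_kern hτ hσ hT]
    simp only [derivV_kern hσ (hV _)]
    unfold kern
    rw [euler_eq hψ, mul_add, Finset.mul_sum]
  have i1 : Integrable (fun z' => f z' * transport (kern τ σ (potT ψ) z) z') :=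
    integrable_mul_of_hasCompactSupport H.integrable_f
      (contDiff_transport (contDiff_kern hT z)).continuous
      (hasCompactSupport_transport (hasCompactSupport_kern hτ hσ cT z))
  have i2 : ∀ i, Integrable (fun z' => f z' *
      derivV (EuclideanSpace.single i 1) (kern τ σ (potV i ψ) z) z') := fun i =>
    integrable_mul_of_hasCompactSupport H.integrable_f
      (contDiff_derivV (contDiff_kern (hV i) z) _).continuous
      (hasCompactSupport_derivV (hasCompactSupport_kern hτ hσ (cV i) z) _)
  have e2 : ∫ z', f z' * kern τ σ (euler ψ) z z'
      = τ * σ ^ 2 * (∫ z', f z' * transport (kern τ σ (potT ψ) z) z')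
        + ∑ i, σ * ∫ z', f z' *
          derivV (EuclideanSpace.single i 1) (kern τ σ (potV i ψ) z) z' := by
    simp only [← integral_const_mul]
    rw [← integral_finsetSum _ (fun i _ => (i2 i).const_mul σ),
      ← integral_add (i1.const_mul _) (integrable_finsetSum _ fun i _ => (i2 i).const_mul σ)]
    congr 1 with z'
    rw [e1, mul_add, Finset.mul_sum]
    congr 1
    · ring
    · exact Finset.sum_congr rfl fun i _ => by ring
  have e3 := functional_eq H.integrable_f H.integrable_b H.integrable_F (contDiff_kern hT z)
    (hasCompactSupport_kern hτ hσ cT z)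
  have e4 : ∀ i, ∫ z', F z' i * kern τ σ (derivV (EuclideanSpace.single i 1) (potT ψ)) z z'
      = σ * ∫ z', F z' i * derivV (EuclideanSpace.single i 1) (kern τ σ (potT ψ) z) z' := by
    intro i
    rw [← integral_const_mul]
    congr 1 with z'
    rw [← derivV_kern hσ hT]
    ring
  simp only [e4, e2, H.grad _ (tV _), e3, Finset.mul_sum, mul_neg, Finset.sum_neg_distrib]
  rw [mul_add, mul_sub, Finset.mul_sum]
  have : ∀ x : ℝ, τ * σ * (σ * x) = τ * σ ^ 2 * x := fun x => by ring
  simp only [this]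
  ring

/-! ### Increments in position, of kernels and of the defect functional. -/

/-- The fundamental theorem of calculus under the integral sign, as an estimate. -/
theorem enorm_integral_mul_sub_le {X : Type*} [MeasurableSpace X] {μ : Measure X} [SFinite μ]
    {f : X → ℝ} (hf : Integrable f μ) {K K' : ℝ → X → ℝ} {ρ s C : ℝ} (hρs : ρ ≤ s)
    (hder : ∀ σ ∈ Icc ρ s, ∀ x, HasDerivAt (fun σ => K σ x) (K' σ x) σ)
    (hcont : ∀ x, ContinuousOn (fun σ => K' σ x) (Icc ρ s))
    (hmeas : Measurable (Function.uncurry K'))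
    (hbound : ∀ σ ∈ Icc ρ s, ∀ x, |K' σ x| ≤ C)
    (hi : ∀ σ ∈ Icc ρ s, Integrable (fun x => f x * K σ x) μ) :
    ‖(∫ x, f x * K s x ∂μ) - ∫ x, f x * K ρ x ∂μ‖ₑ
      ≤ ∫⁻ σ in Ioc ρ s, ‖∫ x, f x * K' σ x ∂μ‖ₑ := by
  have h1 : ∀ x, f x * K s x - f x * K ρ x = ∫ σ in Ioc ρ s, f x * K' σ x := by
    intro x
    rw [integral_const_mul, ← mul_sub, ← intervalIntegral.integral_of_le hρs,
      intervalIntegral.integral_eq_sub_of_hasDerivAt (f := fun σ => K σ x)]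
    · intro σ hσ
      rw [uIcc_of_le hρs] at hσ
      exact hder σ hσ x
    · refine ContinuousOn.intervalIntegrable ?_
      rw [uIcc_of_le hρs]
      exact hcont x
  have h2 : Integrable (Function.uncurry fun x σ => f x * K' σ x)
      (μ.prod (volume.restrict (Ioc ρ s))) := by
    have h3 : Integrable (fun p : X × ℝ => f p.1) (μ.prod (volume.restrict (Ioc ρ s))) :=
      hf.comp_fst _
    refine h3.mul_bdd (c := C) ?_ ?_
    · exact (hmeas.comp measurable_swap).aestronglyMeasurable
    · have : ∀ᵐ p : X × ℝ ∂(μ.prod (volume.restrict (Ioc ρ s))), p.2 ∈ Ioc ρ s :=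
        Measure.quasiMeasurePreserving_snd.ae (ae_restrict_mem measurableSet_Ioc)
      filter_upwards [this] with p hp
      exact hbound p.2 (Ioc_subset_Icc_self hp) p.1
  rw [← integral_sub (hi s ⟨hρs, le_rfl⟩) (hi ρ ⟨le_rfl, hρs⟩)]
  simp only [h1]
  rw [integral_integral_swap h2]
  exact enorm_integral_le_lintegral_enorm _

/-- For `‖η‖ ≤ 1`, either `‖w‖ ≤ 2`, where `θ w = 1` and the Lipschitz bound applies, or both values
of `k` vanish because `k` lives in the unit ball. For `‖η‖ > 1` the triangle inequality and `|k| ≤ B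
θ` suffice. The sum of `θ` at both points is needed since a long translation separates the two
supports. -/
theorem exists_majorant {k θ : Phase d → ℝ} (hk : ContDiff ℝ ∞ k)
    (hks : tsupport k ⊆ Metric.closedBall 0 1) (hθ0 : ∀ w, 0 ≤ θ w)
    (hθ1 : ∀ w, ‖w‖ ≤ 2 → θ w = 1) :
    ∃ C : ℝ, 0 ≤ C ∧ ∀ w η, |k (w - η) - k w| ≤ C * min 1 ‖η‖ * (θ (w - η) + θ w) := by
  have hkc : HasCompactSupport k :=
    (isCompact_closedBall (0 : Phase d) 1).of_isClosed_subset (isClosed_tsupport _) hks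
  obtain ⟨A, hA⟩ := hk.lipschitzWith_of_hasCompactSupport hkc (by simp)
  obtain ⟨B, hB⟩ := hk.continuous.bounded_above_of_compact_support hkc
  have hB0 : 0 ≤ B := (norm_nonneg _).trans (hB 0)
  have hz : ∀ w, 1 < ‖w‖ → k w = 0 := fun w hw => image_eq_zero_of_notMem_tsupport fun h => by
    have := hks h
    rw [mem_closedBall_zero_iff] at this
    linarith
  have hkθ : ∀ w, |k w| ≤ B * θ w := by
    intro w
    by_cases hw : ‖w‖ ≤ 2
    · rw [hθ1 w hw, mul_one]
      exact hB w
    · rw [hz w (by linarith)]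
      simpa using mul_nonneg hB0 (hθ0 w)
  refine ⟨A + B, by positivity, fun w η => ?_⟩
  have hs : 0 ≤ θ (w - η) + θ w := add_nonneg (hθ0 _) (hθ0 _)
  rcases le_or_gt ‖η‖ 1 with h | h
  · rw [min_eq_right h]
    by_cases hw : ‖w‖ ≤ 2
    · have h1 : |k (w - η) - k w| ≤ A * ‖η‖ := by
        have := hA.dist_le_mul (w - η) w
        rwa [dist_eq_norm, dist_eq_norm, sub_sub_cancel_left, norm_neg] at this
      calc _ ≤ A * ‖η‖ * 1 := by rw [mul_one]; exact h1
        _ ≤ (A + B) * ‖η‖ * (θ (w - η) + θ w) := by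
          have : 1 ≤ θ (w - η) + θ w := by rw [hθ1 w hw]; linarith [hθ0 (w - η)]
          gcongr
          linarith
    · have h2 : ‖w‖ ≤ ‖w - η‖ + ‖η‖ := by simpa using norm_add_le (w - η) η
      rw [hz w (by linarith), hz (w - η) (by linarith)]
      simp only [sub_self, abs_zero]
      positivity
  · rw [min_eq_left h.le, mul_one]
    calc _ ≤ |k (w - η)| + |k w| := abs_sub _ _
      _ ≤ B * θ (w - η) + B * θ w := add_le_add (hkθ _) (hkθ _)
      _ = B * (θ (w - η) + θ w) := by ring
      _ ≤ _ := by
        gcongr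
        simp

/-- `k` has increments controlled by the kernel `θ`, with constant `C`. -/
def Dominates (θ : Phase d → ℝ) (C : ℝ) (k : Phase d → ℝ) : Prop :=
  ∀ w η, |k (w - η) - k w| ≤ C * min 1 ‖η‖ * (θ (w - η) + θ w)

/-- The size of a position increment `h` relative to the scales of a kernel, truncated at `1`. -/
def incr (τ σ : ℝ) (h : E d) : ℝ := min 1 (‖h‖ / (τ * σ ^ 3))

theorem incr_nonneg {τ σ : ℝ} (hτ : 0 < τ) (hσ : 0 < σ) (h : E d) : 0 ≤ incr τ σ h := by
  unfold incr; positivity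

theorem abs_kern_sub_le {τ σ C : ℝ} (hτ : 0 < τ) (hσ : 0 < σ) {k θ : Phase d → ℝ}
    (hk : Dominates θ C k) (h : E d) (z z' : Phase d) :
    |kern τ σ k (z + (0, h, 0)) z' - kern τ σ k z z'|
      ≤ C * incr τ σ h * (kern τ σ θ (z + (0, h, 0)) z' + kern τ σ θ z z') := by
  have hJ : 0 ≤ jac d (τ * σ ^ 2)⁻¹ σ⁻¹ := (jac_kern_pos hτ hσ).le
  have hη : ‖((0, ((τ * σ ^ 2)⁻¹ * σ⁻¹) • h, 0) : Phase d)‖ = ‖h‖ / (τ * σ ^ 3) := by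
    have h1 : 0 ≤ ‖((τ * σ ^ 2)⁻¹ * σ⁻¹) • h‖ := norm_nonneg _
    rw [Prod.norm_mk, Prod.norm_mk, norm_zero, norm_zero, max_eq_left h1, max_eq_right h1,
      norm_smul, Real.norm_of_nonneg (by positivity)]
    field_simp
  rw [kern_add_position, kern_add_position]
  unfold kern
  rw [← mul_sub, abs_mul, abs_of_nonneg hJ, ← mul_add, mul_left_comm]
  gcongr
  have := hk (pull (τ * σ ^ 2)⁻¹ σ⁻¹ z z') (0, ((τ * σ ^ 2)⁻¹ * σ⁻¹) • h, 0)
  rwa [hη] at this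

/-- The average of `g` against a kernel. -/
def avg (τ σ : ℝ) (θ : Phase d → ℝ) (g : Phase d → ℝ≥0∞) (z : Phase d) : ℝ≥0∞ :=
  ∫⁻ z', g z' * ENNReal.ofReal (kern τ σ θ z z')

theorem enorm_integral_kern_sub_le {τ σ C : ℝ} (hτ : 0 < τ) (hσ : 0 < σ) (hC : 0 ≤ C)
    {k θ : Phase d → ℝ}
    (hθ : Continuous θ) (hθ0 : ∀ w, 0 ≤ θ w) (hk : Dominates θ C k) {g : Phase d → ℝ}
    (hg : Measurable g) (h : E d) (z : Phase d) :
    ‖∫ z', g z' * (kern τ σ k (z + (0, h, 0)) z' - kern τ σ k z z')‖ₑ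
      ≤ ENNReal.ofReal (C * incr τ σ h) * (avg τ σ θ (fun z => ‖g z‖ₑ) (z + (0, h, 0))
        + avg τ σ θ (fun z => ‖g z‖ₑ) z) := by
  have hm : ∀ z, Measurable fun z' => ‖g z'‖ₑ * ENNReal.ofReal (kern τ σ θ z z') := fun z =>
    hg.enorm.mul (continuous_kern hθ z).measurable.ennreal_ofReal
  unfold avg
  rw [← lintegral_add_left (hm _), ← lintegral_const_mul _ (by exact (hm _).add (hm _))]
  refine (enorm_integral_le_lintegral_enorm _).trans (lintegral_mono fun z' => ?_)
  rw [enorm_mul, ← mul_add, mul_left_comm,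
    ← ENNReal.ofReal_add (kern_nonneg hτ hσ hθ0 _ _) (kern_nonneg hτ hσ hθ0 _ _),
    ← ENNReal.ofReal_mul (mul_nonneg hC (incr_nonneg hτ hσ h))]
  gcongr
  rw [Real.enorm_eq_ofReal_abs]
  exact ENNReal.ofReal_le_ofReal (abs_kern_sub_le hτ hσ hk h z z')

theorem integrable_functional {f b : Phase d → ℝ} {F : Phase d → E d} (hf : Integrable f)
    (hb : Integrable b) (hF : Integrable F) {φ : Phase d → ℝ} (hφ : ContDiff ℝ ∞ φ)
    (hc : HasCompactSupport φ) :
    Integrable (fun z => f z * transport φ z - inner ℝ (F z) (gradV φ z) + b z * φ z) := by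
  have h1 := integrable_mul_of_hasCompactSupport hf (contDiff_transport hφ).continuous
    (hasCompactSupport_transport hc)
  have h3 := integrable_mul_of_hasCompactSupport hb hφ.continuous hc
  have h2 : Integrable (fun z => inner ℝ (F z) (gradV φ z)) := by
    have : (fun z => inner ℝ (F z) (gradV φ z))
        = fun z => ∑ i, F z i * derivV (EuclideanSpace.single i 1) φ z := by
      ext z
      rw [inner_eq_sum]
      simp only [gradV_apply (hφ.differentiable (by simp) z)]
    rw [this]
    exact integrable_finsetSum _ fun i _ => integrable_mul_of_hasCompactSupport
      (integrable_apply hF i) (contDiff_derivV hφ _).continuous (hasCompactSupport_derivV hc _)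
  exact (h1.sub h2).add h3

theorem functional_add_const_mul {f b : Phase d → ℝ} {F : Phase d → E d} (hf : Integrable f)
    (hb : Integrable b) (hF : Integrable F) {φ χ : Phase d → ℝ} (hφ : ContDiff ℝ ∞ φ)
    (hφc : HasCompactSupport φ) (hχ : ContDiff ℝ ∞ χ) (hχc : HasCompactSupport χ) (c : ℝ) :
    functional f b F (fun z => φ z + c * χ z)
      = functional f b F φ + c * functional f b F χ := by
  unfold functional
  rw [← integral_const_mul, ← integral_add (integrable_functional hf hb hF hφ hφc)
    ((integrable_functional hf hb hF hχ hχc).const_mul c)]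
  congr 1 with z
  have h1 := hφ.differentiable (by simp) z
  have h2 := hχ.differentiable (by simp) z
  have h3 : HasFDerivAt (fun z => φ z + c * χ z) (fderiv ℝ φ z + c • fderiv ℝ χ z) z :=
    h1.hasFDerivAt.add (h2.hasFDerivAt.const_mul c)
  have h4 : transport (fun z => φ z + c * χ z) z = transport φ z + c * transport χ z := by
    unfold transport; rw [h3.fderiv]; rfl
  have h5 : gradV (fun z => φ z + c * χ z) z = gradV φ z + c • gradV χ z := by
    ext i
    rw [gradV_apply h3.differentiableAt, PiLp.add_apply, PiLp.smul_apply, gradV_apply h1,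
      gradV_apply h2]
    unfold derivV; rw [h3.fderiv]; rfl
  rw [h4, h5, inner_add_right, real_inner_smul_right]
  ring

/-- The increments of the defect functional on kernels are controlled by its values on
localized dominating kernels. -/
theorem IsSubsolutionOn.abs_functional_kern_sub_le {O : Set (Phase d)} {f b : Phase d → ℝ}
    {F G : Phase d → E d} (H : IsSubsolutionOn O f b F G) {τ σ C : ℝ}
    (hτ : 0 < τ) (hσ : 0 < σ) {k θ χ : Phase d → ℝ} (hk : ContDiff ℝ ∞ k)
    (hkc : HasCompactSupport k) (hθ : ContDiff ℝ ∞ θ) (hdom : Dominates θ C k) (hχ : IsTest O χ)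
    (hχ0 : ∀ z, 0 ≤ χ z) (h : E d) {z : Phase d}
    (h1 : ∀ z', pull (τ * σ ^ 2)⁻¹ σ⁻¹ z z' ∈ tsupport k → χ z' = 1)
    (h2 : ∀ z', pull (τ * σ ^ 2)⁻¹ σ⁻¹ (z + (0, h, 0)) z' ∈ tsupport k → χ z' = 1) :
    |functional f b F (kern τ σ k (z + (0, h, 0))) - functional f b F (kern τ σ k z)|
      ≤ C * incr τ σ h * (functional f b F (fun z' => χ z' * kern τ σ θ (z + (0, h, 0)) z')
        + functional f b F (fun z' => χ z' * kern τ σ θ z z')) := by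
  have ek : ∀ y : Phase d, (∀ z', pull (τ * σ ^ 2)⁻¹ σ⁻¹ y z' ∈ tsupport k → χ z' = 1) →
      ∀ z', χ z' * kern τ σ k y z' = kern τ σ k y z' := by
    intro y hy z'
    by_cases hm : pull (τ * σ ^ 2)⁻¹ σ⁻¹ y z' ∈ tsupport k
    · rw [hy z' hm, one_mul]
    · unfold kern
      rw [image_eq_zero_of_notMem_tsupport hm]
      simp
  have cd : ∀ y, ContDiff ℝ ∞ (fun z' => χ z' * kern τ σ θ y z') := fun y =>
    hχ.contDiff.mul (contDiff_kern hθ y)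
  have cc : ∀ y, HasCompactSupport (fun z' => χ z' * kern τ σ θ y z') := fun y =>
    hχ.hasCompactSupport.mul_right
  have kd := fun y => contDiff_kern (τ := τ) (σ := σ) hk y
  have kc := fun y => hasCompactSupport_kern hτ hσ hkc y
  set y := z + (0, h, 0) with hy
  -- The functional is non-negative on `χ` times the majorant plus or minus the increment of the
  -- kernel. The two signs give the two halves of the absolute value.
  have key : ∀ s : ℝ, |s| = 1 → 0 ≤ C * incr τ σ h * (functional f b F
        (fun z' => χ z' * kern τ σ θ y z') + functional f b F (fun z' => χ z' * kern τ σ θ z z'))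
        + s * (functional f b F (kern τ σ k y) - functional f b F (kern τ σ k z)) := by
    intro s hs
    have d1 := (cd y).add (contDiff_const (c := (1 : ℝ)) |>.mul (cd z))
    have c1 : HasCompactSupport fun z' => χ z' * kern τ σ θ y z' + 1 * (χ z' * kern τ σ θ z z') :=
      (cc y).add ((cc z).mul_left)
    have d2 := (kd y).add (contDiff_const (c := (-1 : ℝ)) |>.mul (kd z))
    have c2 : HasCompactSupport fun z' => kern τ σ k y z' + -1 * kern τ σ k z z' :=
      (kc y).add ((kc z).mul_left)
    have d3 : ContDiff ℝ ∞ fun z' => s * (kern τ σ k y z' + -1 * kern τ σ k z z') :=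
      contDiff_const.mul d2
    have c3 : HasCompactSupport fun z' => s * (kern τ σ k y z' + -1 * kern τ σ k z z') :=
      c2.mul_left
    have d0 : ContDiff ℝ ∞ (fun _ : Phase d => (0 : ℝ)) := contDiff_const
    have c0 : HasCompactSupport (fun _ : Phase d => (0 : ℝ)) := HasCompactSupport.zero
    have f0 : functional f b F (fun _ => 0) = 0 := by
      have := functional_add_const_mul H.integrable_f H.integrable_b H.integrable_F d0 c0 d0 c0 1
      simp only [mul_zero, add_zero, one_mul] at this
      linarith
    have e1 := functional_add_const_mul H.integrable_f H.integrable_b H.integrable_F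
      (cd y) (cc y) (cd z) (cc z) 1
    have e2 := functional_add_const_mul H.integrable_f H.integrable_b H.integrable_F
      (kd y) (kc y) (kd z) (kc z) (-1)
    have e3 := functional_add_const_mul H.integrable_f H.integrable_b H.integrable_F
      d0 c0 d2 c2 s
    simp only [zero_add] at e3
    have e4 := functional_add_const_mul H.integrable_f H.integrable_b H.integrable_F
      d3 c3 d1 c1 (C * incr τ σ h)
    have e5 : 0 ≤ functional f b F (fun z' => s * (kern τ σ k y z' + -1 * kern τ σ k z z')
        + C * incr τ σ h * (χ z' * kern τ σ θ y z' + 1 * (χ z' * kern τ σ θ z z'))) := by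
      -- Where the kernels on `k` do not vanish, `χ = 1`, so `χ` can be inserted in front of the
      -- increment. It is needed in front of the majorant, whose kernel may leave `O`.
      have ee : ∀ z', s * (kern τ σ k y z' + -1 * kern τ σ k z z')
          + C * incr τ σ h * (χ z' * kern τ σ θ y z' + 1 * (χ z' * kern τ σ θ z z'))
          = χ z' * (s * (kern τ σ k y z' - kern τ σ k z z')
          + C * incr τ σ h * (kern τ σ θ y z' + kern τ σ θ z z')) := by
        intro z'
        linear_combination (-s) * ek y h2 z' + s * ek z h1 z'
      refine H.nonneg _ ⟨d3.add (contDiff_const.mul d1), c3.add c1.mul_left, ?_⟩ ?_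
      · refine (closure_mono ?_).trans hχ.tsupport_subset
        intro z' hz' h0
        refine hz' ?_
        exact (ee z').trans (by rw [h0, zero_mul])
      · intro z'
        simp only [ee]
        refine mul_nonneg (hχ0 z') ?_
        have b1 := abs_kern_sub_le hτ hσ hdom h z z'
        have b2 : -|kern τ σ k y z' - kern τ σ k z z'| ≤ s * (kern τ σ k y z' - kern τ σ k z z') := by
          have := neg_abs_le (s * (kern τ σ k y z' - kern τ σ k z z'))
          rwa [abs_mul, hs, one_mul] at this
        linarith
    rw [e4, e3, f0, e2, e1] at e5
    linarith
  rw [abs_le]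
  constructor
  · have := key 1 (by simp); linarith
  · have := key (-1) (by simp); linarith

theorem tsupport_euler_subset (ψ : Phase d → ℝ) : tsupport (euler ψ) ⊆ tsupport ψ := by
  refine closure_minimal (fun w hw => ?_) (isClosed_tsupport _)
  by_contra h
  obtain ⟨h1, h2⟩ := eq_zero_of_notMem_tsupport
    (V := fun z => (2 * z.1, (3 : ℝ) • z.2.1, z.2.2)) h
  exact hw (by simp [euler, h1, h2])

/-! ### The scale derivative of the mollifications. -/

/-- A normalized mollifier `ψ` supported in the unit ball, together with a kernel `θ` which
dominates the increments of `ψ` and of its potentials. -/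
structure IsKernelPair (ψ θ : Phase d → ℝ) (C : ℝ) : Prop where
  contDiff_ψ : ContDiff ℝ ∞ ψ
  contDiff_θ : ContDiff ℝ ∞ θ
  tsupport_ψ : tsupport ψ ⊆ Metric.closedBall 0 1
  hasCompactSupport_θ : HasCompactSupport θ
  integral_ψ : ∫ w, ψ w = 1
  nonneg_ψ : ∀ w, 0 ≤ ψ w
  nonneg_θ : ∀ w, 0 ≤ θ w
  nonneg_C : 0 ≤ C
  dom_ψ : Dominates θ C ψ
  dom_potT : Dominates θ C (potT ψ)
  dom_derivV : ∀ i, Dominates θ C (derivV (EuclideanSpace.single i 1) (potT ψ))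
  dom_potV : ∀ i, Dominates θ C (potV i ψ)

theorem Dominates.mono {θ k : Phase d → ℝ} {C C' : ℝ} (h : Dominates θ C k)
    (hθ : ∀ w, 0 ≤ θ w) (hC : C ≤ C') : Dominates θ C' k := fun w η => by
  have h0 : 0 ≤ θ (w - η) + θ w := add_nonneg (hθ _) (hθ _)
  exact (h w η).trans (by gcongr)

variable (d) in
-- A single bump `θ`, equal to `1` on the ball of radius `2`, dominates `ψ` and every profile
-- derived from it, because all of them are supported in the unit ball. One constant serves for all
-- since there are finitely many profiles.
theorem exists_isKernelPair : ∃ (ψ θ : Phase d → ℝ) (C : ℝ), IsKernelPair ψ θ C := by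
  let B1 : ContDiffBump (0 : Phase d) := ⟨1 / 2, 1, by norm_num, by norm_num⟩
  let B2 : ContDiffBump (0 : Phase d) := ⟨2, 3, by norm_num, by norm_num⟩
  set ψ : Phase d → ℝ := B1.normed volume with hψ
  set θ : Phase d → ℝ := fun w => B2 w with hθ
  have c1 : ContDiff ℝ ∞ ψ := B1.contDiff_normed
  have s1 : tsupport ψ ⊆ Metric.closedBall 0 1 := by
    rw [hψ, B1.tsupport_normed_eq]
  have t0 : ∀ w, 0 ≤ θ w := fun w => B2.nonneg
  have t1 : ∀ w, ‖w‖ ≤ 2 → θ w = 1 := fun w hw =>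
    B2.one_of_mem_closedBall (by rw [mem_closedBall_zero_iff]; exact hw)
  obtain ⟨C1, h1, d1⟩ := exists_majorant c1 s1 t0 t1
  obtain ⟨C2, h2, d2⟩ := exists_majorant (contDiff_potT c1) ((tsupport_potT_subset ψ).trans s1)
    t0 t1
  have h3 := fun i : Fin d => exists_majorant
    (contDiff_derivV (contDiff_potT c1) (EuclideanSpace.single i 1))
    ((tsupport_fderiv_apply_subset _ _).trans ((tsupport_potT_subset ψ).trans s1)) t0 t1
  have h4 := fun i : Fin d => exists_majorant (contDiff_potV c1 i)
    ((tsupport_potV_subset ψ i).trans s1) t0 t1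
  choose C3 h3 d3 using h3
  choose C4 h4 d4 using h4
  have b3 : ∀ i, C3 i ≤ ∑ i, C3 i := fun i =>
    Finset.single_le_sum (fun i _ => h3 i) (Finset.mem_univ i)
  have b4 : ∀ i, C4 i ≤ ∑ i, C4 i := fun i =>
    Finset.single_le_sum (fun i _ => h4 i) (Finset.mem_univ i)
  have n3 : 0 ≤ ∑ i, C3 i := Finset.sum_nonneg fun i _ => h3 i
  have n4 : 0 ≤ ∑ i, C4 i := Finset.sum_nonneg fun i _ => h4 i
  exact ⟨ψ, θ, C1 + C2 + ∑ i, C3 i + ∑ i, C4 i,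
    { contDiff_ψ := c1
      contDiff_θ := B2.contDiff
      tsupport_ψ := s1
      hasCompactSupport_θ := B2.hasCompactSupport
      integral_ψ := B1.integral_normed
      nonneg_ψ := B1.nonneg_normed
      nonneg_θ := t0
      nonneg_C := by positivity
      dom_ψ := Dominates.mono d1 t0 (by linarith)
      dom_potT := Dominates.mono d2 t0 (by linarith)
      dom_derivV := fun i => Dominates.mono (d3 i) t0 (by linarith [b3 i])
      dom_potV := fun i => Dominates.mono (d4 i) t0 (by linarith [b4 i]) }⟩

theorem avg_mono {τ σ : ℝ} {θ : Phase d → ℝ} {g g' : Phase d → ℝ≥0∞} (h : ∀ z, g z ≤ g' z)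
    (z : Phase d) : avg τ σ θ g z ≤ avg τ σ θ g' z :=
  lintegral_mono fun z' => mul_le_mul_left (h z') _

/-- The mass of the defect functional near `z` at scale `σ`, localized by `χ`. -/
def mass (f b : Phase d → ℝ) (F : Phase d → E d) (χ θ : Phase d → ℝ) (τ σ : ℝ) (z : Phase d) :
    ℝ≥0∞ :=
  ENNReal.ofReal (functional f b F (fun z' => χ z' * kern τ σ θ z z'))

/-- The size of the data of the equation. -/
def size (b : Phase d → ℝ) (F G : Phase d → E d) (z : Phase d) : ℝ≥0∞ := ‖F z‖ₑ + ‖b z‖ₑ + ‖G z‖ₑ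

/-- The bound for the increments in position of the derivative in scale of the mollifications. -/
def incrBound (f b : Phase d → ℝ) (F G : Phase d → E d) (χ θ : Phase d → ℝ) (C τ σ : ℝ) (h : E d)
    (z : Phase d) : ℝ≥0∞ :=
  ENNReal.ofReal (C * (2 * d + 1) * incr τ σ h)
      * (avg τ σ θ (size b F G) (z + (0, h, 0)) + avg τ σ θ (size b F G) z)
    + ENNReal.ofReal (C * (τ * σ) * incr τ σ h)
      * (mass f b F χ θ τ σ (z + (0, h, 0)) + mass f b F χ θ τ σ z)

/-- The kernels of scale at most `s` centred at `z` live where `χ = 1`. -/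
def Inside (χ : Phase d → ℝ) (τ s : ℝ) (z : Phase d) : Prop :=
  ∀ σ ∈ Ioc 0 s, ∀ z', ‖pull (τ * σ ^ 2)⁻¹ σ⁻¹ z z'‖ ≤ 1 → χ z' = 1

theorem integrable_mul_kern {g k : Phase d → ℝ} (hg : Integrable g) {τ σ : ℝ} (hτ : 0 < τ)
    (hσ : 0 < σ) (hk : Continuous k) (hc : HasCompactSupport k) (z : Phase d) :
    Integrable (fun z' => g z' * kern τ σ k z z') :=
  integrable_mul_of_hasCompactSupport hg (continuous_kern hk z) (hasCompactSupport_kern hτ hσ hc z)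

theorem enorm_sum_le_enorm (u : E d) (i : Fin d) : ‖u i‖ₑ ≤ ‖u‖ₑ := by
  rw [← ofReal_norm, ← ofReal_norm]
  exact ENNReal.ofReal_le_ofReal (PiLp.norm_apply_le u i)

/-- The left side is the increment in position of the scale derivative of the mollification. The
pairing identity replaces it by increments of kernels against `F`, `b` and `G`, each controlled by
an average of `size b F G`, and by increments of the defect functional, controlled by `mass`. -/
theorem IsKernelPair.enorm_integral_kern_euler_sub_le {ψ θ χ : Phase d → ℝ} {C : ℝ}
    (K : IsKernelPair ψ θ C) {O : Set (Phase d)} (hO : IsOpen O) {f b : Phase d → ℝ}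
    {F G : Phase d → E d} (H : IsSubsolutionOn O f b F G) {τ σ s : ℝ} (hτ : 0 < τ) (hτ1 : τ ≤ 1)
    (hσ : 0 < σ) (hσs : σ ≤ s) (hs1 : s ≤ 1) (hχ : IsTest O χ) (hχ0 : ∀ z, 0 ≤ χ z) (h : E d)
    {z : Phase d} (h1 : Inside χ τ s z) (h2 : Inside χ τ s (z + (0, h, 0))) :
    ‖∫ z', f z' * (-(σ⁻¹ * kern τ σ (euler ψ) (z + (0, h, 0)) z')
        - -(σ⁻¹ * kern τ σ (euler ψ) z z'))‖ₑ ≤ incrBound f b F G χ θ C τ σ h z := by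
  have hc : HasCompactSupport ψ :=
    (isCompact_closedBall (0 : Phase d) 1).of_isClosed_subset (isClosed_tsupport _) K.tsupport_ψ
  have hcT : HasCompactSupport (potT ψ) :=
    hc.of_isClosed_subset (isClosed_tsupport _) (tsupport_potT_subset ψ)
  have hcV : ∀ i, HasCompactSupport (potV i ψ) := fun i =>
    hc.of_isClosed_subset (isClosed_tsupport _) (tsupport_potV_subset ψ i)
  have hcE : HasCompactSupport (euler ψ) :=
    hc.of_isClosed_subset (isClosed_tsupport _) (tsupport_euler_subset ψ)
  have kT := (contDiff_potT K.contDiff_ψ)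
  have kD := fun i : Fin d => (contDiff_derivV kT (EuclideanSpace.single i 1))
  have kV := (contDiff_potV K.contDiff_ψ)
  have kE := contDiff_euler K.contDiff_ψ
  have hσ1 : σ ≤ 1 := hσs.trans hs1
  set y := z + (0, h, 0) with hy
  have mem : ∀ w : Phase d, w ∈ tsupport ψ → ‖w‖ ≤ 1 := fun w hw =>
    mem_closedBall_zero_iff.1 (K.tsupport_ψ hw)
  have sub : ∀ x, Inside χ τ s x → pull (τ * σ ^ 2)⁻¹ σ⁻¹ x ⁻¹' tsupport ψ ⊆ O := by
    intro x hx z' hz'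
    have h1 : χ z' = 1 := hx σ ⟨hσ, hσs⟩ z' (mem _ hz')
    have := hχ.tsupport_subset (subset_tsupport χ (by simp [h1] : z' ∈ Function.support χ))
    rwa [hO.interior_eq] at this
  have ez := H.integral_mul_kern_euler hO hτ hσ K.contDiff_ψ hc (sub z h1)
  have ey := H.integral_mul_kern_euler hO hτ hσ K.contDiff_ψ hc (sub y h2)
  have iE := fun x => integrable_mul_kern H.integrable_f hτ hσ kE.continuous hcE x
  have split : ∀ {g k : Phase d → ℝ}, Integrable g → Continuous k → HasCompactSupport k →
      ∫ z', g z' * (kern τ σ k y z' - kern τ σ k z z')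
        = (∫ z', g z' * kern τ σ k y z') - ∫ z', g z' * kern τ σ k z z' := by
    intro g k hg hk hkc
    rw [← integral_sub (integrable_mul_kern hg hτ hσ hk hkc y)
      (integrable_mul_kern hg hτ hσ hk hkc z)]
    simp only [mul_sub]
  set dL := functional f b F (kern τ σ (potT ψ) y) - functional f b F (kern τ σ (potT ψ) z) with hdL
  set dF : Fin d → ℝ := fun i => ∫ z', F z' i *
    (kern τ σ (derivV (EuclideanSpace.single i 1) (potT ψ)) y z'
      - kern τ σ (derivV (EuclideanSpace.single i 1) (potT ψ)) z z') with hdF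
  set dB := ∫ z', b z' * (kern τ σ (potT ψ) y z' - kern τ σ (potT ψ) z z') with hdB
  set dG : Fin d → ℝ := fun i => ∫ z', G z' i *
    (kern τ σ (potV i ψ) y z' - kern τ σ (potV i ψ) z z') with hdG
  -- Multiplication by `-σ⁻¹` leaves the factors `τ σ` on the defect and on `b`, `τ` on `F` and `1`
  -- on `G`. The gain `τ σ` is discarded for `b` but is essential for the defect.
  have e1 : ∫ z', f z' * (-(σ⁻¹ * kern τ σ (euler ψ) y z') - -(σ⁻¹ * kern τ σ (euler ψ) z z'))
      = -(τ * σ) * dL - τ * ∑ i, dF i + τ * σ * dB + ∑ i, dG i := by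
    have a1 : ∀ z', f z' * (-(σ⁻¹ * kern τ σ (euler ψ) y z') - -(σ⁻¹ * kern τ σ (euler ψ) z z'))
        = -σ⁻¹ * (f z' * (kern τ σ (euler ψ) y z' - kern τ σ (euler ψ) z z')) := fun z' => by ring
    simp only [a1]
    rw [integral_const_mul, split H.integrable_f kE.continuous hcE, ey, ez, hdL, hdB,
      split H.integrable_b kT.continuous hcT]
    have a2 : ∀ i, dF i = _ := fun i =>
      split (integrable_apply H.integrable_F i) (kD i).continuous (hasCompactSupport_derivV hcT _)
    have a3 : ∀ i, dG i = _ := fun i =>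
      split (integrable_apply H.integrable_G i) (kV i).continuous (hcV i)
    simp only [a2, a3, Finset.sum_sub_distrib]
    field_simp
    ring
  have bL : ‖-(τ * σ) * dL‖ₑ ≤ ENNReal.ofReal (C * (τ * σ) * incr τ σ h)
      * (mass f b F χ θ τ σ y + mass f b F χ θ τ σ z) := by
    have a1 := H.abs_functional_kern_sub_le hτ hσ kT hcT K.contDiff_θ K.dom_potT hχ hχ0 h
      (fun z' hz' => h1 σ ⟨hσ, hσs⟩ z' (mem _ (tsupport_potT_subset ψ hz')))
      (fun z' hz' => h2 σ ⟨hσ, hσs⟩ z' (mem _ (tsupport_potT_subset ψ hz')))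
    have a2 : 0 ≤ C * (τ * σ) * incr τ σ h :=
      mul_nonneg (mul_nonneg K.nonneg_C (by positivity)) (incr_nonneg hτ hσ h)
    rw [Real.enorm_eq_ofReal_abs, abs_mul, abs_neg, abs_of_pos (mul_pos hτ hσ)]
    refine (ENNReal.ofReal_le_ofReal
      (mul_le_mul_of_nonneg_left a1 (mul_pos hτ hσ).le)).trans ?_
    unfold mass
    rw [show ∀ A B : ℝ, τ * σ * (C * incr τ σ h * (A + B)) = C * (τ * σ) * incr τ σ h * (A + B) from
      fun A B => by ring, ENNReal.ofReal_mul a2]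
    gcongr
    exact ENNReal.ofReal_add_le
  have small : ∀ {c x : ℝ} {B : ℝ≥0∞}, |c| ≤ 1 → ‖x‖ₑ ≤ B → ‖c * x‖ₑ ≤ B := by
    intro c x B hc hx
    rw [enorm_mul]
    calc ‖c‖ₑ * ‖x‖ₑ ≤ 1 * B := by
          gcongr
          rw [Real.enorm_eq_ofReal_abs]
          exact ENNReal.ofReal_le_one.2 hc
      _ = B := one_mul B
  set R := ENNReal.ofReal (C * incr τ σ h) * (avg τ σ θ (size b F G) y + avg τ σ θ (size b F G) z)
    with hR
  have est : ∀ {g k : Phase d → ℝ}, Measurable g → (∀ z, ‖g z‖ₑ ≤ size b F G z) →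
      Dominates θ C k → ‖∫ z', g z' * (kern τ σ k y z' - kern τ σ k z z')‖ₑ ≤ R := by
    intro g k hg hgs hk
    refine (enorm_integral_kern_sub_le hτ hσ K.nonneg_C K.contDiff_θ.continuous K.nonneg_θ hk hg h
      z).trans ?_
    exact mul_le_mul_right (add_le_add (avg_mono hgs _) (avg_mono hgs _)) _
  have mF : ∀ i, Measurable fun z => F z i := fun i =>
    (EuclideanSpace.proj i : E d →L[ℝ] ℝ).continuous.measurable.comp H.measurable_F
  have mG : ∀ i, Measurable fun z => G z i := fun i =>
    (EuclideanSpace.proj i : E d →L[ℝ] ℝ).continuous.measurable.comp H.measurable_G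
  have bF : ‖-τ * ∑ i, dF i‖ₑ ≤ d * R := by
    refine small (by rw [abs_neg, abs_of_pos hτ]; exact hτ1) ?_
    refine (enorm_sum_le _ _).trans ((Finset.sum_le_sum fun i _ => est (mF i) (fun z => ?_)
      (K.dom_derivV i)).trans (by simp))
    exact (enorm_sum_le_enorm _ i).trans (by unfold size; rw [add_assoc]; exact le_self_add)
  have bG : ‖∑ i, dG i‖ₑ ≤ d * R := by
    refine (enorm_sum_le _ _).trans ((Finset.sum_le_sum fun i _ => est (mG i) (fun z => ?_)
      (K.dom_potV i)).trans (by simp))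
    exact (enorm_sum_le_enorm _ i).trans (by unfold size; exact le_add_self)
  have bB : ‖τ * σ * dB‖ₑ ≤ R := by
    refine small ?_ (est H.measurable_b (fun z => ?_) K.dom_potT)
    · rw [abs_of_pos (mul_pos hτ hσ)]
      exact mul_le_one₀ hτ1 hσ.le hσ1
    · unfold size
      rw [add_right_comm]
      exact le_add_self
  -- The factor `2 d + 1` counts the components: `d` of `F`, one of `b` and `d` of `G`.
  have hRR : ENNReal.ofReal (C * (2 * d + 1) * incr τ σ h)
      * (avg τ σ θ (size b F G) y + avg τ σ θ (size b F G) z) = d * R + R + d * R := by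
    have : C * (2 * d + 1) * incr τ σ h = (2 * d + 1 : ℕ) * (C * incr τ σ h) := by push_cast; ring
    rw [this, ENNReal.ofReal_mul (by positivity), ENNReal.ofReal_natCast, hR]
    push_cast
    ring
  rw [e1, show -(τ * σ) * dL - τ * ∑ i, dF i + τ * σ * dB + ∑ i, dG i
    = ((-τ * ∑ i, dF i) + τ * σ * dB + ∑ i, dG i) + -(τ * σ) * dL by ring]
  refine (enorm_add_le _ _).trans ?_
  unfold incrBound
  rw [hRR]
  refine add_le_add ?_ bL
  refine (enorm_add_le _ _).trans (add_le_add ?_ bG)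
  exact (enorm_add_le _ _).trans (add_le_add bF bB)

/-- The mollification of `f` at scale `σ`. -/
def moll (τ σ : ℝ) (ψ f : Phase d → ℝ) (z : Phase d) : ℝ := ∫ z', f z' * kern τ σ ψ z z'

theorem measurable_uncurry_kern {k : Phase d → ℝ} (hk : Continuous k) (τ : ℝ) (z : Phase d) :
    Measurable (Function.uncurry fun σ z' => kern τ σ k z z') := by
  unfold Function.uncurry kern jac pull
  have h1 : Measurable fun p : ℝ × Phase d => (τ * p.1 ^ 2)⁻¹ := by fun_prop
  have h2 : Measurable fun p : ℝ × Phase d => (p.1)⁻¹ := by fun_prop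
  refine ((h1.pow_const _).mul (h2.pow_const _)).mul (hk.measurable.comp ?_)
  refine (h1.mul ?_).prodMk (((h1.mul h2).smul ?_).prodMk (h2.smul ?_)) <;> fun_prop

/-- Integrate the scale derivative from `ρ` to `s`. The lower limit is relaxed to `0` so that the
bound does not depend on `ρ` and survives the limit `ρ → 0`. The scale `s` stays fixed and costs one
term without cancellation in scale. -/
theorem IsKernelPair.enorm_moll_sub_le {ψ θ χ : Phase d → ℝ} {C : ℝ}
    (K : IsKernelPair ψ θ C) {O : Set (Phase d)} (hO : IsOpen O) {f b : Phase d → ℝ}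
    {F G : Phase d → E d} (H : IsSubsolutionOn O f b F G) {τ ρ s : ℝ} (hτ : 0 < τ) (hτ1 : τ ≤ 1)
    (hρ : 0 < ρ) (hρs : ρ ≤ s) (hs1 : s ≤ 1) (hχ : IsTest O χ) (hχ0 : ∀ z, 0 ≤ χ z) (h : E d)
    {z : Phase d} (h1 : Inside χ τ s z) (h2 : Inside χ τ s (z + (0, h, 0))) :
    ‖moll τ ρ ψ f (z + (0, h, 0)) - moll τ ρ ψ f z‖ₑ
      ≤ ‖moll τ s ψ f (z + (0, h, 0)) - moll τ s ψ f z‖ₑ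
        + ∫⁻ σ in Ioc 0 s, incrBound f b F G χ θ C τ σ h z := by
  have hc : HasCompactSupport ψ :=
    (isCompact_closedBall (0 : Phase d) 1).of_isClosed_subset (isClosed_tsupport _) K.tsupport_ψ
  have hcE : HasCompactSupport (euler ψ) :=
    hc.of_isClosed_subset (isClosed_tsupport _) (tsupport_euler_subset ψ)
  have kE := contDiff_euler K.contDiff_ψ
  obtain ⟨M, hM⟩ := kE.continuous.bounded_above_of_compact_support hcE
  set y := z + (0, h, 0) with hy
  set Kf : ℝ → Phase d → ℝ := fun σ z' => kern τ σ ψ y z' - kern τ σ ψ z z' with hKf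
  set Kd : ℝ → Phase d → ℝ := fun σ z' => -(σ⁻¹ * kern τ σ (euler ψ) y z')
        - -(σ⁻¹ * kern τ σ (euler ψ) z z') with hKd
  have pos : ∀ σ ∈ Icc ρ s, 0 < σ := fun σ hσ => hρ.trans_le hσ.1
  have split : ∀ σ ∈ Icc ρ s, ∫ z', f z' * Kf σ z' = moll τ σ ψ f y - moll τ σ ψ f z := by
    intro σ hσ
    unfold moll
    rw [← integral_sub (integrable_mul_kern H.integrable_f hτ (pos σ hσ) K.contDiff_ψ.continuous hc
      y) (integrable_mul_kern H.integrable_f hτ (pos σ hσ) K.contDiff_ψ.continuous hc z)]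
    simp only [hKf, mul_sub]
  have hJ : ∀ σ ∈ Icc ρ s, ∀ x z', |σ⁻¹ * kern τ σ (euler ψ) x z'|
      ≤ ρ⁻¹ * ((τ ^ (d + 1))⁻¹ * (ρ⁻¹) ^ (4 * d + 2) * M) := by
    intro σ hσ x z'
    have hσ0 := pos σ hσ
    have hi : σ⁻¹ ≤ ρ⁻¹ := inv_anti₀ hρ hσ.1
    have hM0 : 0 ≤ M := (norm_nonneg _).trans (hM 0)
    unfold kern
    rw [jac_kern_eq, abs_mul, abs_mul, abs_of_pos (inv_pos.2 hσ0), abs_of_pos (by positivity)]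
    gcongr
    exact hM _
  have main := enorm_integral_mul_sub_le (K := Kf) (K' := Kd)
    (C := ρ⁻¹ * ((τ ^ (d + 1))⁻¹ * (ρ⁻¹) ^ (4 * d + 2) * M)
      + ρ⁻¹ * ((τ ^ (d + 1))⁻¹ * (ρ⁻¹) ^ (4 * d + 2) * M)) H.integrable_f hρs
    (fun σ hσ x => (hasDerivAt_kern hτ (pos σ hσ) K.contDiff_ψ y x).sub
      (hasDerivAt_kern hτ (pos σ hσ) K.contDiff_ψ z x))
    (fun x σ hσ => by
      have hi := (hasDerivAt_inv (pos σ hσ).ne').continuousAt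
      exact (((hi.mul (hasDerivAt_kern hτ (pos σ hσ) kE y x).continuousAt).neg).sub
        ((hi.mul (hasDerivAt_kern hτ (pos σ hσ) kE z x).continuousAt).neg)).continuousWithinAt)
    (by
      have m1 : Measurable fun p : ℝ × Phase d => p.1⁻¹ := by fun_prop
      exact ((m1.mul (measurable_uncurry_kern kE.continuous τ y)).neg).sub
        ((m1.mul (measurable_uncurry_kern kE.continuous τ z)).neg))
    (fun σ hσ x => by
      refine (abs_sub _ _).trans (add_le_add ?_ ?_)
      · rw [abs_neg]; exact hJ σ hσ y x
      · rw [abs_neg]; exact hJ σ hσ z x)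
    (fun σ hσ => by
      have := (integrable_mul_kern H.integrable_f hτ (pos σ hσ) K.contDiff_ψ.continuous hc y).sub
        (integrable_mul_kern H.integrable_f hτ (pos σ hσ) K.contDiff_ψ.continuous hc z)
      exact this.congr (Filter.Eventually.of_forall fun z' => by simp only [hKf, mul_sub, Pi.sub_apply]))
  rw [split s ⟨hρs, le_rfl⟩, split ρ ⟨le_rfl, hρs⟩] at main
  have tri : ∀ A B : ℝ, ‖A‖ₑ ≤ ‖B‖ₑ + ‖B - A‖ₑ := by
    intro A B
    have := enorm_sub_le (a := B) (b := B - A)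
    rwa [sub_sub_cancel] at this
  refine (tri _ _).trans (add_le_add_right (main.trans ?_) _)
  refine (setLIntegral_mono_ae' measurableSet_Ioc (Filter.Eventually.of_forall fun σ hσ =>
    K.enorm_integral_kern_euler_sub_le hO H hτ hτ1 (hρ.trans hσ.1) hσ.2 hs1 hχ hχ0 h h1 h2)).trans ?_
  exact lintegral_mono_set (Ioc_subset_Ioc_left hρ.le)

/-! ### `L²` bounds for averages over one scale and over all scales. -/

/-- Cauchy–Schwarz for the splitting `u v = u^(1/2) (u v²)^(1/2)`. It is used with `u` a kernel or a
weight in `σ`, and with `u = 1` on sets of finite measure. -/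
theorem sq_lintegral_mul_le {X : Type*} [MeasurableSpace X] {μ : Measure X} {u v : X → ℝ≥0∞}
    (hu : AEMeasurable u μ) (hv : AEMeasurable v μ) :
    (∫⁻ x, u x * v x ∂μ) ^ 2 ≤ (∫⁻ x, u x ∂μ) * ∫⁻ x, u x * v x ^ 2 ∂μ := by
  have h := ENNReal.lintegral_mul_norm_pow_le (μ := μ) hu (hu.mul (hv.pow_const 2))
    (p := 1 / 2) (q := 1 / 2) (by norm_num) (by norm_num) (by norm_num)
  have e1 : ∀ x, u x ^ (1 / 2 : ℝ) * ((u * fun x => v x ^ 2) x) ^ (1 / 2 : ℝ) = u x * v x := by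
    intro x
    rw [Pi.mul_apply, ← ENNReal.mul_rpow_of_nonneg _ _ (by norm_num), ← mul_assoc, ← sq,
      ← mul_pow, ← ENNReal.rpow_natCast, ← ENNReal.rpow_mul]
    norm_num
  simp only [e1] at h
  have h2 := pow_le_pow_left' h 2
  refine h2.trans (le_of_eq ?_)
  rw [← ENNReal.mul_rpow_of_nonneg _ _ (by norm_num), ← ENNReal.rpow_natCast, ← ENNReal.rpow_mul]
  norm_num

theorem measurable_kern {k : Phase d → ℝ} (hk : Continuous k) (τ : ℝ) :
    Measurable fun p : ℝ × Phase d × Phase d => kern τ p.1 k p.2.1 p.2.2 := by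
  unfold kern jac pull
  have h1 : Measurable fun p : ℝ × Phase d × Phase d => (τ * p.1 ^ 2)⁻¹ := by fun_prop
  have h2 : Measurable fun p : ℝ × Phase d × Phase d => (p.1)⁻¹ := by fun_prop
  refine ((h1.pow_const _).mul (h2.pow_const _)).mul (hk.measurable.comp ?_)
  refine (h1.mul ?_).prodMk (((h1.mul h2).smul ?_).prodMk (h2.smul ?_)) <;> fun_prop

theorem measurable_avg {θ : Phase d → ℝ} (hθ : Continuous θ) (τ : ℝ) {g : Phase d → ℝ≥0∞}
    (hg : Measurable g) : Measurable fun p : ℝ × Phase d => avg τ p.1 θ g p.2 := by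
  unfold avg
  have : Measurable fun q : (ℝ × Phase d) × Phase d =>
      g q.2 * ENNReal.ofReal (kern τ q.1.1 θ q.1.2 q.2) := by
    have h1 : Measurable fun q : (ℝ × Phase d) × Phase d => (q.1.1, q.1.2, q.2) := by fun_prop
    have h2 : Measurable fun q : (ℝ × Phase d) × Phase d => g q.2 := hg.comp measurable_snd
    have h3 := ((measurable_kern hθ τ).comp h1).ennreal_ofReal
    exact h2.mul h3
  exact this.lintegral_prod_right'

theorem measurable_avg_right (τ σ : ℝ) {θ : Phase d → ℝ} (hθ : Continuous θ)
    {g : Phase d → ℝ≥0∞} (hg : Measurable g) : Measurable (avg τ σ θ g) := by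
  unfold avg
  have h1 : Measurable fun q : Phase d × Phase d => g q.2 := hg.comp measurable_snd
  have h3 := (continuous_uncurry_kern (τ := τ) (σ := σ) hθ).measurable.ennreal_ofReal
  exact (h1.mul h3).lintegral_prod_right'

section

variable {τ σ : ℝ} {θ : Phase d → ℝ}

theorem lintegral_kern_right (hτ : 0 < τ) (hσ : 0 < σ) (hθ : Continuous θ) (z : Phase d) :
    ∫⁻ z', ENNReal.ofReal (kern τ σ θ z z') = ∫⁻ w, ENNReal.ofReal (θ w) := by
  have hJ := jac_kern_pos (d := d) hτ hσ
  unfold kern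
  simp only [ENNReal.ofReal_mul hJ.le]
  have hm : Measurable fun w => ENNReal.ofReal (θ w) := hθ.measurable.ennreal_ofReal
  rw [lintegral_const_mul _ (by exact hm.comp (continuous_pull_right _ _ z).measurable),
    lintegral_pull_right (g := fun w => ENNReal.ofReal (θ w)) (by positivity) (by positivity) z hm,
    ← mul_assoc, ← ENNReal.ofReal_mul hJ.le, mul_inv_cancel₀ hJ.ne']
  simp

theorem lintegral_kern_left (hτ : 0 < τ) (hσ : 0 < σ) (hθ : Continuous θ) (z' : Phase d) :
    ∫⁻ z, ENNReal.ofReal (kern τ σ θ z z') = ∫⁻ w, ENNReal.ofReal (θ w) := by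
  have hJ := jac_kern_pos (d := d) hτ hσ
  unfold kern
  simp only [ENNReal.ofReal_mul hJ.le]
  have hm : Measurable fun w => ENNReal.ofReal (θ w) := hθ.measurable.ennreal_ofReal
  rw [lintegral_const_mul _ (by exact hm.comp (continuous_pull_left _ _ z').measurable),
    lintegral_pull_left (g := fun w => ENNReal.ofReal (θ w)) (by positivity) (by positivity) z' hm,
    ← mul_assoc, ← ENNReal.ofReal_mul hJ.le, mul_inv_cancel₀ hJ.ne']
  simp

theorem lintegral_avg (hτ : 0 < τ) (hσ : 0 < σ) (hθ : Continuous θ) {g : Phase d → ℝ≥0∞}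
    (hg : Measurable g) :
    ∫⁻ z, avg τ σ θ g z = (∫⁻ w, ENNReal.ofReal (θ w)) * ∫⁻ z, g z := by
  have hk : Measurable fun p : Phase d × Phase d => ENNReal.ofReal (kern τ σ θ p.1 p.2) :=
    (continuous_uncurry_kern hθ).measurable.ennreal_ofReal
  unfold avg
  rw [lintegral_lintegral_swap (by exact ((hg.comp measurable_snd).mul hk).aemeasurable)]
  have : ∀ z', ∫⁻ z, g z' * ENNReal.ofReal (kern τ σ θ z z')
      = (∫⁻ w, ENNReal.ofReal (θ w)) * g z' := by
    intro z'
    rw [lintegral_const_mul _ (by exact hk.comp measurable_prodMk_right), lintegral_kern_left hτ hσ hθ,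
      mul_comm]
  simp only [this]
  rw [lintegral_const_mul _ hg]

theorem sq_avg_le (hτ : 0 < τ) (hσ : 0 < σ) (hθ : Continuous θ) {g : Phase d → ℝ≥0∞}
    (hg : Measurable g) (z : Phase d) :
    avg τ σ θ g z ^ 2
      ≤ (∫⁻ w, ENNReal.ofReal (θ w)) * avg τ σ θ (fun z => g z ^ 2) z := by
  have hk : Measurable fun z' => ENNReal.ofReal (kern τ σ θ z z') :=
    (continuous_kern hθ z).measurable.ennreal_ofReal
  have h := sq_lintegral_mul_le (μ := volume) hk.aemeasurable hg.aemeasurable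
  rw [lintegral_kern_right hτ hσ hθ] at h
  unfold avg
  simpa only [mul_comm] using h

theorem lintegral_sq_avg_le (hτ : 0 < τ) (hσ : 0 < σ) (hθ : Continuous θ) {g : Phase d → ℝ≥0∞}
    (hg : Measurable g) :
    ∫⁻ z, avg τ σ θ g z ^ 2 ≤ (∫⁻ w, ENNReal.ofReal (θ w)) ^ 2 * ∫⁻ z, g z ^ 2 := by
  have hg2 : Measurable fun z => g z ^ 2 := hg.pow_const 2
  have hm := measurable_avg_right τ σ hθ hg2
  calc ∫⁻ z, avg τ σ θ g z ^ 2
      ≤ ∫⁻ z, (∫⁻ w, ENNReal.ofReal (θ w)) * avg τ σ θ (fun z => g z ^ 2) z :=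
        lintegral_mono fun z => sq_avg_le hτ hσ hθ hg z
    _ = (∫⁻ w, ENNReal.ofReal (θ w)) * ∫⁻ z, avg τ σ θ (fun z => g z ^ 2) z :=
        lintegral_const_mul _ hm
    _ = (∫⁻ w, ENNReal.ofReal (θ w)) ^ 2 * ∫⁻ z, g z ^ 2 := by
        rw [lintegral_avg hτ hσ hθ hg2]
        ring

/-- Weighted superpositions of averages over all scales are bounded on `L²`. -/
theorem lintegral_sq_lintegral_avg_le (hτ : 0 < τ) {s : ℝ} (hθ : Continuous θ)
    {g : Phase d → ℝ≥0∞} (hg : Measurable g) {m : ℝ → ℝ≥0∞} (hm : Measurable m) :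
    ∫⁻ z, (∫⁻ σ in Ioc 0 s, m σ * avg τ σ θ g z) ^ 2
      ≤ (∫⁻ σ in Ioc 0 s, m σ) ^ 2 * (∫⁻ w, ENNReal.ofReal (θ w)) ^ 2 * ∫⁻ z, g z ^ 2 := by
  have ha : Measurable fun p : ℝ × Phase d => avg τ p.1 θ g p.2 := measurable_avg hθ τ hg
  have hma : Measurable fun p : ℝ × Phase d => m p.1 * avg τ p.1 θ g p.2 ^ 2 :=
    (hm.comp measurable_fst).mul (ha.pow_const 2)
  calc ∫⁻ z, (∫⁻ σ in Ioc 0 s, m σ * avg τ σ θ g z) ^ 2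
      ≤ ∫⁻ z, (∫⁻ σ in Ioc 0 s, m σ) * ∫⁻ σ in Ioc 0 s, m σ * avg τ σ θ g z ^ 2 :=
        lintegral_mono fun z => sq_lintegral_mul_le hm.aemeasurable
          (ha.comp measurable_prodMk_right).aemeasurable
    _ = (∫⁻ σ in Ioc 0 s, m σ) * ∫⁻ σ in Ioc 0 s, ∫⁻ z, m σ * avg τ σ θ g z ^ 2 := by
        rw [lintegral_const_mul _ (by exact (hma.comp measurable_swap).lintegral_prod_right'),
          lintegral_lintegral_swap (by exact (hma.comp measurable_swap).aemeasurable)]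
    _ ≤ (∫⁻ σ in Ioc 0 s, m σ) * ∫⁻ σ in Ioc 0 s,
          m σ * ((∫⁻ w, ENNReal.ofReal (θ w)) ^ 2 * ∫⁻ z, g z ^ 2) := by
        refine mul_le_mul_right (setLIntegral_mono_ae' measurableSet_Ioc
          (Filter.Eventually.of_forall fun σ hσ => ?_)) _
        rw [lintegral_const_mul _ ((measurable_avg_right τ σ hθ hg).pow_const 2)]
        exact mul_le_mul_right (lintegral_sq_avg_le hτ hσ.1 hθ hg) _
    _ = _ := by
        rw [lintegral_mul_const _ hm]
        ring

end

/-! ### The mass of the defect functional, integrated over all centres. -/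

section mass

theorem integral_fderiv_apply_eq_zero {k : Phase d → ℝ} (hk : ContDiff ℝ ∞ k)
    (hc : HasCompactSupport k) (u : Phase d) : ∫ w, fderiv ℝ k w u = 0 := by
  have hd := hk.differentiable (by simp)
  have hfd : Continuous fun w => fderiv ℝ k w u :=
    (contDiff_fderiv_apply hk (V := fun _ => u) contDiff_const).continuous
  have hfc : HasCompactSupport fun w => fderiv ℝ k w u :=
    hc.mono' ((subset_tsupport _).trans (tsupport_fderiv_apply_subset k fun _ => u))
  have h := integral_mul_fderiv_eq_neg_fderiv_mul_of_integrable (μ := volume)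
    (f := fun _ : Phase d => (1 : ℝ)) (g := k) (v := u) (by simp)
    (by simpa using hfd.integrable_of_hasCompactSupport hfc)
    (by simpa using hk.continuous.integrable_of_hasCompactSupport hc)
    (fun _ _ => differentiableAt_const _) (fun x _ => hd x)
  simpa using h

theorem integral_derivV_eq_zero {k : Phase d → ℝ} (hk : ContDiff ℝ ∞ k)
    (hc : HasCompactSupport k) (e : E d) : ∫ w, derivV e k w = 0 :=
  integral_fderiv_apply_eq_zero hk hc _

/-- The transport field has no divergence: `wᵢ` does not depend on position, so `wᵢ ∂_{yᵢ} k =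
∂_{yᵢ} (wᵢ k)` and every term is a derivative of a compactly supported function. -/
theorem integral_transport_eq_zero {k : Phase d → ℝ} (hk : ContDiff ℝ ∞ k)
    (hc : HasCompactSupport k) : ∫ w, transport k w = 0 := by
  have hd := hk.differentiable (by simp)
  have hw : ∀ i : Fin d, ContDiff ℝ ∞ fun w : Phase d => w.2.2 i := fun i => by fun_prop
  have hk' : ∀ i : Fin d, ContDiff ℝ ∞ fun w => w.2.2 i * k w := fun i => (hw i).mul hk
  have hc' : ∀ i : Fin d, HasCompactSupport fun w => w.2.2 i * k w := fun i => hc.mul_left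
  have e : ∀ w, transport k w = fderiv ℝ k w (1, 0, 0)
      + ∑ i, fderiv ℝ (fun w => w.2.2 i * k w) w (0, EuclideanSpace.single i 1, 0) := by
    intro w
    have e1 : ∀ i, fderiv ℝ (fun w => w.2.2 i * k w) w (0, EuclideanSpace.single i 1, 0)
        = w.2.2 i * fderiv ℝ k w (0, EuclideanSpace.single i 1, 0) := by
      intro i
      have hw2 : HasFDerivAt (fun z : Phase d => z.2.2)
        ((ContinuousLinearMap.snd ℝ (E d) (E d)).comp
          (ContinuousLinearMap.snd ℝ ℝ (E d × E d))) w :=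
        HasFDerivAt.comp w (g := fun q : E d × E d => q.2) hasFDerivAt_snd hasFDerivAt_snd
      have hwi := ((EuclideanSpace.proj i : E d →L[ℝ] ℝ).hasFDerivAt (x := w.2.2)).comp w hw2
      have h : HasFDerivAt (fun w : Phase d => w.2.2 i * k w) _ w := hwi.mul (hd w).hasFDerivAt
      rw [h.fderiv]
      simp
    have e2 : ∑ i, w.2.2 i * fderiv ℝ k w (0, EuclideanSpace.single i 1, 0)
        = fderiv ℝ k w (0, w.2.2, 0) := by
      have := (EuclideanSpace.basisFun (Fin d) ℝ).sum_repr w.2.2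
      set T : E d →L[ℝ] ℝ := (fderiv ℝ k w).comp ((ContinuousLinearMap.inr ℝ ℝ (E d × E d)).comp
        (ContinuousLinearMap.inl ℝ (E d) (E d))) with hT
      change ∑ i, w.2.2 i * T (EuclideanSpace.single i 1) = T w.2.2
      conv_rhs => rw [← this]
      simp [map_sum]
    simp only [e1, e2]
    unfold transport
    rw [← map_add]
    simp
  have i1 : ∀ (g : Phase d → ℝ) (u : Phase d), ContDiff ℝ ∞ g → HasCompactSupport g →
      Integrable fun w => fderiv ℝ g w u := fun g u hg hgc =>
    (contDiff_fderiv_apply hg (V := fun _ => u) contDiff_const).continuous.integrable_of_hasCompactSupport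
      (hgc.mono' ((subset_tsupport _).trans (tsupport_fderiv_apply_subset g fun _ => u)))
  simp only [e]
  rw [integral_add (i1 _ _ hk hc) (integrable_finsetSum _ fun i _ => i1 _ _ (hk' i) (hc' i)),
    integral_finsetSum _ fun i _ => i1 _ _ (hk' i) (hc' i), integral_fderiv_apply_eq_zero hk hc]
  simp only [integral_fderiv_apply_eq_zero (hk' _) (hc' _), Finset.sum_const_zero, add_zero]

variable {τ σ : ℝ}

theorem integrable_mul_kern_prod (hτ : 0 < τ) (hσ : 0 < σ) {q k : Phase d → ℝ} (hq : Integrable q)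
    (hk : Continuous k) (hc : HasCompactSupport k) :
    Integrable (fun p : Phase d × Phase d => q p.2 * kern τ σ k p.1 p.2)
      (volume.prod volume) := by
  have hJ := jac_kern_pos (d := d) hτ hσ
  have hm : AEStronglyMeasurable (fun p : Phase d × Phase d => q p.2 * kern τ σ k p.1 p.2)
      (volume.prod volume) :=
    hq.aestronglyMeasurable.comp_snd.mul (continuous_uncurry_kern hk).aestronglyMeasurable
  have hi : ∀ z', Integrable fun z => kern τ σ k z z' := by
    intro z'
    have h1 : Integrable k (Measure.map (fun z => pull (τ * σ ^ 2)⁻¹ σ⁻¹ z z') volume) := by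
      rw [map_pull_left (by positivity) (by positivity)]
      exact (hk.integrable_of_hasCompactSupport hc).smul_measure ENNReal.ofReal_ne_top
    exact (h1.comp_measurable (continuous_pull_left _ _ z').measurable).const_mul _
  have hn : ∀ z', ∫ z, ‖kern τ σ k z z'‖ = ∫ w, ‖k w‖ := by
    intro z'
    have := integral_pull_left (d := d) (α := (τ * σ ^ 2)⁻¹) (γ := σ⁻¹) (by positivity)
      (by positivity) z' (g := fun w => ‖k w‖) hk.norm.aestronglyMeasurable
    unfold kern
    simp only [norm_mul, Real.norm_of_nonneg hJ.le]
    rw [integral_const_mul, this, smul_eq_mul, ← mul_assoc, mul_inv_cancel₀ hJ.ne', one_mul]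
  refine (integrable_prod_iff' hm).2 ⟨Filter.Eventually.of_forall fun z' => (hi z').const_mul (q z'), ?_⟩
  have : (fun z' => ∫ z, ‖q z' * kern τ σ k z z'‖) = fun z' => ‖q z'‖ * ∫ w, ‖k w‖ := by
    ext z'
    simp only [norm_mul]
    rw [integral_const_mul, hn]
  exact this ▸ hq.norm.mul_const _

theorem integral_integral_mul_kern (hτ : 0 < τ) (hσ : 0 < σ) {q k : Phase d → ℝ}
    (hq : Integrable q) (hk : Continuous k) (hc : HasCompactSupport k) :
    ∫ z, ∫ z', q z' * kern τ σ k z z' = (∫ z, q z) * ∫ w, k w := by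
  have hJ := jac_kern_pos (d := d) hτ hσ
  rw [integral_integral_swap (integrable_mul_kern_prod hτ hσ hq hk hc), ← integral_mul_const]
  congr 1 with z'
  rw [integral_const_mul]
  unfold kern
  rw [integral_const_mul, integral_pull_left (by positivity) (by positivity) z'
    hk.aestronglyMeasurable, smul_eq_mul, ← mul_assoc (jac _ _ _), mul_inv_cancel₀ hJ.ne', one_mul]

/-- The Leibniz rule separates the derivatives of `χ` from those of the kernel. In this form the
centre `z` enters only through undifferentiated kernels, so the expression can be integrated in `z`
by Fubini and is visibly measurable in centre and scale. -/
theorem functional_mul_kern {f b : Phase d → ℝ} {F : Phase d → E d} (hf : Integrable f)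
    (hb : Integrable b) (hF : Integrable F) {χ θ : Phase d → ℝ} (hχ : ContDiff ℝ ∞ χ)
    (hχc : HasCompactSupport χ) (hθ : ContDiff ℝ ∞ θ) (hθc : HasCompactSupport θ) (hτ : 0 < τ)
    (hσ : 0 < σ) (z : Phase d) :
    functional f b F (fun z' => χ z' * kern τ σ θ z z')
      = (∫ z', (f z' * transport χ z' - inner ℝ (F z') (gradV χ z') + b z' * χ z')
            * kern τ σ θ z z')
        + (τ * σ ^ 2)⁻¹ * (∫ z', f z' * χ z' * kern τ σ (transport θ) z z')
        - σ⁻¹ * ∑ i, ∫ z', F z' i * χ z'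
            * kern τ σ (derivV (EuclideanSpace.single i 1) θ) z z' := by
  have i0 := integrable_functional hf hb hF hχ hχc
  have i1 := integrable_mul_kern i0 hτ hσ hθ.continuous hθc z
  have i2 := integrable_mul_kern (integrable_mul_of_hasCompactSupport hf hχ.continuous hχc) hτ hσ
    (contDiff_transport hθ).continuous (hasCompactSupport_transport hθc) z
  have i3 := fun i => integrable_mul_kern
    (integrable_mul_of_hasCompactSupport (integrable_apply hF i) hχ.continuous hχc) hτ hσ
    (contDiff_derivV hθ (EuclideanSpace.single i 1)).continuous (hasCompactSupport_derivV hθc _) z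
  rw [← integral_finsetSum _ fun i _ => i3 i, ← integral_const_mul, ← integral_const_mul,
    ← integral_add i1 (i2.const_mul _), ← integral_sub (f := fun z => _ + _)
      (i1.add (i2.const_mul _)) ((integrable_finsetSum _ fun i _ => i3 i).const_mul _)]
  unfold functional
  congr 1 with z'
  have h1 : DifferentiableAt ℝ χ z' := hχ.differentiable (by simp) z'
  have h2 : DifferentiableAt ℝ (kern τ σ θ z) z' :=
    (contDiff_kern hθ z).differentiable (by simp) z'
  have h3 := h1.hasFDerivAt.mul h2.hasFDerivAt
  have h3' : HasFDerivAt (fun z' => χ z' * kern τ σ θ z z') _ z' := h3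
  have h4 : transport (fun z' => χ z' * kern τ σ θ z z') z'
      = χ z' * transport (kern τ σ θ z) z' + kern τ σ θ z z' * transport χ z' := by
    unfold transport; rw [h3'.fderiv]; rfl
  have h5 : ∀ e, derivV e (fun z' => χ z' * kern τ σ θ z z') z'
      = χ z' * derivV e (kern τ σ θ z) z' + kern τ σ θ z z' * derivV e χ z' := by
    intro e; unfold derivV; rw [h3'.fderiv]; rfl
  rw [h4, inner_eq_sum, inner_eq_sum]
  simp only [gradV_apply h3'.differentiableAt, gradV_apply h1, h5,
    ← transport_kern hτ hσ hθ, ← derivV_kern hσ hθ]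
  have h6 : ∀ i, F z' i * (χ z' * derivV (EuclideanSpace.single i 1) (kern τ σ θ z) z'
      + kern τ σ θ z z' * derivV (EuclideanSpace.single i 1) χ z')
      = σ⁻¹ * (F z' i * χ z' * (σ * derivV (EuclideanSpace.single i 1) (kern τ σ θ z) z'))
        + kern τ σ θ z z' * (F z' i * derivV (EuclideanSpace.single i 1) χ z') := by
    intro i
    field_simp
  simp only [h6, Finset.sum_add_distrib, ← Finset.mul_sum]
  field_simp
  ring

/-- Superposing the kernels over all centres gives the constant `∫ θ`, so only `functional f b F χ`
remains; the terms where the kernel is differentiated integrate to zero, and the singular factors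
`(τ σ²)⁻¹` and `σ⁻¹` disappear with them. The bound is thus uniform in `σ`. Positivity turns the
integral of the functional into the integral of `mass`. -/
theorem lintegral_mass {f b : Phase d → ℝ} {F : Phase d → E d} (hf : Integrable f)
    (hb : Integrable b) (hF : Integrable F) {χ θ : Phase d → ℝ} (hχ : ContDiff ℝ ∞ χ)
    (hχc : HasCompactSupport χ) (hθ : ContDiff ℝ ∞ θ) (hθc : HasCompactSupport θ) (hτ : 0 < τ)
    (hσ : 0 < σ) (hpos : ∀ z, 0 ≤ functional f b F (fun z' => χ z' * kern τ σ θ z z')) :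
    ∫⁻ z, mass f b F χ θ τ σ z = ENNReal.ofReal (functional f b F χ * ∫ w, θ w) := by
  have i0 := integrable_functional hf hb hF hχ hχc
  have ifχ := integrable_mul_of_hasCompactSupport hf hχ.continuous hχc
  have iFχ := fun i => integrable_mul_of_hasCompactSupport (integrable_apply hF i) hχ.continuous hχc
  have kT := (contDiff_transport hθ).continuous
  have cT := hasCompactSupport_transport hθc
  have kD := fun i : Fin d => (contDiff_derivV hθ (EuclideanSpace.single i 1)).continuous
  have cD := fun i : Fin d => hasCompactSupport_derivV hθc (EuclideanSpace.single i 1)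
  have j1 := (integrable_mul_kern_prod hτ hσ i0 hθ.continuous hθc).integral_prod_left
  have j2 := (integrable_mul_kern_prod hτ hσ ifχ kT cT).integral_prod_left
  have j3 := fun i => (integrable_mul_kern_prod hτ hσ (iFχ i) (kD i) (cD i)).integral_prod_left
  have e := functional_mul_kern (τ := τ) (σ := σ) hf hb hF hχ hχc hθ hθc hτ hσ
  have j : Integrable fun z => functional f b F (fun z' => χ z' * kern τ σ θ z z') := by
    simp only [e]
    exact (j1.add (j2.const_mul _)).sub ((integrable_finsetSum _ fun i _ => j3 i).const_mul _)
  unfold mass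
  rw [← ofReal_integral_eq_lintegral_ofReal j (Filter.Eventually.of_forall hpos)]
  congr 1
  simp only [e]
  rw [integral_sub (f := fun z => _ + _) (j1.add (j2.const_mul _))
    ((integrable_finsetSum _ fun i _ => j3 i).const_mul _),
    integral_add j1 (j2.const_mul _), integral_const_mul, integral_const_mul,
    integral_finsetSum _ fun i _ => j3 i, integral_integral_mul_kern hτ hσ i0 hθ.continuous hθc,
    integral_integral_mul_kern hτ hσ ifχ kT cT, integral_transport_eq_zero hθ hθc]
  simp only [integral_integral_mul_kern hτ hσ (iFχ _) (kD _) (cD _),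
    integral_derivV_eq_zero hθ hθc]
  simp [functional]

end mass

/-! ### Cut-off functions. -/

theorem deriv_smoothTransition_eq_zero {x : ℝ} (hx : x ∉ Icc (0 : ℝ) 1) :
    deriv Real.smoothTransition x = 0 := by
  rw [mem_Icc, not_and_or, not_le, not_le] at hx
  rcases hx with hx | hx
  · have : Real.smoothTransition =ᶠ[nhds x] fun _ => 0 := by
      filter_upwards [gt_mem_nhds hx] with y hy
      exact Real.smoothTransition.zero_of_nonpos (le_of_lt hy)
    rw [this.deriv_eq, deriv_const]
  · have : Real.smoothTransition =ᶠ[nhds x] fun _ => 1 := by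
      filter_upwards [lt_mem_nhds hx] with y hy
      exact Real.smoothTransition.one_of_one_le (le_of_lt hy)
    rw [this.deriv_eq, deriv_const]

theorem exists_deriv_smoothTransition_le :
    ∃ C : ℝ, 0 ≤ C ∧ ∀ x, |deriv Real.smoothTransition x| ≤ C := by
  have hc : Continuous (deriv Real.smoothTransition) :=
    (Real.smoothTransition.contDiff (n := ⊤)).continuous_deriv (by simp)
  obtain ⟨C, hC⟩ := (isCompact_Icc (a := (0 : ℝ)) (b := 1)).exists_bound_of_continuousOn
    hc.continuousOn
  have hC0 : 0 ≤ C := (norm_nonneg _).trans (hC 0 (by simp))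
  refine ⟨C, hC0, fun x => ?_⟩
  by_cases hx : x ∈ Icc (0 : ℝ) 1
  · exact hC x hx
  · rw [deriv_smoothTransition_eq_zero hx]
    simpa using hC0

theorem nonneg_of_div_nonneg {x y : ℝ} (hy : 0 < y) (h : 0 ≤ x / y) : 0 ≤ x := by
  have := mul_nonneg h hy.le
  rwa [div_mul_cancel₀ _ hy.ne'] at this

/-- The interior of the kinetic cylinder of radius `R`. -/
def openCylinder (R : ℝ) (z₀ : Phase d) : Set (Phase d) :=
  {z | -R ^ 2 < z.1 - z₀.1 ∧ z.1 - z₀.1 < 0 ∧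
    ‖z.2.1 - z₀.2.1 - (z.1 - z₀.1) • z₀.2.2‖ < R ^ 3 ∧ ‖z.2.2 - z₀.2.2‖ < R}

theorem isOpen_openCylinder (R : ℝ) (z₀ : Phase d) : IsOpen (openCylinder R z₀) := by
  unfold openCylinder
  simp only [ofPred_and]
  refine IsOpen.inter ?_ (IsOpen.inter ?_ (IsOpen.inter ?_ ?_)) <;>
    exact isOpen_lt (by fun_prop) (by fun_prop)

theorem openCylinder_subset (R : ℝ) (z₀ : Phase d) : openCylinder R z₀ ⊆ cylinder R z₀ :=
  fun _ hz => ⟨hz.1, hz.2.1.le, hz.2.2⟩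

/-- The cut-off function centred at the origin. -/
def cutoff (a b τ : ℝ) (w : Phase d) : ℝ :=
  Real.smoothTransition ((w.1 + b ^ 2) / (b ^ 2 - a ^ 2))
    * Real.smoothTransition ((-w.1 - τ / 2) / (τ / 4))
    * Real.smoothTransition ((b ^ 6 - ‖w.2.1‖ ^ 2) / (b ^ 6 - a ^ 6))
    * Real.smoothTransition ((b ^ 2 - ‖w.2.2‖ ^ 2) / (b ^ 2 - a ^ 2))

theorem cutoff_nonneg (a b τ : ℝ) (w : Phase d) : 0 ≤ cutoff a b τ w := by
  unfold cutoff
  have := Real.smoothTransition.nonneg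
  exact mul_nonneg (mul_nonneg (mul_nonneg (this _) (this _)) (this _)) (this _)

theorem cutoff_le_one (a b τ : ℝ) (w : Phase d) : cutoff a b τ w ≤ 1 := by
  unfold cutoff
  have h0 := Real.smoothTransition.nonneg
  have h1 := Real.smoothTransition.le_one
  exact mul_le_one₀ (mul_le_one₀ (mul_le_one₀ (h1 _) (h0 _) (h1 _)) (h0 _) (h1 _)) (h0 _) (h1 _)

theorem contDiff_cutoff (a b τ : ℝ) : ContDiff ℝ ∞ (cutoff (d := d) a b τ) := by
  have hκ : ContDiff ℝ ∞ Real.smoothTransition := Real.smoothTransition.contDiff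
  unfold cutoff
  refine ((ContDiff.mul ?_ ?_).mul ?_).mul ?_
  · exact hκ.comp (by fun_prop)
  · exact hκ.comp (by fun_prop)
  · exact hκ.comp ((contDiff_const.sub ((contDiff_norm_sq ℝ).comp
      (by fun_prop : ContDiff ℝ ∞ fun w : Phase d => w.2.1))).div_const _)
  · exact hκ.comp ((contDiff_const.sub ((contDiff_norm_sq ℝ).comp
      (by fun_prop : ContDiff ℝ ∞ fun w : Phase d => w.2.2))).div_const _)

section

variable {a b τ : ℝ}

theorem cutoff_eq_one (ha : 0 < a) (hab : a < b) (hτ : 0 < τ) {w : Phase d} (h1 : -a ^ 2 ≤ w.1)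
    (h2 : w.1 ≤ -(3 * τ / 4)) (h3 : ‖w.2.1‖ ≤ a ^ 3) (h4 : ‖w.2.2‖ ≤ a) : cutoff a b τ w = 1 := by
  have p2 : 0 < b ^ 2 - a ^ 2 := sub_pos.2 (by gcongr)
  have p6 : 0 < b ^ 6 - a ^ 6 := sub_pos.2 (by gcongr)
  have h3' : ‖w.2.1‖ ^ 2 ≤ a ^ 6 := by
    calc _ ≤ (a ^ 3) ^ 2 := by gcongr
      _ = a ^ 6 := by ring
  have h4' : ‖w.2.2‖ ^ 2 ≤ a ^ 2 := by gcongr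
  unfold cutoff
  rw [Real.smoothTransition.one_of_one_le, Real.smoothTransition.one_of_one_le,
    Real.smoothTransition.one_of_one_le, Real.smoothTransition.one_of_one_le]
  · norm_num
  all_goals rw [le_div_iff₀ (by first | assumption | positivity)]
  all_goals linarith

theorem mem_of_cutoff_ne_zero (ha : 0 < a) (hab : a < b) (hτ : 0 < τ) {w : Phase d}
    (h : cutoff a b τ w ≠ 0) :
    -b ^ 2 ≤ w.1 ∧ w.1 ≤ -(τ / 2) ∧ ‖w.2.1‖ ≤ b ^ 3 ∧ ‖w.2.2‖ ≤ b := by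
  have p2 : 0 < b ^ 2 - a ^ 2 := sub_pos.2 (by gcongr)
  have p6 : 0 < b ^ 6 - a ^ 6 := sub_pos.2 (by gcongr)
  have hb : 0 < b := ha.trans hab
  unfold cutoff at h
  simp only [mul_ne_zero_iff] at h
  obtain ⟨⟨⟨h1, h2⟩, h3⟩, h4⟩ := h
  have key : ∀ {x y : ℝ}, 0 < y → Real.smoothTransition (x / y) ≠ 0 → 0 ≤ x := by
    intro x y hy hxy
    by_contra hx
    exact hxy (Real.smoothTransition.zero_of_nonpos
      (div_nonpos_of_nonpos_of_nonneg (by linarith) hy.le))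
  have k1 := key p2 h1
  have k2 := key (by positivity) h2
  have k3 := key p6 h3
  have k4 := key p2 h4
  refine ⟨by linarith, by linarith, ?_, ?_⟩
  · refine le_of_sq_le_sq ?_ (by positivity)
    nlinarith
  · exact le_of_sq_le_sq (by linarith) hb.le

theorem tsupport_cutoff_subset (ha : 0 < a) (hab : a < b) (hτ : 0 < τ) :
    tsupport (cutoff (d := d) a b τ)
      ⊆ {w | -b ^ 2 ≤ w.1 ∧ w.1 ≤ -(τ / 2) ∧ ‖w.2.1‖ ≤ b ^ 3 ∧ ‖w.2.2‖ ≤ b} := by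
  refine closure_minimal (fun w hw => mem_of_cutoff_ne_zero ha hab hτ hw) ?_
  simp only [ofPred_and]
  refine IsClosed.inter ?_ (IsClosed.inter ?_ (IsClosed.inter ?_ ?_)) <;>
    exact isClosed_le (by fun_prop) (by fun_prop)

/-- The derivative of the cut-off function. -/
theorem fderiv_cutoff (a b τ : ℝ) (w u : Phase d) :
    fderiv ℝ (cutoff a b τ) w u =
      deriv Real.smoothTransition ((w.1 + b ^ 2) / (b ^ 2 - a ^ 2)) * (u.1 / (b ^ 2 - a ^ 2))
        * Real.smoothTransition ((-w.1 - τ / 2) / (τ / 4))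
        * Real.smoothTransition ((b ^ 6 - ‖w.2.1‖ ^ 2) / (b ^ 6 - a ^ 6))
        * Real.smoothTransition ((b ^ 2 - ‖w.2.2‖ ^ 2) / (b ^ 2 - a ^ 2))
      + Real.smoothTransition ((w.1 + b ^ 2) / (b ^ 2 - a ^ 2))
        * (deriv Real.smoothTransition ((-w.1 - τ / 2) / (τ / 4)) * (-u.1 / (τ / 4)))
        * Real.smoothTransition ((b ^ 6 - ‖w.2.1‖ ^ 2) / (b ^ 6 - a ^ 6))
        * Real.smoothTransition ((b ^ 2 - ‖w.2.2‖ ^ 2) / (b ^ 2 - a ^ 2))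
      + Real.smoothTransition ((w.1 + b ^ 2) / (b ^ 2 - a ^ 2))
        * Real.smoothTransition ((-w.1 - τ / 2) / (τ / 4))
        * (deriv Real.smoothTransition ((b ^ 6 - ‖w.2.1‖ ^ 2) / (b ^ 6 - a ^ 6))
          * (-(2 * inner ℝ w.2.1 u.2.1) / (b ^ 6 - a ^ 6)))
        * Real.smoothTransition ((b ^ 2 - ‖w.2.2‖ ^ 2) / (b ^ 2 - a ^ 2))
      + Real.smoothTransition ((w.1 + b ^ 2) / (b ^ 2 - a ^ 2))
        * Real.smoothTransition ((-w.1 - τ / 2) / (τ / 4))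
        * Real.smoothTransition ((b ^ 6 - ‖w.2.1‖ ^ 2) / (b ^ 6 - a ^ 6))
        * (deriv Real.smoothTransition ((b ^ 2 - ‖w.2.2‖ ^ 2) / (b ^ 2 - a ^ 2))
          * (-(2 * inner ℝ w.2.2 u.2.2) / (b ^ 2 - a ^ 2))) := by
  have hκ : ∀ x, HasDerivAt Real.smoothTransition (deriv Real.smoothTransition x) x := fun x =>
    ((Real.smoothTransition.contDiff (n := 1)).differentiable (by simp) x).hasDerivAt
  have hs : HasFDerivAt (fun z : Phase d => z.1)
      (ContinuousLinearMap.fst ℝ ℝ (E d × E d)) w := hasFDerivAt_fst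
  have hw : HasFDerivAt (fun z : Phase d => z.2.2)
      ((ContinuousLinearMap.snd ℝ (E d) (E d)).comp (ContinuousLinearMap.snd ℝ ℝ (E d × E d))) w :=
    HasFDerivAt.comp w (g := fun q : E d × E d => q.2) hasFDerivAt_snd hasFDerivAt_snd
  have hy : HasFDerivAt (fun z : Phase d => z.2.1)
      ((ContinuousLinearMap.fst ℝ (E d) (E d)).comp (ContinuousLinearMap.snd ℝ ℝ (E d × E d))) w :=
    HasFDerivAt.comp w (g := fun q : E d × E d => q.1) hasFDerivAt_fst hasFDerivAt_snd
  have k1 := (hκ _).comp_hasFDerivAt w ((hs.add_const (b ^ 2)).mul_const (b ^ 2 - a ^ 2)⁻¹)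
  have k2 := (hκ _).comp_hasFDerivAt w ((hs.neg.sub_const (τ / 2)).mul_const (τ / 4)⁻¹)
  have k3 := (hκ _).comp_hasFDerivAt w ((hy.norm_sq.const_sub (b ^ 6)).mul_const (b ^ 6 - a ^ 6)⁻¹)
  have k4 := (hκ _).comp_hasFDerivAt w ((hw.norm_sq.const_sub (b ^ 2)).mul_const (b ^ 2 - a ^ 2)⁻¹)
  have h := (((k1.mul k2).mul k3).mul k4).fderiv
  have h' : fderiv ℝ (cutoff a b τ) w = _ := h
  rw [h']
  simp [div_eq_mul_inv]
  ring

/-- The initial-time and position factors each cost `1 / ((b - a) b)`, up to constants. The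
final-time factor costs `4 / τ`, but only on the slab where it varies. Keeping that indicator is
what later turns `τ⁻¹` into `τ^(-1/2)`. -/
theorem abs_transport_cutoff_le {C : ℝ} (hC : 0 ≤ C)
    (hκ : ∀ x, |deriv Real.smoothTransition x| ≤ C) (ha : 0 < a) (hab : a < b) (hτ : 0 < τ)
    (w : Phase d) : |transport (cutoff a b τ) w|
      ≤ C * (3 / ((b - a) * b)
        + (Icc (-(3 * τ / 4)) (-(τ / 2))).indicator (fun _ => 4 / τ) w.1) := by
  have hb : 0 < b := ha.trans hab
  have hba : 0 < b - a := sub_pos.2 hab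
  have p2 : (b - a) * b ≤ b ^ 2 - a ^ 2 := by nlinarith
  have p6 : (b - a) * b ^ 5 ≤ b ^ 6 - a ^ 6 := by
    have h5 : a ^ 5 ≤ b ^ 5 := by gcongr
    nlinarith [mul_le_mul_of_nonneg_left h5 ha.le]
  have q2 : 0 < b ^ 2 - a ^ 2 := lt_of_lt_of_le (by positivity) p2
  have q6 : 0 < b ^ 6 - a ^ 6 := lt_of_lt_of_le (by positivity) p6
  have n0 := Real.smoothTransition.nonneg
  have n1 := Real.smoothTransition.le_one
  have m3 : ∀ {x y z u : ℝ}, 0 ≤ y → y ≤ 1 → 0 ≤ z → z ≤ 1 → 0 ≤ u → u ≤ 1 →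
      |x * y * z * u| ≤ |x| := by
    intro x y z u hy hy' hz hz' hu hu'
    rw [abs_mul, abs_mul, abs_mul, abs_of_nonneg hy, abs_of_nonneg hz, abs_of_nonneg hu]
    have h1 := mul_le_of_le_one_right (abs_nonneg x) hy'
    have h2 := mul_le_of_le_one_right (mul_nonneg (abs_nonneg x) hy) hz'
    have h3 := mul_le_of_le_one_right (mul_nonneg (mul_nonneg (abs_nonneg x) hy) hz) hu'
    linarith
  unfold transport
  rw [fderiv_cutoff]
  simp only [inner_zero_right, mul_zero, neg_zero, zero_div, add_zero]
  set A := Real.smoothTransition ((w.1 + b ^ 2) / (b ^ 2 - a ^ 2))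
  set B := Real.smoothTransition ((-w.1 - τ / 2) / (τ / 4))
  set X := Real.smoothTransition ((b ^ 6 - ‖w.2.1‖ ^ 2) / (b ^ 6 - a ^ 6))
  set V := Real.smoothTransition ((b ^ 2 - ‖w.2.2‖ ^ 2) / (b ^ 2 - a ^ 2)) with hV
  have t1 : |deriv Real.smoothTransition ((w.1 + b ^ 2) / (b ^ 2 - a ^ 2)) * (1 / (b ^ 2 - a ^ 2))
      * B * X * V| ≤ C * (1 / ((b - a) * b)) := by
    refine (m3 (n0 _) (n1 _) (n0 _) (n1 _) (n0 _) (n1 _)).trans ?_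
    rw [abs_mul, abs_of_pos (one_div_pos.2 q2)]
    gcongr
    exact hκ _
  have t2 : |A * (deriv Real.smoothTransition ((-w.1 - τ / 2) / (τ / 4)) * (-1 / (τ / 4))) * X * V|
      ≤ C * (Icc (-(3 * τ / 4)) (-(τ / 2))).indicator (fun _ => 4 / τ) w.1 := by
    rw [mul_comm A]
    refine (m3 (n0 _) (n1 _) (n0 _) (n1 _) (n0 _) (n1 _)).trans ?_
    by_cases hw : w.1 ∈ Icc (-(3 * τ / 4)) (-(τ / 2))
    · rw [indicator_of_mem hw, abs_mul]
      refine mul_le_mul (hκ _) (le_of_eq ?_) (abs_nonneg _) hC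
      rw [neg_div, abs_neg, abs_of_pos (by positivity)]
      field_simp
    · rw [indicator_of_notMem hw, deriv_smoothTransition_eq_zero]
      · simp
      · intro h
        refine hw ⟨?_, ?_⟩
        · have := h.2
          rw [div_le_one (by positivity)] at this
          linarith
        · have := nonneg_of_div_nonneg (show 0 < τ / 4 by positivity) h.1
          linarith
  have t3 : |A * B * (deriv Real.smoothTransition ((b ^ 6 - ‖w.2.1‖ ^ 2) / (b ^ 6 - a ^ 6))
      * (-(2 * inner ℝ w.2.1 w.2.2) / (b ^ 6 - a ^ 6))) * V| ≤ C * (2 / ((b - a) * b)) := by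
    by_cases hy : (b ^ 6 - ‖w.2.1‖ ^ 2) / (b ^ 6 - a ^ 6) ∈ Icc (0 : ℝ) 1
    -- The position derivative is multiplied by the velocity, which is unbounded, but the velocity
    -- cut-off vanishes beyond `b`.
    · by_cases hv : ‖w.2.2‖ ≤ b
      · have hy1 : ‖w.2.1‖ ≤ b ^ 3 := by
          have := nonneg_of_div_nonneg q6 hy.1
          refine le_of_sq_le_sq ?_ (by positivity)
          nlinarith
        rw [show ∀ x : ℝ, A * B * x * V = x * A * B * V from fun x => by ring]
        refine (m3 (n0 _) (n1 _) (n0 _) (n1 _) (n0 _) (n1 _)).trans ?_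
        rw [abs_mul, abs_div, abs_neg, abs_mul, abs_of_pos q6, abs_two]
        have hi : |inner ℝ w.2.1 w.2.2| ≤ b ^ 3 * b :=
          (abs_real_inner_le_norm _ _).trans (by gcongr)
        calc _ ≤ C * (2 * (b ^ 3 * b) / ((b - a) * b ^ 5)) := by
              gcongr
              exact hκ _
          _ = _ := by field_simp
      · have : V = 0 := by
          rw [hV]
          refine Real.smoothTransition.zero_of_nonpos (div_nonpos_of_nonpos_of_nonneg ?_ q2.le)
          rw [not_le] at hv
          have : b ^ 2 < ‖w.2.2‖ ^ 2 := by gcongr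
          linarith
        rw [this, mul_zero, abs_zero]
        positivity
    · rw [deriv_smoothTransition_eq_zero hy]
      simp only [zero_mul, mul_zero, abs_zero]
      positivity
  refine (abs_add_le _ _).trans ?_
  refine (add_le_add ((abs_add_le _ _).trans (add_le_add t1 t2)) t3).trans (le_of_eq ?_)
  field_simp
  ring

theorem norm_gradV_cutoff_le {C : ℝ} (hC : 0 ≤ C)
    (hκ : ∀ x, |deriv Real.smoothTransition x| ≤ C) (ha : 0 < a) (hab : a < b)
    (w : Phase d) : ‖gradV (cutoff a b τ) w‖ ≤ C * (2 / (b - a)) := by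
  have hb : 0 < b := ha.trans hab
  have hba : 0 < b - a := sub_pos.2 hab
  have p2 : (b - a) * b ≤ b ^ 2 - a ^ 2 := by nlinarith
  have q2 : 0 < b ^ 2 - a ^ 2 := lt_of_lt_of_le (by positivity) p2
  have n0 := Real.smoothTransition.nonneg
  have n1 := Real.smoothTransition.le_one
  have key : ∀ e : E d, |derivV e (cutoff a b τ) w| ≤ C * (2 / (b - a)) * ‖e‖ := by
    intro e
    unfold derivV
    rw [fderiv_cutoff]
    simp only [inner_zero_right, mul_zero, neg_zero, zero_div, add_zero, zero_mul, zero_add]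
    set P := Real.smoothTransition ((w.1 + b ^ 2) / (b ^ 2 - a ^ 2))
      * Real.smoothTransition ((-w.1 - τ / 2) / (τ / 4))
      * Real.smoothTransition ((b ^ 6 - ‖w.2.1‖ ^ 2) / (b ^ 6 - a ^ 6)) with hP
    have hP0 : 0 ≤ P := mul_nonneg (mul_nonneg (n0 _) (n0 _)) (n0 _)
    have hP1 : P ≤ 1 := mul_le_one₀ (mul_le_one₀ (n1 _) (n0 _) (n1 _)) (n0 _) (n1 _)
    rw [abs_mul, abs_of_nonneg hP0]
    refine (mul_le_of_le_one_left (abs_nonneg _) hP1).trans ?_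
    by_cases hy : (b ^ 2 - ‖w.2.2‖ ^ 2) / (b ^ 2 - a ^ 2) ∈ Icc (0 : ℝ) 1
    · have hy1 : ‖w.2.2‖ ≤ b := by
        have := nonneg_of_div_nonneg q2 hy.1
        exact le_of_sq_le_sq (by linarith) hb.le
      rw [abs_mul, abs_div, abs_neg, abs_mul, abs_of_pos q2, abs_two]
      have hi : |inner ℝ w.2.2 e| ≤ b * ‖e‖ := (abs_real_inner_le_norm _ _).trans (by gcongr)
      calc _ ≤ C * (2 * (b * ‖e‖) / ((b - a) * b)) := by
            gcongr
            exact hκ _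
        _ = _ := by field_simp
    · rw [deriv_smoothTransition_eq_zero hy]
      simp only [zero_mul, abs_zero]
      positivity
  have h1 := key (gradV (cutoff a b τ) w)
  rw [← inner_gradV ((contDiff_cutoff a b τ).differentiable (by simp) w),
    real_inner_self_eq_norm_sq, abs_of_nonneg (sq_nonneg _), sq] at h1
  rcases (norm_nonneg (gradV (cutoff a b τ) w)).eq_or_lt with h0 | h0
  · rw [← h0]; positivity
  · exact le_of_mul_le_mul_right h1 h0

end

variable (d) in
/-- Cut-off functions adapted to a pair of concentric kinetic cylinders, which vanish near the
final time. -/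
theorem exists_cutoff : ∃ C : ℝ, 0 ≤ C ∧ ∀ (z₀ : Phase d) (r R τ : ℝ), 0 < r → r < R → R < 1 →
    0 < τ → ∃ χ : Phase d → ℝ, IsTest (openCylinder R z₀) χ ∧ (∀ z, 0 ≤ χ z) ∧ (∀ z, χ z ≤ 1) ∧
      (∀ z, -(r + (R - r) / 2) ^ 2 ≤ z.1 - z₀.1 → z.1 - z₀.1 ≤ -(3 * τ / 4) →
        ‖z.2.1 - z₀.2.1 - (z.1 - z₀.1) • z₀.2.2‖ ≤ (r + (R - r) / 2) ^ 3 →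
        ‖z.2.2 - z₀.2.2‖ ≤ r + (R - r) / 2 → χ z = 1) ∧
      (∀ z, |transport χ z| ≤ C * ((R - r)⁻¹ ^ 2
        + (Icc (z₀.1 - 3 * τ / 4) (z₀.1 - τ / 2)).indicator (fun _ => τ⁻¹) z.1)) ∧
      (∀ z, ‖gradV χ z‖ ≤ C * (R - r)⁻¹) := by
  obtain ⟨C, hC, hκ⟩ := exists_deriv_smoothTransition_le
  refine ⟨16 * C, by positivity, fun z₀ r R τ hr hrR hR hτ => ?_⟩
  have hD : 0 < R - r := sub_pos.2 hrR
  -- The cut-off equals `1` up to radius `a`, halfway between `r` and `R`, and vanishes beyond `b`,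
  -- at three quarters of the way. This leaves room for kernels of scale `(R - r) / 4` on one side
  -- and for compact support in the open cylinder on the other.
  set a := r + (R - r) / 2 with ha
  set b := r + 3 * (R - r) / 4 with hb
  have a0 : 0 < a := by positivity
  have hab : a < b := by linarith
  have b0 : 0 < b := a0.trans hab
  have hbR : b < R := by linarith
  have hba : b - a = (R - r) / 4 := by rw [ha, hb]; ring
  have epull : ∀ z : Phase d, pull 1 1 z₀ z
      = (z.1 - z₀.1, z.2.1 - z₀.2.1 - (z.1 - z₀.1) • z₀.2.2, z.2.2 - z₀.2.2) := fun z => by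
    simp [pull]
  have hdiff : Differentiable ℝ (cutoff (d := d) a b τ) :=
    (contDiff_cutoff a b τ).differentiable (by simp)
  refine ⟨fun z => cutoff a b τ (pull 1 1 z₀ z), ⟨?_, ?_, ?_⟩, fun z => cutoff_nonneg _ _ _ _,
    fun z => cutoff_le_one _ _ _ _, ?_, ?_, ?_⟩
  · exact (contDiff_cutoff a b τ).comp (contDiff_pull 1 1 z₀)
  · refine ((isCompact_closedBall (0 : Phase d) 1).image (continuous_push 1 1 z₀)).of_isClosed_subset
      (isClosed_tsupport _) (closure_minimal (fun z hz => ?_)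
        ((isCompact_closedBall (0 : Phase d) 1).image (continuous_push 1 1 z₀)).isClosed)
    obtain ⟨h1, h2, h3, h4⟩ := mem_of_cutoff_ne_zero a0 hab hτ hz
    refine ⟨pull 1 1 z₀ z, ?_, ?_⟩
    · rw [mem_closedBall_zero_iff, Prod.norm_def, Prod.norm_def]
      refine max_le ?_ (max_le ?_ ?_)
      · rw [Real.norm_eq_abs, abs_le]
        constructor <;> nlinarith
      · exact h3.trans (pow_le_one₀ b0.le (by linarith))
      · linarith
    · have := push_pull (α := 1) (γ := 1) one_ne_zero one_ne_zero z₀ z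
      rwa [inv_one] at this
  · rw [(isOpen_openCylinder R z₀).interior_eq]
    intro z hz
    have hz' : pull 1 1 z₀ z ∈ tsupport (cutoff (d := d) a b τ) := by
      have h := tsupport_comp_subset_preimage (cutoff (d := d) a b τ)
        (continuous_pull_right 1 1 z₀)
      exact h hz
    obtain ⟨h1, h2, h3, h4⟩ := tsupport_cutoff_subset a0 hab hτ hz'
    rw [epull] at h1 h2 h3 h4
    simp only at h1 h2 h3 h4
    refine ⟨by nlinarith, by linarith, h3.trans_lt (by gcongr), by linarith⟩
  · intro z h1 h2 h3 h4
    refine cutoff_eq_one a0 hab hτ ?_ ?_ ?_ ?_ <;> rw [epull] <;> assumption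
  · intro z
    rw [transport_comp_pull hdiff, one_mul]
    refine (abs_transport_cutoff_le hC hκ a0 hab hτ _).trans ?_
    have e1 : (Icc (-(3 * τ / 4)) (-(τ / 2))).indicator (fun _ => 4 / τ) (pull 1 1 z₀ z).1
        ≤ 16 * (Icc (z₀.1 - 3 * τ / 4) (z₀.1 - τ / 2)).indicator (fun _ => τ⁻¹) z.1 := by
      rw [epull]
      by_cases hm : z.1 ∈ Icc (z₀.1 - 3 * τ / 4) (z₀.1 - τ / 2)
      · rw [indicator_of_mem hm]
        refine (indicator_le_self' (fun _ _ => by positivity) _).trans ?_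
        rw [div_eq_mul_inv]
        gcongr
        norm_num
      · rw [indicator_of_notMem hm, indicator_of_notMem]
        · simp
        · intro h
          exact hm ⟨by linarith [h.1], by linarith [h.2]⟩
    have e2 : 3 / ((b - a) * b) ≤ 16 * (R - r)⁻¹ ^ 2 := by
      have hb34 : 3 * (R - r) / 4 ≤ b := by linarith
      calc 3 / ((b - a) * b) ≤ 3 / ((R - r) / 4 * (3 * (R - r) / 4)) := by
            rw [hba]; gcongr
        _ = 16 * (R - r)⁻¹ ^ 2 := by field_simp; norm_num
    calc _ ≤ C * (16 * (R - r)⁻¹ ^ 2 + 16 * (Icc (z₀.1 - 3 * τ / 4) (z₀.1 - τ / 2)).indicator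
          (fun _ => τ⁻¹) z.1) := by gcongr
      _ = _ := by ring
  · intro z
    rw [gradV_comp_pull hdiff, one_smul]
    refine (norm_gradV_cutoff_le hC hκ a0 hab _).trans (le_of_eq_of_le (b := 8 * C * (R - r)⁻¹) ?_ ?_)
    · rw [hba]; field_simp; ring
    · gcongr; norm_num

/-- Kernels of small scale centred in the small cylinder live where the cut-off equals `1`. -/
theorem inside_of_mem {z₀ z : Phase d} {r R τ : ℝ} (hr : 0 < r) (hrR : r < R) (hτ : 0 < τ)
    (hτ1 : τ ≤ 1) (hR : R < 1) {χ : Phase d → ℝ}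
    (hχ : ∀ z : Phase d, -(r + (R - r) / 2) ^ 2 ≤ z.1 - z₀.1 → z.1 - z₀.1 ≤ -(3 * τ / 4) →
        ‖z.2.1 - z₀.2.1 - (z.1 - z₀.1) • z₀.2.2‖ ≤ (r + (R - r) / 2) ^ 3 →
        ‖z.2.2 - z₀.2.2‖ ≤ r + (R - r) / 2 → χ z = 1)
    (hz : z ∈ cylinder r z₀) (ht : z.1 - z₀.1 ≤ -τ) : Inside χ τ ((R - r) / 4) z := by
  rintro σ ⟨hσ, hσs⟩ z' hw
  set D := R - r with hD'
  have hD : 0 < D := sub_pos.2 hrR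
  have ez := push_pull (α := τ * σ ^ 2) (γ := σ) (by positivity) hσ.ne' z z'
  set w := pull (τ * σ ^ 2)⁻¹ σ⁻¹ z z' with hw'
  have w1 : |w.1| ≤ 1 := (norm_fst_le w).trans hw
  have w2 : ‖w.2.1‖ ≤ 1 := (norm_fst_le w.2).trans ((norm_snd_le w).trans hw)
  have w3 : ‖w.2.2‖ ≤ 1 := (norm_snd_le w.2).trans ((norm_snd_le w).trans hw)
  obtain ⟨z1, z2, z3, z4⟩ := hz
  have hσ2 : τ * σ ^ 2 ≤ σ ^ 2 := mul_le_of_le_one_left (sq_nonneg _) hτ1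
  have hσD : σ ^ 2 ≤ (D / 4) ^ 2 := by gcongr
  have hp : |τ * σ ^ 2 * w.1| ≤ τ * σ ^ 2 := by
    rw [abs_mul, abs_of_pos (by positivity)]
    exact mul_le_of_le_one_right (by positivity) w1
  have hp' := abs_le.1 hp
  have hD1 : D ≤ 1 := by linarith
  rw [← ez]
  refine hχ _ ?_ ?_ ?_ ?_
  · simp only [push]
    nlinarith
  · simp only [push]
    -- The time scale of the kernel is proportional to `τ`, so from `t - t₀ ≤ -τ` the kernel cannot
    -- reach beyond `t₀ - 3 τ / 4`, where the cut-off begins to decrease.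
    have : τ * σ ^ 2 ≤ τ * (1 / 4) := by
      gcongr
      nlinarith
    linarith
  · simp only [push]
    have e : z.2.1 + (τ * σ ^ 2 * w.1) • z.2.2 + (τ * σ ^ 2 * σ) • w.2.1 - z₀.2.1
        - (z.1 + τ * σ ^ 2 * w.1 - z₀.1) • z₀.2.2
        = (z.2.1 - z₀.2.1 - (z.1 - z₀.1) • z₀.2.2) + (τ * σ ^ 2 * w.1) • (z.2.2 - z₀.2.2)
          + (τ * σ ^ 2 * σ) • w.2.1 := by
      module
    rw [e]
    have n1 : ‖(τ * σ ^ 2 * w.1) • (z.2.2 - z₀.2.2)‖ ≤ (D / 4) ^ 2 * r := by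
      rw [norm_smul, Real.norm_eq_abs]
      gcongr
      exact hp.trans (hσ2.trans hσD)
    have n2 : ‖(τ * σ ^ 2 * σ) • w.2.1‖ ≤ (D / 4) ^ 2 * (D / 4) := by
      rw [norm_smul, Real.norm_of_nonneg (by positivity)]
      calc _ ≤ τ * σ ^ 2 * σ * 1 := by gcongr
        _ ≤ (D / 4) ^ 2 * (D / 4) := by rw [mul_one]; gcongr; exact hσ2.trans hσD
    refine (norm_add_le _ _).trans ((add_le_add_left (norm_add_le _ _) _).trans ?_)
    have : 0 < r * D ^ 2 := by positivity
    have : 0 < r ^ 2 * D := by positivity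
    have : 0 < D ^ 3 := by positivity
    nlinarith
  · simp only [push]
    have e : z.2.2 + σ • w.2.2 - z₀.2.2 = (z.2.2 - z₀.2.2) + σ • w.2.2 := by abel
    rw [e]
    refine (norm_add_le _ _).trans ?_
    rw [norm_smul, Real.norm_of_nonneg hσ.le]
    nlinarith

/-! ### Controlled data and the total mass of the defect. -/

/-- Data supported in the kinetic cylinder of radius `R`, with `L²` norms measured by `N`. -/
structure IsControlled (z₀ : Phase d) (r R N : ℝ) (f b : Phase d → ℝ) (F G : Phase d → E d) :
    Prop where
  nonneg : 0 ≤ N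
  zero_f : ∀ z, z ∉ cylinder R z₀ → f z = 0
  zero_b : ∀ z, z ∉ cylinder R z₀ → b z = 0
  zero_F : ∀ z, z ∉ cylinder R z₀ → F z = 0
  sq_f : ∫⁻ z, ‖f z‖ₑ ^ 2 ≤ ENNReal.ofReal ((R - r) ^ 2 * N) ^ 2
  sq_b : ∫⁻ z, ‖b z‖ₑ ^ 2 ≤ ENNReal.ofReal N ^ 2
  sq_F : ∫⁻ z, ‖F z‖ₑ ^ 2 ≤ ENNReal.ofReal ((R - r) * N) ^ 2
  sq_G : ∫⁻ z, ‖G z‖ₑ ^ 2 ≤ ENNReal.ofReal ((R - r) * N) ^ 2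

/-- The volume of the unit ball of `ℝ^d`. -/
def unitVol (d : ℕ) : ℝ := (volume (Metric.ball (0 : E d) 1)).toReal

theorem unitVol_nonneg (d : ℕ) : 0 ≤ unitVol d := ENNReal.toReal_nonneg

theorem measurableSet_cylinder (R : ℝ) (z₀ : Phase d) : MeasurableSet (cylinder R z₀) := by
  unfold cylinder
  simp only [ofPred_and]
  refine MeasurableSet.inter ?_ (MeasurableSet.inter ?_ (MeasurableSet.inter ?_ ?_))
  · exact measurableSet_lt (by fun_prop) (by fun_prop)
  · exact measurableSet_le (by fun_prop) (by fun_prop)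
  · exact measurableSet_lt (by fun_prop) (by fun_prop)
  · exact measurableSet_lt (by fun_prop) (by fun_prop)

/-- The part of a kinetic cylinder of radius at most one in a time slab. -/
theorem volume_cylinder_inter_le {R : ℝ} (hR : R ≤ 1) (hR0 : 0 ≤ R) (z₀ : Phase d) {p q : ℝ}
    (hpq : p ≤ q) :
    volume (cylinder R z₀ ∩ {z | z.1 ∈ Icc p q}) ≤ ENNReal.ofReal (unitVol d ^ 2 * (q - p)) := by
  have hmp : Measure.map (pull 1 1 z₀) volume = volume := by
    rw [map_pull_right one_pos one_pos]
    simp [jac]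
  have hsub : cylinder R z₀ ∩ {z | z.1 ∈ Icc p q} ⊆ pull 1 1 z₀ ⁻¹'
      (Icc (p - z₀.1) (q - z₀.1) ×ˢ (Metric.ball (0 : E d) 1 ×ˢ Metric.ball (0 : E d) 1)) := by
    rintro z ⟨⟨_, _, h3, h4⟩, h5⟩
    simp only [pull, one_mul, one_smul, mem_preimage, mem_prod, mem_Icc, mem_ball_zero_iff,
      mul_one]
    refine ⟨⟨by linarith [h5.1], by linarith [h5.2]⟩, h3.trans_le (pow_le_one₀ hR0 hR),
      h4.trans_le hR⟩
  have hms : MeasurableSet (Icc (p - z₀.1) (q - z₀.1) ×ˢ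
      (Metric.ball (0 : E d) 1 ×ˢ Metric.ball (0 : E d) 1)) :=
    measurableSet_Icc.prod (measurableSet_ball.prod measurableSet_ball)
  refine (measure_mono hsub).trans ?_
  rw [← Measure.map_apply (continuous_pull_right _ _ _).measurable hms, hmp]
  have e : volume (Icc (p - z₀.1) (q - z₀.1) ×ˢ
      (Metric.ball (0 : E d) 1 ×ˢ Metric.ball (0 : E d) 1))
      = volume (Icc (p - z₀.1) (q - z₀.1)) *
        (volume (Metric.ball (0 : E d) 1) * volume (Metric.ball (0 : E d) 1)) := by
    rw [← Measure.prod_prod, ← Measure.prod_prod]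
    rfl
  have hb : volume (Metric.ball (0 : E d) 1) = ENNReal.ofReal (unitVol d) :=
    (ENNReal.ofReal_toReal measure_ball_lt_top.ne).symm
  rw [e, Real.volume_Icc, hb, ← ENNReal.ofReal_mul (unitVol_nonneg d),
    ← ENNReal.ofReal_mul (by linarith)]
  refine ENNReal.ofReal_le_ofReal (le_of_eq ?_)
  ring

theorem volume_cylinder_ne_top {R : ℝ} (hR0 : 0 ≤ R) (hR : R ≤ 1) (z₀ : Phase d) :
    volume (cylinder R z₀) ≠ ⊤ := by
  have h := volume_cylinder_inter_le hR hR0 z₀ (p := z₀.1 - R ^ 2) (q := z₀.1)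
    (by linarith [sq_nonneg R])
  refine ne_top_of_le_ne_top ENNReal.ofReal_ne_top ((measure_mono fun z hz => ?_).trans h)
  exact ⟨hz, by linarith [hz.1], by linarith [hz.2.1]⟩

theorem setLIntegral_le_of_sq {X : Type*} [MeasurableSpace X] {μ : Measure X} {u : X → ℝ≥0∞}
    (hu : AEMeasurable u μ) {S : Set X} {v A : ℝ} (hv : 0 ≤ v)
    (hS : μ S ≤ ENNReal.ofReal v) (hA : ∫⁻ x, u x ^ 2 ∂μ ≤ ENNReal.ofReal A ^ 2) :
    ∫⁻ x in S, u x ∂μ ≤ ENNReal.ofReal (√v * A) := by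
  have h := sq_lintegral_mul_le (μ := μ.restrict S) (u := fun _ => 1) aemeasurable_const hu.restrict
  simp only [one_mul, lintegral_one, Measure.restrict_apply_univ] at h
  have h2 : (∫⁻ x in S, u x ∂μ) ^ 2 ≤ ENNReal.ofReal (√v * A) ^ 2 := by
    refine h.trans ((mul_le_mul' hS ((setLIntegral_le_lintegral _ _).trans hA)).trans (le_of_eq ?_))
    rw [ENNReal.ofReal_mul (Real.sqrt_nonneg v), mul_pow, ← ENNReal.ofReal_pow (Real.sqrt_nonneg v),
      Real.sq_sqrt hv]
  exact (ENNReal.pow_le_pow_left_iff two_ne_zero).1 h2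

theorem lintegral_le_of_sq_of_zero {R N A : ℝ} {z₀ : Phase d} (hR0 : 0 ≤ R) (hR : R ≤ 1)
    {u : Phase d → ℝ≥0∞} (hu : Measurable u) (h0 : ∀ z, z ∉ cylinder R z₀ → u z = 0)
    (hA : ∫⁻ z, u z ^ 2 ≤ ENNReal.ofReal A ^ 2) (hAN : A ≤ N) :
    ∫⁻ z, u z ≤ ENNReal.ofReal (unitVol d * N) := by
  have hS := volume_cylinder_inter_le hR hR0 z₀ (p := z₀.1 - 1) (q := z₀.1) (by linarith)
  have e : cylinder R z₀ ∩ {z | z.1 ∈ Icc (z₀.1 - 1) z₀.1} = cylinder R z₀ := by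
    refine inter_eq_left.2 fun z hz => ⟨?_, ?_⟩
    · have : R ^ 2 ≤ 1 := pow_le_one₀ hR0 hR
      linarith [hz.1]
    · linarith [hz.2.1]
  rw [e, sub_sub_cancel, mul_one] at hS
  have h1 := setLIntegral_le_of_sq hu.aemeasurable (sq_nonneg _) hS hA
  rw [Real.sqrt_sq (unitVol_nonneg d)] at h1
  rw [setLIntegral_eq_of_support_subset] at h1
  · exact h1.trans (ENNReal.ofReal_le_ofReal
      (mul_le_mul_of_nonneg_left hAN (unitVol_nonneg d)))
  · intro z hz
    by_contra h
    exact hz (h0 z h)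

/-- The total mass of the defect functional away from the final time. -/
theorem IsControlled.functional_le {O : Set (Phase d)} {z₀ : Phase d} {r R N : ℝ}
    {f b : Phase d → ℝ} {F G : Phase d → E d} (H : IsSubsolutionOn O f b F G)
    (hc : IsControlled z₀ r R N f b F G) (hr : 0 < r) (hrR : r < R) (hR : R < 1) {τ C : ℝ}
    (hC : 0 ≤ C) (hτ : 0 < τ) (hτ1 : τ ≤ 1) {χ : Phase d → ℝ}
    (h0 : ∀ z, 0 ≤ χ z) (h1 : ∀ z, χ z ≤ 1)
    (hT : ∀ z, |transport χ z| ≤ C * ((R - r)⁻¹ ^ 2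
        + (Icc (z₀.1 - 3 * τ / 4) (z₀.1 - τ / 2)).indicator (fun _ => τ⁻¹) z.1))
    (hV : ∀ z, ‖gradV χ z‖ ≤ C * (R - r)⁻¹) :
    functional f b F χ ≤ unitVol d * (3 * C + 1) * N * (√τ)⁻¹ := by
  have hD : 0 < R - r := sub_pos.2 hrR
  have hR0 : 0 < R := hr.trans hrR
  have hN := hc.nonneg
  set D := R - r with hDdef
  set V := unitVol d with hVd
  have hV0 : 0 ≤ V := unitVol_nonneg d
  have hst : 0 < √τ := Real.sqrt_pos.2 hτ
  have mf := H.measurable_f.enorm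
  have mF := H.measurable_F.enorm
  have mb := H.measurable_b.enorm
  set S : Set (Phase d) := cylinder R z₀ ∩ {z | z.1 ∈ Icc (z₀.1 - 3 * τ / 4) (z₀.1 - τ / 2)} with hS
  have hSm : MeasurableSet S := (measurableSet_cylinder R z₀).inter (measurable_fst measurableSet_Icc)
  have point : ∀ z, ‖f z * transport χ z - inner ℝ (F z) (gradV χ z) + b z * χ z‖ₑ
      ≤ ENNReal.ofReal (C * D⁻¹ ^ 2) * ‖f z‖ₑ
        + ENNReal.ofReal (C * τ⁻¹) * S.indicator (fun z => ‖f z‖ₑ) z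
        + ENNReal.ofReal (C * D⁻¹) * ‖F z‖ₑ + ‖b z‖ₑ := by
    intro z
    refine (enorm_add_le _ _).trans (add_le_add (enorm_sub_le.trans (add_le_add ?_ ?_)) ?_)
    · by_cases hz : z ∈ cylinder R z₀
      · rw [enorm_mul, mul_comm ‖f z‖ₑ, Real.enorm_eq_ofReal_abs (transport χ z)]
        have hTz := hT z
        by_cases hz2 : z.1 ∈ Icc (z₀.1 - 3 * τ / 4) (z₀.1 - τ / 2)
        · rw [indicator_of_mem hz2] at hTz
          rw [indicator_of_mem (show z ∈ S from ⟨hz, hz2⟩), ← add_mul,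
            ← ENNReal.ofReal_add (by positivity) (by positivity)]
          gcongr
          linarith
        · rw [indicator_of_notMem hz2, add_zero] at hTz
          refine le_trans ?_ le_self_add
          gcongr
      · rw [hc.zero_f z hz]
        simp
    · rw [mul_comm, Real.enorm_eq_ofReal_abs]
      refine (ENNReal.ofReal_le_ofReal (abs_real_inner_le_norm _ _)).trans ?_
      rw [ENNReal.ofReal_mul (norm_nonneg _), ofReal_norm]
      gcongr
      exact hV z
    · rw [enorm_mul]
      refine mul_le_of_le_one_right' ?_
      rw [Real.enorm_eq_ofReal_abs, abs_of_nonneg (h0 z)]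
      exact ENNReal.ofReal_le_one.2 (h1 z)
  have b1 : ∫⁻ z, ‖f z‖ₑ ≤ ENNReal.ofReal (V * (D ^ 2 * N)) :=
    lintegral_le_of_sq_of_zero (z₀ := z₀) hR0.le hR.le mf (fun z hz => by simp [hc.zero_f z hz]) hc.sq_f le_rfl
  have b2 : ∫⁻ z, ‖F z‖ₑ ≤ ENNReal.ofReal (V * (D * N)) :=
    lintegral_le_of_sq_of_zero (z₀ := z₀) hR0.le hR.le mF (fun z hz => by simp [hc.zero_F z hz]) hc.sq_F le_rfl
  have b3 : ∫⁻ z, ‖b z‖ₑ ≤ ENNReal.ofReal (V * N) :=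
    lintegral_le_of_sq_of_zero (z₀ := z₀) hR0.le hR.le mb (fun z hz => by simp [hc.zero_b z hz]) hc.sq_b le_rfl
  -- Cauchy–Schwarz on a slab of thickness `τ / 4`: the factor `√τ` gained here meets the `τ⁻¹` of
  -- the final-time cut-off.
  have b4 : ∫⁻ z, S.indicator (fun z => ‖f z‖ₑ) z ≤ ENNReal.ofReal (V * √τ * N) := by
    rw [lintegral_indicator hSm]
    have hv := volume_cylinder_inter_le hR.le hR0.le z₀ (p := z₀.1 - 3 * τ / 4)
      (q := z₀.1 - τ / 2) (by linarith)
    refine (setLIntegral_le_of_sq mf.aemeasurable (mul_nonneg (sq_nonneg _) (by linarith)) hv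
      hc.sq_f).trans (ENNReal.ofReal_le_ofReal ?_)
    rw [Real.sqrt_mul (sq_nonneg _), Real.sqrt_sq hV0]
    have h2 : √(z₀.1 - τ / 2 - (z₀.1 - 3 * τ / 4)) ≤ √τ := Real.sqrt_le_sqrt (by linarith)
    have h3 : D ^ 2 * N ≤ N := by
      refine mul_le_of_le_one_left hN (pow_le_one₀ hD.le (by linarith))
    gcongr
  have hm1 : Measurable fun z => ENNReal.ofReal (C * D⁻¹ ^ 2) * ‖f z‖ₑ := mf.const_mul _
  have hm2 : Measurable fun z => ENNReal.ofReal (C * τ⁻¹) * S.indicator (fun z => ‖f z‖ₑ) z :=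
    (mf.indicator hSm).const_mul _
  have hm3 : Measurable fun z => ENNReal.ofReal (C * D⁻¹) * ‖F z‖ₑ := mF.const_mul _
  -- The powers of `R - r` in `IsControlled` cancel exactly those produced by the derivatives of the
  -- cut-off.
  have total : ENNReal.ofReal (functional f b F χ)
      ≤ ENNReal.ofReal (C * D⁻¹ ^ 2 * (V * (D ^ 2 * N)) + C * τ⁻¹ * (V * √τ * N)
        + C * D⁻¹ * (V * (D * N)) + V * N) := by
    have e1 : ENNReal.ofReal (functional f b F χ) ≤ ‖functional f b F χ‖ₑ := by
      rw [Real.enorm_eq_ofReal_abs]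
      exact ENNReal.ofReal_le_ofReal (le_abs_self _)
    refine e1.trans ((enorm_integral_le_lintegral_enorm _).trans ((lintegral_mono point).trans ?_))
    rw [lintegral_add_left (by exact (hm1.add hm2).add hm3),
      lintegral_add_left (by exact hm1.add hm2), lintegral_add_left hm1, lintegral_const_mul _ mf, lintegral_const_mul _ (mf.indicator hSm),
      lintegral_const_mul _ mF, ENNReal.ofReal_add (by positivity) (by positivity),
      ENNReal.ofReal_add (by positivity) (by positivity),
      ENNReal.ofReal_add (by positivity) (by positivity),
      ENNReal.ofReal_mul (p := C * D⁻¹ ^ 2) (by positivity),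
      ENNReal.ofReal_mul (p := C * τ⁻¹) (by positivity),
      ENNReal.ofReal_mul (p := C * D⁻¹) (by positivity)]
    gcongr
  have h3 := (ENNReal.ofReal_le_ofReal_iff (by positivity)).1 total
  refine h3.trans ?_
  have e : τ⁻¹ * √τ = (√τ)⁻¹ := by
    have : τ = √τ * √τ := (Real.mul_self_sqrt hτ.le).symm
    rw [this, Real.sqrt_mul_self hst.le]
    field_simp
  have h4 : 1 ≤ (√τ)⁻¹ := (one_le_inv₀ hst).2 (Real.sqrt_le_one.2 hτ1)
  calc _ = V * N * (2 * C + 1) + V * N * C * (τ⁻¹ * √τ) := by field_simp; ring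
    _ ≤ V * N * (2 * C + 1) * (√τ)⁻¹ + V * N * C * (√τ)⁻¹ := by
        rw [e]
        exact add_le_add_left (le_mul_of_one_le_right (by positivity) h4) _
    _ = _ := by ring

/-! ### Integration of the increment factor over all scales. -/

theorem min_one_le_rpow {x β : ℝ} (hx : 0 ≤ x) (hβ : 0 ≤ β) (hβ1 : β ≤ 1) : min 1 x ≤ x ^ β := by
  rcases hx.eq_or_lt with rfl | hx
  · exact (min_le_right _ _).trans (Real.rpow_nonneg le_rfl _)
  rcases le_total x 1 with h | h
  · refine (min_le_right _ _).trans ?_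
    simpa using Real.rpow_le_rpow_of_exponent_ge hx h hβ1
  · exact (min_le_left _ _).trans (Real.one_le_rpow h hβ)

theorem incr_le_rpow {τ σ β : ℝ} (hτ : 0 < τ) (hσ : 0 < σ) (hβ : 0 ≤ β) (hβ1 : β ≤ 1) (h : E d) :
    incr τ σ h ≤ (‖h‖ / τ) ^ β * σ ^ (-(3 * β)) := by
  refine (min_one_le_rpow (by positivity) hβ hβ1).trans (le_of_eq ?_)
  have e : ‖h‖ / (τ * σ ^ 3) = ‖h‖ / τ / σ ^ 3 := by field_simp
  rw [e, Real.div_rpow (by positivity) (by positivity), ← Real.rpow_natCast, ← Real.rpow_mul hσ.le,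
    Real.rpow_neg hσ.le, div_eq_mul_inv]
  norm_num

theorem lintegral_rpow_Ioc_le {e s : ℝ} (he : -1 < e) (hs : 0 ≤ s) (hs1 : s ≤ 1) :
    ∫⁻ σ in Ioc 0 s, ENNReal.ofReal (σ ^ e) ≤ ENNReal.ofReal (e + 1)⁻¹ := by
  have hi : IntegrableOn (fun σ : ℝ => σ ^ e) (Ioc 0 s) :=
    (intervalIntegrable_iff_integrableOn_Ioc_of_le hs).1 (intervalIntegral.intervalIntegrable_rpow' he)
  rw [← ofReal_integral_eq_lintegral_ofReal hi ((ae_restrict_iff' measurableSet_Ioc).2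
    (Filter.Eventually.of_forall fun σ hσ => Real.rpow_nonneg hσ.1.le _)),
    ← intervalIntegral.integral_of_le hs, integral_rpow (Or.inl he)]
  have h1 : 0 < e + 1 := by linarith
  refine ENNReal.ofReal_le_ofReal ?_
  rw [Real.zero_rpow h1.ne', sub_zero, div_eq_mul_inv]
  exact mul_le_of_le_one_left (by positivity) (Real.rpow_le_one hs hs1 h1.le)

/-- Interpolating `min 1 x ≤ x ^ β` gives the power `σ ^ (-3 β)`, integrable at `0` exactly when `β
< 1/3`. This is the threshold of the theorem. -/
theorem lintegral_incr_le {τ s β : ℝ} (hτ : 0 < τ) (hs : 0 ≤ s) (hs1 : s ≤ 1) (hβ : 0 ≤ β)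
    (hβ1 : β < 1 / 3) (h : E d) {c : ℝ} (hc : 0 ≤ c) :
    ∫⁻ σ in Ioc 0 s, ENNReal.ofReal (c * incr τ σ h)
      ≤ ENNReal.ofReal (c * (1 - 3 * β)⁻¹ * (‖h‖ / τ) ^ β) := by
  calc _ ≤ ∫⁻ σ in Ioc 0 s, ENNReal.ofReal (c * (‖h‖ / τ) ^ β) * ENNReal.ofReal (σ ^ (-(3 * β))) := by
        refine setLIntegral_mono' measurableSet_Ioc fun σ hσ => ?_
        rw [← ENNReal.ofReal_mul (by positivity), mul_assoc]
        exact ENNReal.ofReal_le_ofReal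
          (mul_le_mul_of_nonneg_left (incr_le_rpow hτ hσ.1 hβ (by linarith) h) hc)
    _ ≤ ENNReal.ofReal (c * (‖h‖ / τ) ^ β) * ENNReal.ofReal (-(3 * β) + 1)⁻¹ := by
        rw [lintegral_const_mul _ (by fun_prop)]
        exact mul_le_mul_right (lintegral_rpow_Ioc_le (by linarith) hs hs1) _
    _ = _ := by
        rw [← ENNReal.ofReal_mul (by positivity)]
        congr 1
        rw [neg_add_eq_sub]
        ring

/-- The additional factor `σ` makes `σ ^ (1 - 6 β)` integrable, so the exponent of `‖h‖ / τ` may be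
doubled under the same condition on `β`. This doubling compensates for the defect being controlled
in `L¹` only. -/
theorem lintegral_mul_incr_le {τ s β : ℝ} (hτ : 0 < τ) (hs : 0 ≤ s) (hs1 : s ≤ 1) (hβ : 0 ≤ β)
    (hβ1 : β < 1 / 3) (h : E d) {c : ℝ} (hc : 0 ≤ c) :
    ∫⁻ σ in Ioc 0 s, ENNReal.ofReal (c * (τ * σ) * incr τ σ h)
      ≤ ENNReal.ofReal (c * (2 - 6 * β)⁻¹ * τ * (‖h‖ / τ) ^ (2 * β)) := by
  calc _ ≤ ∫⁻ σ in Ioc 0 s, ENNReal.ofReal (c * τ * (‖h‖ / τ) ^ (2 * β))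
          * ENNReal.ofReal (σ ^ (1 - 6 * β)) := by
        refine setLIntegral_mono' measurableSet_Ioc fun σ hσ => ?_
        have h0 : 0 < σ := hσ.1
        rw [← ENNReal.ofReal_mul (by positivity)]
        refine ENNReal.ofReal_le_ofReal ?_
        have e : σ ^ (1 - 6 * β) = σ * σ ^ (-(3 * (2 * β))) := by
          nth_rw 2 [← Real.rpow_one σ]
          rw [← Real.rpow_add hσ.1]
          ring_nf
        have := mul_le_mul_of_nonneg_left (incr_le_rpow hτ hσ.1 (β := 2 * β) (by linarith)
          (by linarith) h) (a := c * (τ * σ)) (by positivity)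
        refine this.trans (le_of_eq ?_)
        rw [e]
        ring
    _ ≤ ENNReal.ofReal (c * τ * (‖h‖ / τ) ^ (2 * β)) * ENNReal.ofReal (1 - 6 * β + 1)⁻¹ := by
        rw [lintegral_const_mul _ (by fun_prop)]
        exact mul_le_mul_right (lintegral_rpow_Ioc_le (by linarith) hs hs1) _
    _ = _ := by
        rw [← ENNReal.ofReal_mul (by positivity)]
        congr 1
        have : 1 - 6 * β + 1 = 2 - 6 * β := by ring
        rw [this]
        ring

/-! ### Measurability in the centre and the scale. -/

theorem measurable_incr (τ : ℝ) (h : E d) : Measurable fun σ => incr τ σ h := by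
  unfold incr; fun_prop

theorem measurable_slice {X Y : Type*} [MeasurableSpace X] [MeasurableSpace Y] {M : X × Y → ℝ≥0∞}
    (hM : Measurable M) (x : X) : Measurable fun y => M (x, y) :=
  hM.comp measurable_prodMk_left

theorem measurable_slice_left {X Y : Type*} [MeasurableSpace X] [MeasurableSpace Y]
    {M : X × Y → ℝ≥0∞} (hM : Measurable M) (y : Y) : Measurable fun x => M (x, y) :=
  hM.comp measurable_prodMk_right

theorem measurable_avg_swap {θ : Phase d → ℝ} (hθ : Continuous θ) (τ : ℝ) {g : Phase d → ℝ≥0∞}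
    (hg : Measurable g) : Measurable fun p : Phase d × ℝ => avg τ p.2 θ g p.1 := by
  unfold avg
  have h1 : Measurable fun q : (Phase d × ℝ) × Phase d => (q.1.2, q.1.1, q.2) := by fun_prop
  have h2 : Measurable fun q : (Phase d × ℝ) × Phase d => g q.2 := hg.comp measurable_snd
  exact (h2.mul ((measurable_kern hθ τ).comp h1).ennreal_ofReal).lintegral_prod_right'

theorem measurable_integral_mul_kern {q k : Phase d → ℝ} (hq : Measurable q) (hk : Continuous k)
    (τ : ℝ) : Measurable fun p : Phase d × ℝ => ∫ z', q z' * kern τ p.2 k p.1 z' := by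
  have h1 : Measurable fun q : (Phase d × ℝ) × Phase d => (q.1.2, q.1.1, q.2) := by fun_prop
  have h2 : Measurable fun p : (Phase d × ℝ) × Phase d => q p.2 := hq.comp measurable_snd
  have h3 := (measurable_kern hk τ).comp h1
  exact (StronglyMeasurable.integral_prod_right (f := fun (p : Phase d × ℝ) z' =>
    q z' * kern τ p.2 k p.1 z') (h2.mul h3).stronglyMeasurable).measurable

/-- The expanded formula is jointly measurable but agrees with `mass` for `σ > 0` only, because its
derivation divides by `σ`. The function `M` is the formula itself, and only positive scales are ever
integrated. -/
theorem exists_measurable_mass {f b : Phase d → ℝ} {F : Phase d → E d} (hf : Integrable f)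
    (hb : Integrable b) (hF : Integrable F) (mf : Measurable f) (mb : Measurable b)
    (mF : Measurable F) {χ θ : Phase d → ℝ} (hχ : ContDiff ℝ ∞ χ)
    (hχc : HasCompactSupport χ) (hθ : ContDiff ℝ ∞ θ) (hθc : HasCompactSupport θ) {τ : ℝ}
    (hτ : 0 < τ) : ∃ M : Phase d × ℝ → ℝ≥0∞, Measurable M ∧
      ∀ σ, 0 < σ → ∀ z, mass f b F χ θ τ σ z = M (z, σ) := by
  have hg : Measurable fun z => inner ℝ (F z) (gradV χ z) := by
    have : (fun z => inner ℝ (F z) (gradV χ z))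
        = fun z => ∑ i, F z i * derivV (EuclideanSpace.single i 1) χ z := by
      ext z
      rw [inner_eq_sum]
      simp only [gradV_apply (hχ.differentiable (by simp) z)]
    rw [this]
    refine Finset.measurable_sum _ fun i _ => ?_
    exact (show Measurable fun z => F z i by fun_prop).mul (contDiff_derivV hχ _).continuous.measurable
  have mT := (contDiff_transport hχ).continuous.measurable
  have mχ := hχ.continuous.measurable
  refine ⟨fun p => ENNReal.ofReal ((∫ z', (f z' * transport χ z' - inner ℝ (F z') (gradV χ z')
      + b z' * χ z') * kern τ p.2 θ p.1 z')
        + (τ * p.2 ^ 2)⁻¹ * (∫ z', f z' * χ z' * kern τ p.2 (transport θ) p.1 z')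
        - p.2⁻¹ * ∑ i, ∫ z', F z' i * χ z'
            * kern τ p.2 (derivV (EuclideanSpace.single i 1) θ) p.1 z'), ?_, fun σ hσ z => ?_⟩
  · have a1 := measurable_integral_mul_kern (((mf.mul mT).sub hg).add (mb.mul mχ)) hθ.continuous τ
    have a2 := measurable_integral_mul_kern (mf.mul mχ) (contDiff_transport hθ).continuous τ
    have a3 := fun i : Fin d => measurable_integral_mul_kern
      ((show Measurable fun z => F z i by fun_prop).mul mχ)
      (contDiff_derivV hθ (EuclideanSpace.single i 1)).continuous τ
    have c1 : Measurable fun p : Phase d × ℝ => (τ * p.2 ^ 2)⁻¹ := by fun_prop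
    have c2 : Measurable fun p : Phase d × ℝ => p.2⁻¹ := by fun_prop
    exact ((a1.add (c1.mul a2)).sub (c2.mul (Finset.measurable_sum _ fun i _ => a3 i))).ennreal_ofReal
  · unfold mass
    rw [functional_mul_kern hf hb hF hχ hχc hθ hθc hτ hσ]

/-! ### Increments of the mollifications, uniformly in the scale. -/

theorem lintegral_sq_add_le {X : Type*} [MeasurableSpace X] {μ : Measure X} {u v : X → ℝ≥0∞}
    (hu : AEMeasurable u μ) (hv : AEMeasurable v μ) {A B : ℝ≥0∞} (hA : ∫⁻ x, u x ^ 2 ∂μ ≤ A ^ 2)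
    (hB : ∫⁻ x, v x ^ 2 ∂μ ≤ B ^ 2) : ∫⁻ x, (u x + v x) ^ 2 ∂μ ≤ (A + B) ^ 2 := by
  have h := ENNReal.lintegral_Lp_add_le hu hv (p := 2) (by norm_num)
  have e : ∀ I J : ℝ≥0∞, I ≤ J ^ 2 → I ^ (1 / 2 : ℝ) ≤ J := by
    intro I J hIJ
    refine (ENNReal.rpow_le_rpow hIJ (by norm_num)).trans (le_of_eq ?_)
    rw [← ENNReal.rpow_natCast, ← ENNReal.rpow_mul]
    norm_num
  simp only [ENNReal.rpow_ofNat, Pi.add_apply] at h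
  have h2 := ENNReal.rpow_le_rpow (h.trans (add_le_add (e _ _ hA) (e _ _ hB)))
    (z := 2) (by norm_num)
  rw [← ENNReal.rpow_mul] at h2
  simpa using h2

set_option maxHeartbeats 400000 in
/-- The increments in position of the mollifications, uniformly in the scale of mollification,
are controlled by a square integrable and an integrable function. -/
theorem IsControlled.exists_bound {z₀ : Phase d} {r R N : ℝ}
    {f b : Phase d → ℝ} {F G : Phase d → E d} (H : IsSubsolutionOn (openCylinder R z₀) f b F G)
    (hc : IsControlled z₀ r R N f b F G) (hr : 0 < r) (hrR : r < R) (hR : R < 1)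
    {ψ θ : Phase d → ℝ} {C : ℝ} (K : IsKernelPair ψ θ C) {τ C' β : ℝ}
    (hC' : 0 ≤ C') (hτ : 0 < τ) (hτ1 : τ ≤ 1) (hβ : 0 ≤ β) (hβ1 : β < 1 / 3) {χ : Phase d → ℝ}
    (hχ : IsTest (openCylinder R z₀) χ)
    (h0 : ∀ z, 0 ≤ χ z) (h1 : ∀ z, χ z ≤ 1)
    (hT : ∀ z, |transport χ z| ≤ C' * ((R - r)⁻¹ ^ 2
        + (Icc (z₀.1 - 3 * τ / 4) (z₀.1 - τ / 2)).indicator (fun _ => τ⁻¹) z.1))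
    (hV : ∀ z, ‖gradV χ z‖ ≤ C' * (R - r)⁻¹) (h : E d) :
    ∃ Y Z : Phase d → ℝ≥0∞, Measurable Y ∧ Measurable Z ∧
      ∫⁻ z, Y z ^ 2 ≤ ENNReal.ofReal ((4 * C + 3 * C * (2 * d + 1) * (1 - 3 * β)⁻¹) * (∫ w, θ w)
        * N * (‖h‖ / τ) ^ β) ^ 2 ∧
      ∫⁻ z, Z z ≤ ENNReal.ofReal (C * (2 - 6 * β)⁻¹ * (∫ w, θ w) * (unitVol d * (3 * C' + 1)) * N
        * √τ * (‖h‖ / τ) ^ (2 * β)) ∧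
      ∀ ρ ∈ Ioc 0 ((R - r) / 4), ∀ z, Inside χ τ ((R - r) / 4) z →
        Inside χ τ ((R - r) / 4) (z + (0, h, 0)) →
        ‖moll τ ρ ψ f (z + (0, h, 0)) - moll τ ρ ψ f z‖ₑ
          ≤ (Y (z + (0, h, 0)) + Y z) + (Z (z + (0, h, 0)) + Z z) := by
  have hD : 0 < R - r := sub_pos.2 hrR
  have hN := hc.nonneg
  have hCn := K.nonneg_C
  have hfun := hc.functional_le H hr hrR hR hC' hτ hτ1 h0 h1 hT hV
  set D := R - r with hDdef
  have hD1 : D ≤ 1 := by linarith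
  set s := D / 4 with hs
  have s0 : 0 < s := by positivity
  have s1 : s ≤ 1 := by linarith
  set u := ‖h‖ / τ with hu
  have hu0 : 0 ≤ u := by positivity
  have kθ := K.contDiff_θ.continuous
  set Θ := ∫ w, θ w with hΘ
  have hΘ0 : 0 ≤ Θ := integral_nonneg K.nonneg_θ
  have eΘ : ∫⁻ w, ENNReal.ofReal (θ w) = ENNReal.ofReal Θ :=
    (ofReal_integral_eq_lintegral_ofReal (kθ.integrable_of_hasCompactSupport K.hasCompactSupport_θ)
      (Filter.Eventually.of_forall K.nonneg_θ)).symm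
  have mf := H.measurable_f.enorm
  have mF := H.measurable_F.enorm
  have mb := H.measurable_b.enorm
  have mG := H.measurable_G.enorm
  have ms : Measurable (size b F G) := (mF.add mb).add mG
  have hDN : D * N ≤ N := mul_le_of_le_one_left hN hD1
  have sz : ∫⁻ z, size b F G z ^ 2 ≤ ENNReal.ofReal (3 * N) ^ 2 := by
    have := lintegral_sq_add_le (mF.add mb).aemeasurable mG.aemeasurable
      (lintegral_sq_add_le mF.aemeasurable mb.aemeasurable hc.sq_F hc.sq_b) hc.sq_G
    refine this.trans (pow_le_pow_left' ?_ 2)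
    rw [← ENNReal.ofReal_add (by positivity) hN, ← ENNReal.ofReal_add (by positivity)
      (by positivity)]
    exact ENNReal.ofReal_le_ofReal (by linarith)
  obtain ⟨M, hM, eM⟩ := exists_measurable_mass H.integrable_f H.integrable_b H.integrable_F
    H.measurable_f H.measurable_b H.measurable_F hχ.contDiff hχ.hasCompactSupport K.contDiff_θ
    K.hasCompactSupport_θ hτ
  set c₁ : ℝ := C * (2 * d + 1) with hc₁
  have c₁0 : 0 ≤ c₁ := by positivity
  -- `X` accounts for the increment at the top scale `s = (R - r) / 4`, `Y₁` for `F`, `b` and `G`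
  -- over all scales, and `Z` for the defect over all scales.
  set X : Phase d → ℝ≥0∞ := fun z => ENNReal.ofReal (C * incr τ s h) * avg τ s θ (fun z => ‖f z‖ₑ) z
    with hX
  set m₁ : ℝ → ℝ≥0∞ := fun σ => ENNReal.ofReal (c₁ * incr τ σ h) with hm₁
  set m₂ : ℝ → ℝ≥0∞ := fun σ => ENNReal.ofReal (C * (τ * σ) * incr τ σ h) with hm₂
  have mm₁ : Measurable m₁ := ((measurable_incr τ h).const_mul _).ennreal_ofReal
  have mm₂ : Measurable m₂ := by
    have : Measurable fun σ : ℝ => C * (τ * σ) := by fun_prop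
    exact (this.mul (measurable_incr τ h)).ennreal_ofReal
  set Y₁ : Phase d → ℝ≥0∞ := fun z => ∫⁻ σ in Ioc 0 s, m₁ σ * avg τ σ θ (size b F G) z with hY₁
  set Z : Phase d → ℝ≥0∞ := fun z => ∫⁻ σ in Ioc 0 s, m₂ σ * M (z, σ) with hZ
  have mX : Measurable X := (measurable_avg_right τ s kθ mf).const_mul _
  have ja : Measurable fun p : Phase d × ℝ => m₁ p.2 * avg τ p.2 θ (size b F G) p.1 := by
    exact (mm₁.comp measurable_snd).mul (measurable_avg_swap kθ τ ms)
  have jM : Measurable fun p : Phase d × ℝ => m₂ p.2 * M p :=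
    (mm₂.comp measurable_snd).mul hM
  have mY₁ : Measurable Y₁ := ja.lintegral_prod_right'
  have mZ : Measurable Z := jM.lintegral_prod_right'
  refine ⟨fun z => X z + Y₁ z, Z, mX.add mY₁, mZ, ?_, ?_, ?_⟩
  · have bX : ∫⁻ z, X z ^ 2 ≤ ENNReal.ofReal (4 * C * Θ * N * u ^ β) ^ 2 := by
      simp only [hX, mul_pow]
      rw [lintegral_const_mul _ ((measurable_avg_right τ s kθ mf).pow_const 2)]
      have h2 := (lintegral_sq_avg_le hτ s0 kθ mf).trans (mul_le_mul_right hc.sq_f _)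
      refine (mul_le_mul_right h2 _).trans ?_
      rw [eΘ, ← mul_pow, ← mul_pow, ← ENNReal.ofReal_mul hΘ0, ← ENNReal.ofReal_mul
        (mul_nonneg hCn (incr_nonneg hτ s0 h))]
      refine pow_le_pow_left' (ENNReal.ofReal_le_ofReal ?_) 2
      -- Since `3 β < 1`, the loss at scale `s` is at most `s⁻¹ = 4 / D`, which the factor `D²` in
      -- the bound of `f` absorbs.
      have h3 : incr τ s h ≤ u ^ β * s⁻¹ := by
        refine (incr_le_rpow hτ s0 hβ (by linarith) h).trans ?_
        gcongr
        rw [← Real.rpow_neg_one s]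
        exact Real.rpow_le_rpow_of_exponent_ge s0 s1 (by linarith)
      calc C * incr τ s h * (Θ * (D ^ 2 * N)) ≤ C * (u ^ β * s⁻¹) * (Θ * (D ^ 2 * N)) := by gcongr
        _ = 4 * C * Θ * u ^ β * (D * N) := by rw [hs]; field_simp
        _ ≤ 4 * C * Θ * u ^ β * N := by gcongr
        _ = _ := by ring
    have bY : ∫⁻ z, Y₁ z ^ 2 ≤ ENNReal.ofReal (3 * c₁ * (1 - 3 * β)⁻¹ * Θ * N * u ^ β) ^ 2 := by
      refine (lintegral_sq_lintegral_avg_le hτ kθ ms mm₁).trans ?_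
      refine (mul_le_mul' (mul_le_mul' (pow_le_pow_left' (lintegral_incr_le hτ s0.le s1 hβ hβ1 h c₁0) 2)
        le_rfl) sz).trans (le_of_eq ?_)
      have : 0 < 1 - 3 * β := by linarith
      rw [eΘ, ← mul_pow, ← mul_pow, ← ENNReal.ofReal_mul (by positivity),
        ← ENNReal.ofReal_mul (by positivity)]
      congr 2
      ring
    refine (lintegral_sq_add_le mX.aemeasurable mY₁.aemeasurable bX bY).trans (le_of_eq ?_)
    have : 0 < 1 - 3 * β := by linarith
    rw [← ENNReal.ofReal_add (by positivity) (by positivity)]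
    congr 2
    ring
  · rw [hZ, lintegral_lintegral_swap (by exact jM.aemeasurable)]
    have hpos : ∀ σ z, 0 < σ → 0 ≤ functional f b F (fun z' => χ z' * kern τ σ θ z z') := by
      intro σ z hσ
      refine H.nonneg _ ⟨hχ.contDiff.mul (contDiff_kern K.contDiff_θ z), hχ.hasCompactSupport.mul_right,
        (closure_mono (Function.support_mul_subset_left _ _)).trans hχ.tsupport_subset⟩ fun z' =>
        mul_nonneg (h0 z') (kern_nonneg hτ hσ K.nonneg_θ _ _)
    have step : ∀ σ ∈ Ioc 0 s, ∫⁻ z, m₂ σ * M (z, σ)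
        ≤ m₂ σ * ENNReal.ofReal (unitVol d * (3 * C' + 1) * N * (√τ)⁻¹ * Θ) := by
      intro σ hσ
      simp only [← eM σ hσ.1]
      have hmm : Measurable fun z => mass f b F χ θ τ σ z := by
        have h2 : (fun z => mass f b F χ θ τ σ z) = fun z => M (z, σ) := funext fun z => eM σ hσ.1 z
        have h1 : Measurable fun z => M (z, σ) := measurable_slice_left (M := M) hM σ
        rw [h2]
        exact h1
      rw [lintegral_const_mul _ hmm, lintegral_mass H.integrable_f H.integrable_b H.integrable_F
        hχ.contDiff hχ.hasCompactSupport K.contDiff_θ K.hasCompactSupport_θ hτ hσ.1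
        fun z => hpos σ z hσ.1]
      gcongr
    refine (setLIntegral_mono' measurableSet_Ioc step).trans ?_
    rw [lintegral_mul_const _ mm₂]
    refine (mul_le_mul_left (lintegral_mul_incr_le hτ s0.le s1 hβ hβ1 h hCn) _).trans (le_of_eq ?_)
    have : 0 < 2 - 6 * β := by linarith
    rw [← ENNReal.ofReal_mul (by positivity)]
    congr 1
    -- The factor `τ` from the equation more than compensates the `τ^(-1/2)` in the mass of the
    -- defect.
    have e : τ * (√τ)⁻¹ = √τ := by
      have := Real.mul_self_sqrt hτ.le
      have h2 : 0 < √τ := Real.sqrt_pos.2 hτ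
      field_simp
      rw [sq]; exact this.symm
    linear_combination (C * (2 - 6 * β)⁻¹ * Θ * (unitVol d * (3 * C' + 1)) * N * u ^ (2 * β)) * e
  · intro ρ hρ z hz hz'
    refine (K.enorm_moll_sub_le (isOpen_openCylinder R z₀) H hτ hτ1 hρ.1 hρ.2 s1 hχ h0 h hz hz').trans ?_
    have first : ‖moll τ s ψ f (z + (0, h, 0)) - moll τ s ψ f z‖ₑ ≤ X (z + (0, h, 0)) + X z := by
      have hψc : HasCompactSupport ψ :=
        (isCompact_closedBall (0 : Phase d) 1).of_isClosed_subset (isClosed_tsupport _) K.tsupport_ψ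
      have hi := integrable_mul_kern H.integrable_f hτ s0 K.contDiff_ψ.continuous hψc
      have := enorm_integral_kern_sub_le hτ s0 hCn kθ K.nonneg_θ K.dom_ψ H.measurable_f h z
      simp only [mul_sub] at this
      rw [integral_sub (hi _) (hi _), mul_add] at this
      exact this
    have second : ∫⁻ σ in Ioc 0 s, incrBound f b F G χ θ C τ σ h z
        = (Y₁ (z + (0, h, 0)) + Y₁ z) + (Z (z + (0, h, 0)) + Z z) := by
      have a1 : ∀ y, Measurable fun σ => m₁ σ * avg τ σ θ (size b F G) y := fun y =>
        measurable_slice ja y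
      have a2 : ∀ y, Measurable fun σ => m₂ σ * M (y, σ) := fun y => measurable_slice jM y
      have e : ∫⁻ σ in Ioc 0 s, incrBound f b F G χ θ C τ σ h z
          = ∫⁻ σ in Ioc 0 s, ((m₁ σ * avg τ σ θ (size b F G) (z + (0, h, 0))
            + m₁ σ * avg τ σ θ (size b F G) z)
            + (m₂ σ * M (z + (0, h, 0), σ) + m₂ σ * M (z, σ))) := by
        refine setLIntegral_congr_fun measurableSet_Ioc fun σ hσ => ?_
        simp only [incrBound, eM σ hσ.1, mul_add, hm₁, hm₂, hc₁]
      rw [e, lintegral_add_left (by exact (a1 _).add (a1 _)), lintegral_add_left (a1 _),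
        lintegral_add_left (a2 _)]
    rw [second]
    refine (add_le_add_left first _).trans (le_of_eq ?_)
    ring

/-! ### Removing the mollification. -/

/-- In the rescaled variable the scale sits in the argument of `g` and the weight is fixed, so the
limit `ρ → 0` becomes dominated convergence. -/
theorem moll_eq_integral_push {τ ρ : ℝ} (hτ : 0 < τ) (hρ : 0 < ρ) {ψ g : Phase d → ℝ}
    (hψ : Continuous ψ) (hg : Continuous g) (z : Phase d) :
    moll τ ρ ψ g z = ∫ w, g (push (τ * ρ ^ 2) ρ z w) * ψ w := by
  have hJ := jac_kern_pos (d := d) hτ hρ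
  have h1 := integral_pull_right (d := d) (α := (τ * ρ ^ 2)⁻¹) (γ := ρ⁻¹) (by positivity)
    (by positivity) z (g := fun w => g (push (τ * ρ ^ 2) ρ z w) * ψ w)
    ((hg.comp (continuous_push _ _ _)).mul hψ).aestronglyMeasurable
  have h2 : ∀ z', g (push (τ * ρ ^ 2) ρ z (pull (τ * ρ ^ 2)⁻¹ ρ⁻¹ z z')) = g z' := fun z' => by
    rw [push_pull (by positivity) hρ.ne']
  simp only [h2] at h1
  unfold moll kern
  simp only [mul_left_comm (g _)]
  rw [integral_const_mul, h1, smul_eq_mul, ← mul_assoc, mul_inv_cancel₀ hJ.ne', one_mul]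

theorem continuous_push_scale (τ : ℝ) (z w : Phase d) :
    Continuous fun ρ => push (τ * ρ ^ 2) ρ z w := by
  unfold push; fun_prop

theorem push_zero (τ : ℝ) (z w : Phase d) : push (τ * 0 ^ 2) 0 z w = z := by
  simp [push]

/-- Mollifications of a bounded continuous function converge pointwise. -/
theorem tendsto_moll {τ : ℝ} (hτ : 0 < τ) {ψ g : Phase d → ℝ} (hψ : Continuous ψ)
    (hψi : Integrable ψ) (h1 : ∫ w, ψ w = 1) (hg : Continuous g) {M : ℝ} (hM : ∀ z, ‖g z‖ ≤ M)
    {ρ : ℕ → ℝ} (hρ : ∀ n, 0 < ρ n) (hρ0 : Filter.Tendsto ρ Filter.atTop (nhds 0)) (z : Phase d) :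
    Filter.Tendsto (fun n => moll τ (ρ n) ψ g z) Filter.atTop (nhds (g z)) := by
  simp only [fun n => moll_eq_integral_push hτ (hρ n) hψ hg z]
  have e : g z = ∫ w, g z * ψ w := by rw [integral_const_mul, h1, mul_one]
  rw [e]
  refine tendsto_integral_of_dominated_convergence (fun w => M * ‖ψ w‖)
    (fun n => ((hg.comp (continuous_push _ _ _)).mul hψ).aestronglyMeasurable)
    (hψi.norm.const_mul _) (fun n => Filter.Eventually.of_forall fun w => ?_)
    (Filter.Eventually.of_forall fun w => ?_)
  · rw [norm_mul]
    exact mul_le_mul_of_nonneg_right (hM _) (norm_nonneg _)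
  · refine Filter.Tendsto.mul_const _ ((hg.tendsto _).comp ?_)
    have := (continuous_push_scale τ z w).tendsto 0
    rw [push_zero] at this
    exact this.comp hρ0

theorem measurable_moll {ψ g : Phase d → ℝ} (hψ : Continuous ψ) (hg : Measurable g) (τ ρ : ℝ) :
    Measurable (moll τ ρ ψ g) := by
  have h2 : Measurable fun p : Phase d × Phase d => g p.2 := hg.comp measurable_snd
  have h3 := (continuous_uncurry_kern (τ := τ) (σ := ρ) hψ).measurable
  exact (StronglyMeasurable.integral_prod_right (f := fun (z : Phase d) z' =>
    g z' * kern τ ρ ψ z z') (h2.mul h3).stronglyMeasurable).measurable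

/-- Mollification does not increase the `L¹` norm. -/
theorem lintegral_enorm_moll_le {τ ρ : ℝ} (hτ : 0 < τ) (hρ : 0 < ρ) {ψ g : Phase d → ℝ}
    (hψ : Continuous ψ) (hψi : Integrable ψ) (hψ0 : ∀ w, 0 ≤ ψ w) (h1 : ∫ w, ψ w = 1)
    (hg : Measurable g) : ∫⁻ z, ‖moll τ ρ ψ g z‖ₑ ≤ ∫⁻ z, ‖g z‖ₑ := by
  have e := lintegral_avg hτ hρ hψ hg.enorm
  rw [← ofReal_integral_eq_lintegral_ofReal hψi (Filter.Eventually.of_forall hψ0), h1,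
    ENNReal.ofReal_one, one_mul] at e
  rw [← e]
  refine lintegral_mono fun z => (enorm_integral_le_lintegral_enorm _).trans (le_of_eq ?_)
  unfold avg
  congr 1 with z'
  rw [enorm_mul, Real.enorm_of_nonneg (kern_nonneg hτ hρ hψ0 z z')]

/-- Mollifications of an integrable function converge almost everywhere along a sequence. -/
theorem exists_seq_tendsto_moll {τ s : ℝ} (hτ : 0 < τ) (hs : 0 < s) {ψ f : Phase d → ℝ}
    (hψ : Continuous ψ) (hψc : HasCompactSupport ψ) (hψ0 : ∀ w, 0 ≤ ψ w) (h1 : ∫ w, ψ w = 1)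
    (hf : Integrable f) (mf : Measurable f) {S : Set (Phase d)} (hS : volume S ≠ ⊤) :
    ∃ ρ : ℕ → ℝ, (∀ n, ρ n ∈ Ioc 0 s) ∧ ∀ᵐ z ∂volume.restrict S,
      Filter.Tendsto (fun n => moll τ (ρ n) ψ f z) Filter.atTop (nhds (f z)) := by
  have hψi : Integrable ψ := hψ.integrable_of_hasCompactSupport hψc
  set ρ : ℕ → ℝ := fun n => s / (n + 1) with hρd
  have hρ : ∀ n, 0 < ρ n := fun n => by positivity
  have hρs : ∀ n, ρ n ≤ s := fun n => div_le_self hs.le (by linarith [n.cast_nonneg (α := ℝ)])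
  have hρ0 : Filter.Tendsto ρ Filter.atTop (nhds 0) :=
    tendsto_const_nhds.div_atTop
      (Filter.tendsto_atTop_add_const_right _ _ tendsto_natCast_atTop_atTop)
  have : IsFiniteMeasure (volume.restrict S) := ⟨by simpa using hS.lt_top⟩
  have key : Filter.Tendsto (fun n => eLpNorm (moll τ (ρ n) ψ f - f) 1 (volume.restrict S))
      Filter.atTop (nhds 0) := by
    refine ENNReal.tendsto_atTop_zero.2 fun δ hδ => ?_
    -- Approximation by a continuous compactly supported `g`: one third of `δ` for each of the
    -- mollified difference, the mollification error of `g`, and the difference. The first is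
    -- bounded by the third because mollification contracts `L¹`.
    obtain ⟨g, hgc, hgδ, hg, hgi⟩ := hf.exists_hasCompactSupport_lintegral_sub_le
      (ε := δ / 3) (by simpa using hδ.ne')
    obtain ⟨M, hM⟩ := hg.bounded_above_of_compact_support hgc
    have hpt := fun z => tendsto_moll hτ hψ hψi h1 hg hM hρ hρ0 z
    have hlim : Filter.Tendsto (fun n => ∫⁻ z in S, ‖moll τ (ρ n) ψ g z - g z‖ₑ) Filter.atTop
        (nhds 0) := by
      have hM0 : 0 ≤ M := (norm_nonneg _).trans (hM 0)
      have := tendsto_lintegral_of_dominated_convergence (μ := volume.restrict S)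
        (F := fun n z => ‖moll τ (ρ n) ψ g z - g z‖ₑ) (f := fun _ => 0)
        (fun _ => ENNReal.ofReal (M + M))
        (fun n => ((measurable_moll hψ hg.measurable τ (ρ n)).sub hg.measurable).enorm)
        (fun n => Filter.Eventually.of_forall fun z => ?_)
        (by rw [lintegral_const]; exact ENNReal.mul_ne_top ENNReal.ofReal_ne_top (measure_ne_top _ _))
        (Filter.Eventually.of_forall fun z => ?_)
      · simpa using this
      · beta_reduce
        rw [← ofReal_norm]
        refine ENNReal.ofReal_le_ofReal ((norm_sub_le _ _).trans (add_le_add ?_ (hM z)))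
        rw [moll_eq_integral_push hτ (hρ n) hψ hg]
        refine (norm_integral_le_integral_norm _).trans ?_
        refine (integral_mono_of_nonneg (Filter.Eventually.of_forall fun w => norm_nonneg _)
          (hψi.const_mul M) (Filter.Eventually.of_forall fun w => ?_)).trans (le_of_eq ?_)
        · simp only [norm_mul, Real.norm_of_nonneg (hψ0 w)]
          exact mul_le_mul_of_nonneg_right (hM _) (hψ0 w)
        · rw [integral_const_mul, h1, mul_one]
      · have := ((hpt z).sub_const (g z)).enorm
        simpa using this
    obtain ⟨n₀, hn₀⟩ := ENNReal.tendsto_atTop_zero.1 hlim (δ / 3) (ENNReal.div_pos hδ.ne' (by simp))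
    refine ⟨n₀, fun n hn => ?_⟩
    have mg := hg.measurable
    rw [eLpNorm_one_eq_lintegral_enorm]
    have hlin : ∀ z, moll τ (ρ n) ψ f z = moll τ (ρ n) ψ (fun z => f z - g z) z
        + moll τ (ρ n) ψ g z := by
      intro z
      unfold moll
      rw [← integral_add (by exact integrable_mul_kern (hf.sub hgi) hτ (hρ n) hψ hψc z)
        (integrable_mul_kern hgi hτ (hρ n) hψ hψc z)]
      congr 1 with z'
      ring
    calc ∫⁻ z in S, ‖(moll τ (ρ n) ψ f - f) z‖ₑ
        ≤ ∫⁻ z in S, (‖moll τ (ρ n) ψ (fun z => f z - g z) z‖ₑ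
            + (‖moll τ (ρ n) ψ g z - g z‖ₑ + ‖f z - g z‖ₑ)) := by
          refine lintegral_mono fun z => ?_
          have : (moll τ (ρ n) ψ f - f) z = moll τ (ρ n) ψ (fun z => f z - g z) z
              + ((moll τ (ρ n) ψ g z - g z) - (f z - g z)) := by
            rw [Pi.sub_apply, hlin]; ring
          rw [this]
          exact (enorm_add_le _ _).trans (add_le_add_right enorm_sub_le _)
      _ ≤ δ / 3 + (δ / 3 + δ / 3) := by
          have m1 := (measurable_moll hψ (mf.sub mg) τ (ρ n)).enorm
          have m2 := ((measurable_moll hψ mg τ (ρ n)).sub mg).enorm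
          rw [lintegral_add_left (by exact m1), lintegral_add_left (by exact m2)]
          refine add_le_add ?_ (add_le_add (hn₀ n hn) ((setLIntegral_le_lintegral _ _).trans hgδ))
          exact (setLIntegral_le_lintegral _ _).trans
            ((lintegral_enorm_moll_le hτ (hρ n) hψ hψi hψ0 h1 (mf.sub mg)).trans hgδ)
      _ = δ := by rw [← add_assoc, ENNReal.add_thirds]
  obtain ⟨ns, _, hae⟩ := (tendstoInMeasure_of_tendsto_eLpNorm one_ne_zero
    (fun n => (measurable_moll hψ mf τ (ρ n)).aestronglyMeasurable) mf.aestronglyMeasurable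
    key).exists_seq_tendsto_ae
  exact ⟨fun n => ρ (ns n), fun n => ⟨hρ _, hρs _⟩, hae⟩

/-- A function whose mollifications have increments bounded by `Y` almost surely has increments
bounded by `Y`. -/
theorem ae_enorm_sub_le_of_moll {τ s : ℝ} (hτ : 0 < τ) (hs : 0 < s) {ψ f : Phase d → ℝ}
    (hψ : Continuous ψ) (hψc : HasCompactSupport ψ) (hψ0 : ∀ w, 0 ≤ ψ w) (h1 : ∫ w, ψ w = 1)
    (hf : Integrable f) (mf : Measurable f) {S : Set (Phase d)} (hSm : MeasurableSet S)
    (hS : volume S ≠ ⊤) {T : Set (Phase d)} (η : Phase d) {Y : Phase d → ℝ≥0∞}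
    (hT : ∀ z ∈ T, z ∈ S ∧ z + η ∈ S)
    (hY : ∀ ρ ∈ Ioc 0 s, ∀ z ∈ T, ‖moll τ ρ ψ f (z + η) - moll τ ρ ψ f z‖ₑ ≤ Y z) :
    ∀ᵐ z, z ∈ T → ‖f (z + η) - f z‖ₑ ≤ Y z := by
  obtain ⟨ρ, hρ, hae⟩ := exists_seq_tendsto_moll hτ hs hψ hψc hψ0 h1 hf mf hS
  rw [ae_restrict_iff' hSm] at hae
  -- Convergence is also needed at the translated point; translation preserves null sets.
  have hae' := (measurePreserving_add_right (volume : Measure (Phase d)) η).quasiMeasurePreserving.ae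
    hae
  filter_upwards [hae, hae'] with z a1 a2 hz
  have hl := ((a2 (hT z hz).2).sub (a1 (hT z hz).1)).enorm
  exact le_of_tendsto hl (Filter.Eventually.of_forall fun n => hY _ (hρ n) z hz)

/-! ### Interpolation and the estimate in a time layer. -/

/-- Interpolation for a function which is bounded in `L²` and by the sum of a function of `L²` and
a function of `L¹`. -/
theorem lintegral_rpow_le_of_le_add {X : Type*} [MeasurableSpace X] {μ : Measure X}
    {W Y Z : X → ℝ≥0∞} (mW : Measurable W) (mY : Measurable Y) (mZ : Measurable Z) {p : ℝ}
    (hp : 1 < p) (hp2 : p < 2) {v A B D : ℝ} (hv : 0 ≤ v) (hA : 0 ≤ A) (hB : 0 ≤ B) (hD : 0 ≤ D)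
    (hμ : μ univ ≤ ENNReal.ofReal v) (hWYZ : ∀ᵐ x ∂μ, W x ≤ Y x + Z x)
    (hY : ∫⁻ x, Y x ^ 2 ∂μ ≤ ENNReal.ofReal A ^ 2) (hZ : ∫⁻ x, Z x ∂μ ≤ ENNReal.ofReal B)
    (hW : ∫⁻ x, W x ^ 2 ∂μ ≤ ENNReal.ofReal D ^ 2) :
    ∫⁻ x, W x ^ p ∂μ
      ≤ ENNReal.ofReal (2 * (v ^ (1 - p / 2) * A ^ p + B ^ (2 - p) * D ^ (2 * p - 2))) := by
  have point : ∀ᵐ x ∂μ, W x ^ p ≤ 2 * (Y x ^ p + Z x ^ (2 - p) * (W x ^ 2) ^ (p - 1)) := by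
    filter_upwards [hWYZ] with x hx
    -- Capping `Z` by `W` makes `L²` integrability available for the `L¹` part: the exponent `p` of
    -- the minimum is split as `2 - p` on `Z` and `2 (p - 1)` on `W`.
    have h1 : W x ≤ Y x + min (Z x) (W x) := by
      rcases le_total (Z x) (W x) with h | h
      · rwa [min_eq_left h]
      · rw [min_eq_right h]; exact le_add_self
    have h2 : min (Z x) (W x) ^ p ≤ Z x ^ (2 - p) * (W x ^ 2) ^ (p - 1) := by
      have e : p = (2 - p) + 2 * (p - 1) := by ring
      nth_rw 1 [e]
      rw [ENNReal.rpow_add_of_nonneg _ _ (by linarith) (by linarith), ENNReal.rpow_mul,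
        ENNReal.rpow_ofNat]
      refine mul_le_mul' (ENNReal.rpow_le_rpow (min_le_left _ _) (by linarith))
        (ENNReal.rpow_le_rpow (pow_le_pow_left' (min_le_right _ _) 2) (by linarith))
    have h3 : (2 : ℝ≥0∞) ^ (p - 1) ≤ 2 := by
      simpa using ENNReal.rpow_le_rpow_of_exponent_le (x := 2) (by norm_num) (show p - 1 ≤ 1 by linarith)
    calc W x ^ p ≤ (Y x + min (Z x) (W x)) ^ p := ENNReal.rpow_le_rpow h1 (by linarith)
      _ ≤ 2 ^ (p - 1) * (Y x ^ p + min (Z x) (W x) ^ p) :=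
        ENNReal.rpow_add_le_mul_rpow_add_rpow _ _ hp.le
      _ ≤ _ := mul_le_mul' h3 (add_le_add_right h2 _)
  have iY : ∫⁻ x, Y x ^ p ∂μ ≤ ENNReal.ofReal (v ^ (1 - p / 2) * A ^ p) := by
    have h := ENNReal.lintegral_mul_norm_pow_le (μ := μ) (f := fun _ => 1)
      aemeasurable_const (mY.pow_const 2).aemeasurable (p := 1 - p / 2) (q := p / 2)
      (by linarith) (by linarith) (by ring)
    have e : ∀ a : ℝ≥0∞, (a ^ 2) ^ (p / 2) = a ^ p := by
      intro a
      rw [← ENNReal.rpow_natCast, ← ENNReal.rpow_mul]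
      congr 1
      push_cast
      ring
    simp only [ENNReal.one_rpow, one_mul, lintegral_one, e] at h
    refine h.trans ?_
    rw [ENNReal.ofReal_mul (by positivity), ← ENNReal.ofReal_rpow_of_nonneg hv (by linarith),
      ← ENNReal.ofReal_rpow_of_nonneg hA (by linarith), ← e (ENNReal.ofReal A)]
    exact mul_le_mul' (ENNReal.rpow_le_rpow hμ (by linarith)) (ENNReal.rpow_le_rpow hY (by linarith))
  have iZ : ∫⁻ x, Z x ^ (2 - p) * (W x ^ 2) ^ (p - 1) ∂μ
      ≤ ENNReal.ofReal (B ^ (2 - p) * D ^ (2 * p - 2)) := by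
    refine (ENNReal.lintegral_mul_norm_pow_le (μ := μ) mZ.aemeasurable
      (mW.pow_const 2).aemeasurable (by linarith) (by linarith) (by ring)).trans ?_
    have e : ENNReal.ofReal D ^ (2 * p - 2) = (ENNReal.ofReal D ^ 2) ^ (p - 1) := by
      rw [← ENNReal.rpow_natCast, ← ENNReal.rpow_mul]
      congr 1
      push_cast
      ring
    rw [ENNReal.ofReal_mul (by positivity), ← ENNReal.ofReal_rpow_of_nonneg hB (by linarith),
      ← ENNReal.ofReal_rpow_of_nonneg hD (by linarith), e]
    exact mul_le_mul' (ENNReal.rpow_le_rpow hZ (by linarith)) (ENNReal.rpow_le_rpow hW (by linarith))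
  refine (lintegral_mono_ae point).trans ?_
  rw [lintegral_const_mul _ (by exact (mY.pow_const _).add ((mZ.pow_const _).mul
    ((mW.pow_const 2).pow_const _))), lintegral_add_left (mY.pow_const _),
    ENNReal.ofReal_mul (by norm_num), ENNReal.ofReal_add (by positivity) (by positivity)]
  simpa using mul_le_mul_right (add_le_add iY iZ) 2

/-- The part of the cylinder of radius `r` in the time layer `[t₀ - 2 τ, t₀ - τ]` whose translate by
`h` in position remains in the cylinder. -/
def layer (z₀ : Phase d) (r τ : ℝ) (h : E d) : Set (Phase d) :=
  {z | z ∈ cylinder r z₀ ∧ z + (0, h, 0) ∈ cylinder r z₀ ∧ z.1 ∈ Icc (z₀.1 - 2 * τ) (z₀.1 - τ)}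

theorem measurableSet_layer (z₀ : Phase d) (r τ : ℝ) (h : E d) :
    MeasurableSet (layer z₀ r τ h) := by
  have h1 := measurableSet_cylinder r z₀
  refine h1.inter (MeasurableSet.inter (s₁ := {z | z + (0, h, 0) ∈ cylinder r z₀}) ?_
    (measurable_fst measurableSet_Icc))
  exact (show Measurable fun z : Phase d => z + (0, h, 0) by fun_prop) h1

theorem rpow_le_pow_of_le {x L : ℝ} (hL : 1 ≤ L) (e : ℝ) (n : ℕ) (hx : 0 ≤ x) (hxL : x ≤ L)
    (he : 0 ≤ e) (hen : e ≤ n) : x ^ e ≤ L ^ n := by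
  refine (Real.rpow_le_rpow hx hxL he).trans ?_
  rw [← Real.rpow_natCast]
  exact Real.rpow_le_rpow_of_exponent_le hL hen

/-- Both terms carry the same power of `τ`: the first from the volume of the layer, the second from
`√τ ^ (2 - p)`. The powers of `u` are lowered to a common `γ`, as `u ≤ 1`. Constants enter through
integer powers of `L`, so nothing depends on `p`. -/
theorem interpolated_bound_le {V K₁ K₂ L N τ u p β γ : ℝ} (hV : 0 ≤ V) (hVL : V ≤ L) (hK₁ : 0 ≤ K₁)
    (hK₁L : K₁ ≤ L) (hK₂ : 0 ≤ K₂) (hK₂L : K₂ ≤ L) (hL : 2 ≤ L) (hN : 0 ≤ N) (hτ : 0 < τ)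
    (hu : 0 ≤ u) (hu1 : u ≤ 1) (hp : 1 < p) (hp2 : p < 3 / 2) (hγ : 0 ≤ γ) (hγ1 : γ ≤ β * p)
    (hγ2 : γ ≤ 2 * β * (2 - p)) :
    2 * ((V ^ 2 * τ) ^ (1 - p / 2) * (K₁ * N * u ^ β) ^ p
      + (K₂ * N * √τ * u ^ (2 * β)) ^ (2 - p) * (L * N) ^ (2 * p - 2))
      ≤ 4 * L ^ 3 * N ^ p * τ ^ (1 - p / 2) * u ^ γ := by
  have L0 : 0 ≤ L := by linarith
  have pw := fun {x : ℝ} => rpow_le_pow_of_le (x := x) (by linarith : 1 ≤ L)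
  have a1 : (V ^ 2 * τ) ^ (1 - p / 2) ≤ L * τ ^ (1 - p / 2) := by
    rw [Real.mul_rpow (by positivity) hτ.le, ← Real.rpow_natCast, ← Real.rpow_mul hV]
    refine mul_le_mul_of_nonneg_right ?_ (by positivity)
    simpa using pw ((2 : ℕ) * (1 - p / 2)) 1 hV hVL (by push_cast; linarith) (by push_cast; linarith)
  have a2 : (K₁ * N * u ^ β) ^ p ≤ L ^ 2 * N ^ p * u ^ γ := by
    rw [Real.mul_rpow (by positivity) (by positivity), Real.mul_rpow hK₁ hN, ← Real.rpow_mul hu]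
    have := pw p 2 hK₁ hK₁L (by linarith) (by push_cast; linarith)
    have := Real.rpow_le_rpow_of_exponent_ge' hu hu1 hγ hγ1
    gcongr
  have a3 : (K₂ * N * √τ * u ^ (2 * β)) ^ (2 - p)
      ≤ L * N ^ (2 - p) * τ ^ (1 - p / 2) * u ^ γ := by
    rw [Real.mul_rpow (by positivity) (by positivity), Real.mul_rpow (by positivity) (by positivity),
      Real.mul_rpow hK₂ hN, ← Real.rpow_mul hu, Real.sqrt_eq_rpow, ← Real.rpow_mul hτ.le]
    have h1 : K₂ ^ (2 - p) ≤ L := by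
      simpa using pw (2 - p) 1 hK₂ hK₂L (by linarith) (by push_cast; linarith)
    have h2 := Real.rpow_le_rpow_of_exponent_ge' hu hu1 hγ hγ2
    have h3 : 1 / 2 * (2 - p) = 1 - p / 2 := by ring
    rw [h3]
    gcongr
  have a4 : (L * N) ^ (2 * p - 2) ≤ L ^ 2 * N ^ (2 * p - 2) := by
    rw [Real.mul_rpow L0 hN]
    have := pw (2 * p - 2) 2 L0 le_rfl (by linarith) (by push_cast; linarith)
    gcongr
  have e : N ^ (2 - p) * N ^ (2 * p - 2) = N ^ p := by
    rw [← Real.rpow_add_of_nonneg hN (by linarith) (by linarith)]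
    congr 1; ring
  calc _ ≤ 2 * (L * τ ^ (1 - p / 2) * (L ^ 2 * N ^ p * u ^ γ)
        + L * N ^ (2 - p) * τ ^ (1 - p / 2) * u ^ γ * (L ^ 2 * N ^ (2 * p - 2))) := by
        gcongr
    _ = 2 * L ^ 3 * τ ^ (1 - p / 2) * u ^ γ * (N ^ p + N ^ (2 - p) * N ^ (2 * p - 2)) := by ring
    _ = _ := by rw [e]; ring

theorem crude_bound_le {V L N τ p : ℝ} (hV : 0 ≤ V) (hVL : V ≤ L) (hL : 2 ≤ L) (hN : 0 ≤ N)
    (hτ : 0 < τ) (hp : 1 < p) (hp2 : p < 3 / 2) :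
    2 * ((V ^ 2 * τ) ^ (1 - p / 2) * (L * N) ^ p + 0 ^ (2 - p) * (L * N) ^ (2 * p - 2))
      ≤ 4 * L ^ 3 * N ^ p * τ ^ (1 - p / 2) := by
  have L0 : 0 ≤ L := by linarith
  have pw := fun {x : ℝ} => rpow_le_pow_of_le (x := x) (by linarith : 1 ≤ L)
  have a1 : (V ^ 2 * τ) ^ (1 - p / 2) ≤ L * τ ^ (1 - p / 2) := by
    rw [Real.mul_rpow (by positivity) hτ.le, ← Real.rpow_natCast, ← Real.rpow_mul hV]
    refine mul_le_mul_of_nonneg_right ?_ (by positivity)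
    simpa using pw ((2 : ℕ) * (1 - p / 2)) 1 hV hVL (by push_cast; linarith) (by push_cast; linarith)
  have a2 : (L * N) ^ p ≤ L ^ 2 * N ^ p := by
    rw [Real.mul_rpow L0 hN]
    have := pw p 2 L0 le_rfl (by linarith) (by push_cast; linarith)
    gcongr
  rw [Real.zero_rpow (by linarith), zero_mul, add_zero]
  calc _ ≤ 2 * (L * τ ^ (1 - p / 2) * (L ^ 2 * N ^ p)) := by gcongr
    _ = 2 * (L ^ 3 * N ^ p * τ ^ (1 - p / 2)) := by ring
    _ ≤ 4 * (L ^ 3 * N ^ p * τ ^ (1 - p / 2)) := by gcongr; norm_num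
    _ = _ := by ring

variable (d) in
/-- The increments in position of a sub-solution in a dyadic time layer. -/
theorem exists_layer_bound {β : ℝ} (hβ : 0 ≤ β) (hβ1 : β < 1 / 3) : ∃ L : ℝ, 0 ≤ L ∧
    ∀ (z₀ : Phase d) (r R N : ℝ) (f b : Phase d → ℝ) (F G : Phase d → E d),
      IsSubsolutionOn (openCylinder R z₀) f b F G → IsControlled z₀ r R N f b F G →
      0 < r → r < R → R < 1 → ∀ (τ : ℝ) (h : E d) (p γ : ℝ), 0 < τ → τ ≤ 1 → 1 < p → p < 3 / 2 →
      0 ≤ γ → γ ≤ β * p → γ ≤ 2 * β * (2 - p) →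
      ∫⁻ z in layer z₀ r τ h, ‖f (z + (0, h, 0)) - f z‖ₑ ^ p
        ≤ ENNReal.ofReal (L * N ^ p * τ ^ (1 - p / 2) * min 1 ((‖h‖ / τ) ^ γ)) := by
  obtain ⟨ψ, θ, C, K⟩ := exists_isKernelPair (d := d)
  obtain ⟨C', hC', hcut⟩ := exists_cutoff d
  have hCn := K.nonneg_C
  have hβ2 : 0 < 1 - 3 * β := by linarith
  have hβ3 : 0 < 2 - 6 * β := by linarith
  set Θ := ∫ w, θ w with hΘ
  have hΘ0 : 0 ≤ Θ := integral_nonneg K.nonneg_θ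
  have hV0 := unitVol_nonneg d
  set V := unitVol d with hVd
  set k₁ := (4 * C + 3 * C * (2 * d + 1) * (1 - 3 * β)⁻¹) * Θ with hk₁
  set k₂ := C * (2 - 6 * β)⁻¹ * Θ * (V * (3 * C' + 1)) with hk₂
  have k₁0 : 0 ≤ k₁ := by positivity
  have k₂0 : 0 ≤ k₂ := by positivity
  set L := V + 2 * k₁ + 2 * k₂ + 2 with hL
  refine ⟨4 * L ^ 3, by positivity, ?_⟩
  intro z₀ r R N f b F G H hc hr hrR hR τ h p γ hτ hτ1 hp hp2 hγ hγ1 hγ2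
  have hN := hc.nonneg
  have hD : 0 < R - r := sub_pos.2 hrR
  have mf := H.measurable_f
  set T := layer z₀ r τ h with hTd
  have hTm := measurableSet_layer z₀ r τ h
  set η : Phase d := (0, h, 0) with hη
  have mη : Measurable fun z : Phase d => z + η := by fun_prop
  have mW : Measurable fun z => ‖f (z + η) - f z‖ₑ := ((mf.comp mη).sub mf).enorm
  -- The layer has thickness `τ` in time, whence the factor `τ ^ (1 - p / 2)` for its `L²` part.
  have hμ : (volume.restrict T) univ ≤ ENNReal.ofReal (V ^ 2 * τ) := by
    rw [Measure.restrict_apply_univ]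
    have := volume_cylinder_inter_le (by linarith : r ≤ 1) hr.le z₀ (p := z₀.1 - 2 * τ)
      (q := z₀.1 - τ) (by linarith)
    refine (measure_mono ?_).trans (this.trans (le_of_eq (by rw [hVd]; congr 1; ring)))
    rintro z ⟨hz1, -, hz2⟩
    exact ⟨hz1, hz2⟩
  have sqf : ∫⁻ z, ‖f z‖ₑ ^ 2 ≤ ENNReal.ofReal N ^ 2 := by
    refine hc.sq_f.trans (pow_le_pow_left' (ENNReal.ofReal_le_ofReal ?_) 2)
    exact mul_le_of_le_one_left hN (pow_le_one₀ hD.le (by linarith))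
  have shift : ∀ g : Phase d → ℝ≥0∞, ∫⁻ z, g (z + η) = ∫⁻ z, g z := fun g =>
    lintegral_add_right_eq_self g η
  have two : ∀ {g : Phase d → ℝ≥0∞} {A : ℝ}, Measurable g → 0 ≤ A →
      ∫⁻ z, g z ^ 2 ≤ ENNReal.ofReal A ^ 2 →
      ∫⁻ z in T, (g (z + η) + g z) ^ 2 ≤ ENNReal.ofReal (2 * A) ^ 2 := by
    intro g A mg hA hg
    refine (setLIntegral_le_lintegral _ _).trans ?_
    refine (lintegral_sq_add_le (mg.comp mη).aemeasurable mg.aemeasurable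
      ((shift fun z => g z ^ 2).trans_le hg) hg).trans (le_of_eq ?_)
    rw [← ENNReal.ofReal_add hA hA, two_mul]
  have sqW : ∫⁻ z in T, ‖f (z + η) - f z‖ₑ ^ 2 ≤ ENNReal.ofReal (L * N) ^ 2 := by
    refine (lintegral_mono fun z => pow_le_pow_left' enorm_sub_le 2).trans
      ((two mf.enorm hN sqf).trans (pow_le_pow_left' (ENNReal.ofReal_le_ofReal ?_) 2))
    gcongr
    linarith
  have LN : 0 ≤ L * N := by positivity
  set u := ‖h‖ / τ with hu
  have hu0 : 0 ≤ u := by positivity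
  -- For `‖h‖ > τ` no cancellation is needed: the trivial `L²` bound of the increment and the volume
  -- of the layer give the same power of `τ`.
  rcases le_or_gt u 1 with hu1 | hu1
  · rw [min_eq_right (Real.rpow_le_one hu0 hu1 hγ)]
    obtain ⟨χ, hχ, h0, h1, hone, hT, hg⟩ := hcut z₀ r R τ hr hrR hR hτ
    obtain ⟨Y, Z, mY, mZ, bY, bZ, hYZ⟩ := hc.exists_bound H hr hrR hR K hC' hτ hτ1 hβ hβ1 hχ h0 h1
      hT hg h
    have ins : ∀ z, z ∈ cylinder r z₀ → z.1 ≤ z₀.1 - τ → Inside χ τ ((R - r) / 4) z :=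
      fun z hz ht => inside_of_mem hr hrR hτ hτ1 hR hone hz (by linarith)
    have ae := ae_enorm_sub_le_of_moll (s := (R - r) / 4) (S := cylinder r z₀) (T := T) (η := η)
      (Y := fun z => (Y (z + η) + Y z) + (Z (z + η) + Z z)) hτ (by positivity) K.contDiff_ψ.continuous
      ((isCompact_closedBall (0 : Phase d) 1).of_isClosed_subset (isClosed_tsupport _) K.tsupport_ψ)
      K.nonneg_ψ K.integral_ψ H.integrable_f mf (measurableSet_cylinder r z₀)
      (volume_cylinder_ne_top hr.le (by linarith) z₀)
      (fun z hz => ⟨hz.1, hz.2.1⟩)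
      (fun ρ hρ z hz => hYZ ρ hρ z (ins z hz.1 hz.2.2.2)
        (ins _ hz.2.1 (by simpa [hη] using hz.2.2.2)))
    rw [← ae_restrict_iff' hTm] at ae
    have bZ' : ∫⁻ z in T, (Z (z + η) + Z z) ≤ ENNReal.ofReal (2 * k₂ * N * √τ * u ^ (2 * β)) := by
      refine (setLIntegral_le_lintegral _ _).trans ?_
      rw [lintegral_add_right _ mZ, shift Z]
      refine (add_le_add bZ bZ).trans (le_of_eq ?_)
      rw [← ENNReal.ofReal_add (by positivity) (by positivity)]
      congr 1
      ring
    have bY' := two mY (by positivity) bY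
    have e : 2 * (k₁ * N * u ^ β) = 2 * k₁ * N * u ^ β := by ring
    rw [e] at bY'
    refine (lintegral_rpow_le_of_le_add mW ((mY.comp mη).add mY) ((mZ.comp mη).add mZ) hp
      (by linarith) (by positivity) (by positivity) (by positivity) LN hμ ae bY' bZ' sqW).trans
      (ENNReal.ofReal_le_ofReal ?_)
    exact interpolated_bound_le hV0 (by linarith) (by positivity) (by linarith) (by positivity)
      (by linarith) (by linarith) hN hτ hu0 hu1 hp hp2 hγ hγ1 hγ2
  · rw [min_eq_left (Real.one_le_rpow hu1.le hγ), mul_one]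
    refine (lintegral_rpow_le_of_le_add (Z := fun _ => 0) (B := 0) mW mW measurable_const hp
      (by linarith) (by positivity) LN le_rfl LN hμ
      (Filter.Eventually.of_forall fun z => by simp) sqW (by simp) sqW).trans
      (ENNReal.ofReal_le_ofReal ?_)
    exact crude_bound_le hV0 (by linarith) (by linarith) hN hτ hp hp2

/-! ### The Gagliardo weight. -/

variable (d) in
-- In polar coordinates the integrand becomes `y ^ (κ - 1)` near `0` and `y ^ (-ε - 1)` at infinity.
theorem lintegral_ne_top_of_radial (hd : 1 ≤ d) {κ ε : ℝ} (hκ : 0 < κ) (hε : 0 < ε) :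
    ∫⁻ h : E d, ENNReal.ofReal (if ‖h‖ ≤ 1 then ‖h‖ ^ (κ - d) else ‖h‖ ^ (-ε - d)) ≠ ⊤ := by
  have hfr : Module.finrank ℝ (E d) = d := by simp
  have : Nontrivial (E d) := Module.nontrivial_of_finrank_pos (R := ℝ) (by rw [hfr]; exact hd)
  have hpow : ∀ (y s : ℝ), 0 < y → y ^ (d - 1) * y ^ (s - d) = y ^ (s - 1) := by
    intro y s hy
    rw [← Real.rpow_natCast, ← Real.rpow_add hy, Nat.cast_sub hd]
    congr 1
    push_cast
    ring
  have key : Integrable fun h : E d => (fun y : ℝ => if y ≤ 1 then y ^ (κ - d) else y ^ (-ε - d)) ‖h‖ := by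
    refine (integrable_fun_norm_addHaar volume
      (f := fun y : ℝ => if y ≤ 1 then y ^ (κ - d) else y ^ (-ε - d))).2 ?_
    rw [hfr, ← Ioc_union_Ioi_eq_Ioi zero_le_one]
    refine IntegrableOn.union ?_ ?_
    · have : IntegrableOn (fun y : ℝ => y ^ (κ - 1)) (Ioc 0 1) :=
        (intervalIntegrable_iff_integrableOn_Ioc_of_le zero_le_one).1
          (intervalIntegral.intervalIntegrable_rpow' (by linarith))
      refine this.congr_fun (fun y hy => ?_) measurableSet_Ioc
      simp only [smul_eq_mul, if_pos hy.2]
      rw [hpow y κ hy.1]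
    · have : IntegrableOn (fun y : ℝ => y ^ (-ε - 1)) (Ioi 1) :=
        integrableOn_Ioi_rpow_of_lt (by linarith) one_pos
      refine this.congr_fun (fun y hy => ?_) measurableSet_Ioi
      simp only [smul_eq_mul, if_neg (not_le.2 (mem_Ioi.1 hy))]
      rw [hpow y (-ε) (one_pos.trans hy)]
  exact (lintegral_ofReal_le_lintegral_enorm _).trans_lt key.2 |>.ne

variable (d) in
/-- The weight of the Gagliardo semi-norm, integrated against a truncated power. -/
theorem exists_lintegral_weight_le (hd : 1 ≤ d) {κ ε : ℝ} (hκ : 0 < κ) (hε : 0 < ε) :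
    ∃ c : ℝ, 0 ≤ c ∧ ∀ p τ : ℝ, 1 ≤ p → 0 < τ →
      ∫⁻ h : E d, ENNReal.ofReal ((‖h‖ ^ ((d : ℝ) + ε * p))⁻¹ * min 1 ((‖h‖ / τ) ^ (ε * p + κ)))
        ≤ ENNReal.ofReal (c * τ ^ (-(ε * p))) := by
  refine ⟨(∫⁻ h : E d, ENNReal.ofReal (if ‖h‖ ≤ 1 then ‖h‖ ^ (κ - d) else ‖h‖ ^ (-ε - d))).toReal,
    ENNReal.toReal_nonneg, fun p τ hp hτ => ?_⟩
  set e : ℝ := (d : ℝ) + ε * p with he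
  have hp0 : 0 < p := by linarith
  have he0 : 0 < e := by positivity
  have hγ : 0 < ε * p + κ := by positivity
  -- By scaling it suffices to treat `τ = 1`. There the integrand is dominated by a radial function
  -- independent of `p`: near `0` the exponent `ε p` cancels exactly, and at infinity `p ≥ 1` gives
  -- the decay `-ε - d`.
  set Φ : E d → ℝ≥0∞ := fun h => ENNReal.ofReal ((‖h‖ ^ e)⁻¹ * min 1 (‖h‖ ^ (ε * p + κ))) with hΦ
  have mΦ : Measurable Φ := by rw [hΦ]; fun_prop
  have bΦ : ∀ h, Φ h ≤ ENNReal.ofReal (if ‖h‖ ≤ 1 then ‖h‖ ^ (κ - d) else ‖h‖ ^ (-ε - d)) := by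
    intro h
    refine ENNReal.ofReal_le_ofReal ?_
    rcases (norm_nonneg h).eq_or_lt with h0 | h0
    · rw [← h0, Real.zero_rpow he0.ne', inv_zero, zero_mul, if_pos zero_le_one]
      positivity
    split_ifs with h1
    · refine (mul_le_mul_of_nonneg_left (min_le_right _ _) (by positivity)).trans (le_of_eq ?_)
      rw [← Real.rpow_neg h0.le, ← Real.rpow_add h0]
      congr 1
      rw [he]; ring
    · refine (mul_le_mul_of_nonneg_left (min_le_left _ _) (by positivity)).trans ?_
      rw [mul_one, ← Real.rpow_neg h0.le]
      refine Real.rpow_le_rpow_of_exponent_le (not_le.1 h1).le ?_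
      rw [he]
      nlinarith
  have scale : ∀ h : E d, ENNReal.ofReal ((‖h‖ ^ e)⁻¹ * min 1 ((‖h‖ / τ) ^ (ε * p + κ)))
      = ENNReal.ofReal (τ ^ (-e)) * Φ (τ⁻¹ • h) := by
    intro h
    rw [hΦ, ← ENNReal.ofReal_mul (by positivity), norm_smul, Real.norm_of_nonneg (by positivity),
      inv_mul_eq_div τ]
    congr 1
    rw [Real.div_rpow (y := τ) (z := e) (norm_nonneg _) hτ.le, Real.rpow_neg hτ.le, inv_div]
    have : 0 < τ ^ e := by positivity
    field_simp
  have hτ' : τ⁻¹ ≠ 0 := (inv_pos.2 hτ).ne'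
  have cov : ∫⁻ h : E d, Φ (τ⁻¹ • h) = ENNReal.ofReal (τ ^ (d : ℝ)) * ∫⁻ h, Φ h := by
    rw [← lintegral_map mΦ (measurable_const_smul τ⁻¹), Measure.map_addHaar_smul _ hτ',
      lintegral_smul_measure, smul_eq_mul]
    congr 2
    rw [abs_of_pos (by positivity)]
    simp
  simp only [scale]
  have mΦ' : Measurable fun h : E d => Φ (τ⁻¹ • h) := mΦ.comp (measurable_const_smul τ⁻¹)
  rw [lintegral_const_mul _ mΦ', cov, mul_comm _ (τ ^ (-(ε * p))),
    ENNReal.ofReal_mul (by positivity), ENNReal.ofReal_toReal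
      (lintegral_ne_top_of_radial d hd hκ hε), ← mul_assoc, ← ENNReal.ofReal_mul (by positivity),
      ← Real.rpow_add hτ]
  have e1 : -e + d = -(ε * p) := by rw [he]; ring
  rw [e1]
  exact mul_le_mul_right (lintegral_mono bΦ) _

/-! ### From the semi-norm to integrals of increments. -/

/-- The points of a cylinder whose translate by `h` in position remains in the cylinder. -/
def overlap (z₀ : Phase d) (r : ℝ) (h : E d) : Set (Phase d) :=
  {z | z ∈ cylinder r z₀ ∧ z + (0, h, 0) ∈ cylinder r z₀}

theorem measurableSet_overlap (z₀ : Phase d) (r : ℝ) :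
    MeasurableSet {q : E d × Phase d | q.2 ∈ overlap z₀ r q.1} := by
  have h1 := measurableSet_cylinder r z₀
  have a1 : MeasurableSet {q : E d × Phase d | q.2 ∈ cylinder r z₀} := measurable_snd h1
  have a2 : MeasurableSet {q : E d × Phase d | q.2 + (0, q.1, 0) ∈ cylinder r z₀} :=
    (show Measurable fun q : E d × Phase d => q.2 + (0, q.1, 0) by fun_prop) h1
  exact a1.inter a2

theorem lintegral_prod_rotate {X Y V : Type*} [MeasurableSpace X] [MeasurableSpace Y]
    [MeasurableSpace V] (μ : Measure X) (ν : Measure Y) (ρ : Measure V) [SFinite μ] [SFinite ν]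
    [SFinite ρ] {J : X × Y × V → ℝ≥0∞} (mJ : Measurable J) :
    ∫⁻ q, ∫⁻ y, J (q.1, y, q.2) ∂ν ∂(μ.prod ρ) = ∫⁻ z, J z ∂(μ.prod (ν.prod ρ)) := by
  have m1 : Measurable fun p : (X × V) × Y => J (p.1.1, p.2, p.1.2) := mJ.comp (by fun_prop)
  rw [lintegral_prod _ m1.lintegral_prod_right'.aemeasurable, lintegral_prod _ mJ.aemeasurable]
  congr 1 with t
  have m2 : Measurable fun s : Y × V => J (t, s) := mJ.comp (by fun_prop)
  rw [lintegral_prod_symm _ m2.aemeasurable]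

theorem measurable_uncurry_swap {X Y : Type*} [MeasurableSpace X] [MeasurableSpace Y]
    {H : X → Y → ℝ≥0∞} (mH : Measurable (Function.uncurry H)) :
    Measurable (Function.uncurry fun y x => H x y) :=
  mH.comp measurable_swap

theorem lintegral_prod_sub {X Y : Type*} [MeasurableSpace X] [MeasurableSpace Y] [AddGroup X]
    [MeasurableAdd X] [MeasurableSub₂ X] (μ : Measure X) [SFinite μ] [μ.IsAddRightInvariant]
    {H : X → Y → ℝ≥0∞} (mH : Measurable (Function.uncurry H)) {g : X → Y} (mg : Measurable g) :
    ∫⁻ s, H (s.1 - s.2) (g s.2) ∂(μ.prod μ) = ∫⁻ y, ∫⁻ h, H h (g y) ∂μ ∂μ := by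
  have hm : Measurable fun s : X × X => H (s.1 - s.2) (g s.2) :=
    mH.comp ((measurable_fst.sub measurable_snd).prodMk (mg.comp measurable_snd))
  rw [lintegral_prod_symm _ hm.aemeasurable]
  congr 1 with y
  exact lintegral_sub_right_eq_self (fun h => H h (g y)) y

/-- Tonelli's theorem for the Gagliardo semi-norm in position: increments first. -/
theorem lintegral_slices_le {f : Phase d → ℝ} (mf : Measurable f) {e p r : ℝ} (hp : 0 ≤ p)
    (z₀ : Phase d) :
    (∫⁻ q in Ioc (z₀.1 - r ^ 2) z₀.1 ×ˢ Metric.ball z₀.2.2 r,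
      ∫⁻ s in Metric.ball (z₀.2.1 + (q.1 - z₀.1) • z₀.2.2) (r ^ 3) ×ˢ
          Metric.ball (z₀.2.1 + (q.1 - z₀.1) • z₀.2.2) (r ^ 3),
        ENNReal.ofReal (|f (q.1, s.1, q.2) - f (q.1, s.2, q.2)| ^ p / ‖s.1 - s.2‖ ^ e))
      ≤ ∫⁻ h : E d, ENNReal.ofReal (‖h‖ ^ e)⁻¹ *
          ∫⁻ z in overlap z₀ r h, ‖f (z + (0, h, 0)) - f z‖ₑ ^ p := by
  have hS := measurableSet_overlap z₀ r
  set S : Set (E d × Phase d) := {q | q.2 ∈ overlap z₀ r q.1} with hSd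
  set W : E d × Phase d → ℝ≥0∞ := fun q => ‖f (q.2 + (0, q.1, 0)) - f q.2‖ₑ ^ p with hW
  have mW : Measurable W := by
    have h1 : Measurable fun q : E d × Phase d => f (q.2 + (0, q.1, 0)) :=
      mf.comp (by fun_prop)
    have h2 : Measurable fun q : E d × Phase d => f q.2 := mf.comp measurable_snd
    exact (h1.sub h2).enorm.pow_const p
  set H : E d → Phase d → ℝ≥0∞ := fun h z => ENNReal.ofReal (‖h‖ ^ e)⁻¹ * S.indicator W (h, z) with hH
  have mH : Measurable (Function.uncurry H) := by
    have h1 : Measurable fun q : E d × Phase d => ENNReal.ofReal (‖q.1‖ ^ e)⁻¹ := by fun_prop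
    exact h1.mul (mW.indicator hS)
  have point : ∀ q ∈ Ioc (z₀.1 - r ^ 2) z₀.1 ×ˢ Metric.ball z₀.2.2 r,
      ∀ s ∈ Metric.ball (z₀.2.1 + (q.1 - z₀.1) • z₀.2.2) (r ^ 3) ×ˢ
          Metric.ball (z₀.2.1 + (q.1 - z₀.1) • z₀.2.2) (r ^ 3),
        ENNReal.ofReal (|f (q.1, s.1, q.2) - f (q.1, s.2, q.2)| ^ p / ‖s.1 - s.2‖ ^ e)
          ≤ H (s.1 - s.2) (q.1, s.2, q.2) := by
    rintro ⟨t, v⟩ ⟨ht, hv⟩ ⟨x, y⟩ ⟨hx, hy⟩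
    have hm : ∀ x ∈ Metric.ball (z₀.2.1 + (t - z₀.1) • z₀.2.2) (r ^ 3), (t, x, v) ∈ cylinder r z₀ := by
      intro x hx
      refine ⟨by linarith [ht.1], by linarith [ht.2], ?_, by simpa [dist_eq_norm] using hv⟩
      simpa [dist_eq_norm, sub_sub] using hx
    have e1 : ((t, y, v) : Phase d) + (0, x - y, 0) = (t, x, v) := by simp
    -- Two points of one slice differ by a pure position translation, and both lie in the cylinder,
    -- so the pair becomes a point of the overlap together with its increment.
    have hin : (x - y, (t, y, v)) ∈ S := ⟨hm y hy, by simpa only [e1] using hm x hx⟩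
    simp only [hH]
    rw [indicator_of_mem hin, hW]
    simp only [e1]
    rw [div_eq_mul_inv, mul_comm, ENNReal.ofReal_mul (by positivity), Real.enorm_eq_ofReal_abs,
      ENNReal.ofReal_rpow_of_nonneg (abs_nonneg _) hp]
  have left : (∫⁻ q in Ioc (z₀.1 - r ^ 2) z₀.1 ×ˢ Metric.ball z₀.2.2 r,
      ∫⁻ s in Metric.ball (z₀.2.1 + (q.1 - z₀.1) • z₀.2.2) (r ^ 3) ×ˢ
          Metric.ball (z₀.2.1 + (q.1 - z₀.1) • z₀.2.2) (r ^ 3),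
        ENNReal.ofReal (|f (q.1, s.1, q.2) - f (q.1, s.2, q.2)| ^ p / ‖s.1 - s.2‖ ^ e))
      ≤ ∫⁻ q : ℝ × E d, ∫⁻ s : E d × E d, H (s.1 - s.2) (q.1, s.2, q.2) := by
    refine (setLIntegral_mono' (measurableSet_Ioc.prod measurableSet_ball) fun q hq => ?_).trans
      (setLIntegral_le_lintegral _ _)
    exact (setLIntegral_mono' (measurableSet_ball.prod measurableSet_ball) fun s hs =>
      point q hq s hs).trans (setLIntegral_le_lintegral _ _)
  refine left.trans (le_of_eq ?_)
  have inner : ∀ q : ℝ × E d, ∫⁻ s : E d × E d, H (s.1 - s.2) (q.1, s.2, q.2)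
      = ∫⁻ y, ∫⁻ h, H h (q.1, y, q.2) := by
    intro q
    exact lintegral_prod_sub volume mH (g := fun y => (q.1, y, q.2)) (by fun_prop)
  simp only [inner]
  have mJ : Measurable fun z => ∫⁻ h, H h z := mH.lintegral_prod_left'
  rw [show (∫⁻ q : ℝ × E d, ∫⁻ y, ∫⁻ h, H h (q.1, y, q.2)) = ∫⁻ z, ∫⁻ h, H h z from
    lintegral_prod_rotate volume volume volume mJ,
    lintegral_lintegral_swap (measurable_uncurry_swap mH).aemeasurable]
  congr 1 with h
  have ho : MeasurableSet (overlap z₀ r h) := (measurable_prodMk_left (x := h)) hS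
  have mWh : Measurable fun z => W (h, z) := measurable_slice mW h
  have e2 : ∀ z, S.indicator W (h, z) = (overlap z₀ r h).indicator (fun z => W (h, z)) z := fun z => rfl
  simp only [hH, e2]
  rw [lintegral_const_mul _ (mWh.indicator ho), lintegral_indicator ho]

/-! ### Summation over dyadic time layers. -/

/-- The distance to the final time lies in `(0, 1)` off a null set, hence between consecutive powers
of `1/2`. The exponent `j + 1` makes `2 τ = (1/2) ^ j`. -/
theorem overlap_subset_iUnion_layer {z₀ : Phase d} {r : ℝ} (hr : 0 < r) (hr1 : r < 1) (h : E d) :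
    overlap z₀ r h ⊆ {z | z.1 = z₀.1} ∪ ⋃ j : ℕ, layer z₀ r ((1 / 2) ^ (j + 1)) h := by
  rintro z ⟨h1, h2⟩
  rcases h1.2.1.eq_or_lt with h0 | h0
  · exact Or.inl (by simpa [sub_eq_zero] using h0)
  · right
    have hr2 : r ^ 2 ≤ 1 := pow_le_one₀ hr.le hr1.le
    obtain ⟨n, hn1, hn2⟩ := exists_nat_pow_near_of_lt_one (x := z₀.1 - z.1) (y := (1 / 2 : ℝ))
      (by linarith) (by linarith [h1.1]) (by norm_num) (by norm_num)
    refine mem_iUnion.2 ⟨n, h1, h2, ?_, by linarith⟩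
    rw [pow_succ]
    linarith

theorem volume_fst_eq (c : ℝ) : volume {z : Phase d | z.1 = c} = 0 := by
  have : {z : Phase d | z.1 = c} = ({c} : Set ℝ) ×ˢ (univ : Set (E d × E d)) := by
    ext z; simp
  rw [this]
  refine (Measure.prod_prod (μ := (volume : Measure ℝ)) (ν := (volume : Measure (E d × E d)))
    {c} univ).trans ?_
  simp

/-- Comparison with the geometric series of ratio `(1/2) ^ a₀`. The lower bound `a₀` makes the sum
uniform over the exponents `a`, and so over `p`. -/
theorem tsum_ofReal_pow_half_le {a₀ a : ℝ} (h0 : 0 < a₀) (ha : a₀ ≤ a) :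
    ∑' j : ℕ, ENNReal.ofReal (((1 / 2 : ℝ) ^ (j + 1)) ^ a)
      ≤ ENNReal.ofReal (1 - (1 / 2 : ℝ) ^ a₀)⁻¹ := by
  set x := (1 / 2 : ℝ) ^ a₀ with hx
  have x0 : 0 ≤ x := by positivity
  have x1 : x < 1 := Real.rpow_lt_one (by norm_num) (by norm_num) h0
  have hs := summable_geometric_of_lt_one x0 x1
  rw [← tsum_geometric_of_lt_one x0 x1, ENNReal.ofReal_tsum_of_nonneg (fun n => by positivity) hs]
  refine ENNReal.tsum_le_tsum fun j => ENNReal.ofReal_le_ofReal ?_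
  have b0 : (0 : ℝ) < (1 / 2) ^ (j + 1) := by positivity
  have b1 : (1 / 2 : ℝ) ^ (j + 1) ≤ 1 := pow_le_one₀ (by norm_num) (by norm_num)
  refine (Real.rpow_le_rpow_of_exponent_ge b0 b1 ha).trans ?_
  rw [← Real.rpow_natCast, ← Real.rpow_mul (by norm_num), mul_comm, Real.rpow_mul (by norm_num),
    Real.rpow_natCast]
  exact pow_le_pow_of_le_one x0 x1.le (Nat.le_succ j)

variable (d) in
/-- Interior regularity in position for controlled sub-solutions. -/
theorem exists_seminormX_le (hd : 1 ≤ d) {ε : ℝ} (hε : 0 < ε) (hε' : ε < 1 / 3) : ∃ M : ℝ, 0 ≤ M ∧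
    ∀ (z₀ : Phase d) (r R N : ℝ) (f b : Phase d → ℝ) (F G : Phase d → E d),
      IsSubsolutionOn (openCylinder R z₀) f b F G → IsControlled z₀ r R N f b F G →
      0 < r → r < R → R < 1 → ∀ p : ℝ, 1 < p → p < 6 / (4 + 3 * ε) →
      seminormX ε p r z₀ f ≤ ENNReal.ofReal (M * N) := by
  -- `β` is the midpoint of `ε` and `1/3`. `κ₂` and `a₀` are the values at the endpoint `p = 6 / (4
  -- + 3 ε)` of the margins `2 β (2 - p) - ε p` and `1 - p / 2 - ε p`, which decrease in `p`; `κ`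
  -- also respects the margin `(β - ε) p`, smallest at `p = 1`.
  set β := (3 * ε + 1) / 6 with hβ
  set κ₂ := (6 * ε ^ 2 - 2 * ε + 2 / 3) / (4 + 3 * ε) with hκ₂
  set κ := min (β - ε) κ₂ with hκ
  set a₀ := (1 - 3 * ε) / (4 + 3 * ε) with ha₀
  have a₀0 : 0 < a₀ := div_pos (by linarith) (by linarith)
  -- The numerator is `6 (ε - 1/6)² + 1/2`.
  have κ₂0 : 0 < κ₂ := div_pos (by nlinarith [sq_nonneg (ε - 1 / 6)]) (by linarith)
  have κ0 : 0 < κ := lt_min (by rw [hβ]; linarith) κ₂0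
  obtain ⟨L, hL0, hL⟩ := exists_layer_bound d (β := β) (by positivity) (by rw [hβ]; linarith)
  obtain ⟨c, hc0, hc⟩ := exists_lintegral_weight_le d hd κ0 hε
  set s := (1 - (1 / 2 : ℝ) ^ a₀)⁻¹ with hs
  have s0 : 0 ≤ s := inv_nonneg.2 (sub_nonneg.2 (Real.rpow_le_one (by norm_num) (by norm_num) a₀0.le))
  -- Adding `1` bounds the power `1 / p` of the constant by the constant itself, uniformly in `p`.
  refine ⟨L * c * s + 1, by positivity, ?_⟩
  intro z₀ r R N f b F G H hctrl hr hrR hR p hp hp2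
  have hN := hctrl.nonneg
  have h4 : 0 < 4 + 3 * ε := by linarith
  have hp3 : p < 3 / 2 := hp2.trans (by rw [div_lt_div_iff₀ h4 (by norm_num)]; linarith)
  have hp0 : 0 < p := by linarith
  have hγ0 : 0 ≤ ε * p + κ := by positivity
  have hp2' : p * (4 + 3 * ε) < 6 := (lt_div_iff₀ h4).1 hp2
  have hγ1 : ε * p + κ ≤ β * p := by
    have : κ ≤ (β - ε) * p := (min_le_left _ _).trans
      (le_mul_of_one_le_right (by rw [hβ]; linarith) hp.le)
    linarith
  have hγ2 : ε * p + κ ≤ 2 * β * (2 - p) := by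
    have h1 : κ₂ * (4 + 3 * ε) = 6 * ε ^ 2 - 2 * ε + 2 / 3 := div_mul_cancel₀ _ h4.ne'
    have h2 : κ ≤ κ₂ := min_le_right _ _
    have h3 : κ₂ ≤ 4 * β - p * (2 * β + ε) := by
      refine le_of_mul_le_mul_right ?_ h4
      rw [h1, hβ]
      nlinarith
    linarith
  have ha : a₀ ≤ 1 - p / 2 - ε * p := by
    rw [ha₀, div_le_iff₀ h4]
    nlinarith
  have layerb : ∀ (j : ℕ) (h : E d), ∫⁻ z in layer z₀ r ((1 / 2) ^ (j + 1)) h,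
      ‖f (z + (0, h, 0)) - f z‖ₑ ^ p
      ≤ ENNReal.ofReal (L * N ^ p * ((1 / 2) ^ (j + 1)) ^ (1 - p / 2)
        * min 1 ((‖h‖ / (1 / 2) ^ (j + 1)) ^ (ε * p + κ))) := fun j h =>
    hL z₀ r R N f b F G H hctrl hr hrR hR _ h p _ (by positivity)
      (pow_le_one₀ (by norm_num) (by norm_num)) hp hp3 hγ0 hγ1 hγ2
  have ovl : ∀ h : E d, ∫⁻ z in overlap z₀ r h, ‖f (z + (0, h, 0)) - f z‖ₑ ^ p
      ≤ ∑' j : ℕ, ENNReal.ofReal (L * N ^ p * ((1 / 2) ^ (j + 1)) ^ (1 - p / 2)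
        * min 1 ((‖h‖ / (1 / 2) ^ (j + 1)) ^ (ε * p + κ))) := by
    intro h
    refine (lintegral_mono_set (overlap_subset_iUnion_layer hr (hrR.trans hR) h)).trans ?_
    refine (lintegral_union_le _ _ _).trans ?_
    rw [setLIntegral_measure_zero _ _ (volume_fst_eq _), zero_add]
    exact (lintegral_iUnion_le _ _).trans (ENNReal.tsum_le_tsum fun j => layerb j h)
  have total : (∫⁻ h : E d, ENNReal.ofReal (‖h‖ ^ ((d : ℝ) + ε * p))⁻¹ *
          ∫⁻ z in overlap z₀ r h, ‖f (z + (0, h, 0)) - f z‖ₑ ^ p)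
      ≤ ENNReal.ofReal (L * c * s * N ^ p) := by
    have step : ∀ (h : E d), ENNReal.ofReal (‖h‖ ^ ((d : ℝ) + ε * p))⁻¹ *
          ∫⁻ z in overlap z₀ r h, ‖f (z + (0, h, 0)) - f z‖ₑ ^ p
        ≤ ∑' j : ℕ, ENNReal.ofReal (L * N ^ p * ((1 / 2) ^ (j + 1)) ^ (1 - p / 2))
          * ENNReal.ofReal ((‖h‖ ^ ((d : ℝ) + ε * p))⁻¹
            * min 1 ((‖h‖ / (1 / 2) ^ (j + 1)) ^ (ε * p + κ))) := by
      intro h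
      refine (mul_le_mul_right (ovl h) _).trans (le_of_eq ?_)
      rw [← ENNReal.tsum_mul_left]
      congr 1 with j
      rw [← ENNReal.ofReal_mul (by positivity), ← ENNReal.ofReal_mul (by positivity)]
      congr 1
      ring
    refine (lintegral_mono step).trans ?_
    rw [lintegral_tsum fun j => by fun_prop]
    have each : ∀ j : ℕ, ∫⁻ h : E d,
        ENNReal.ofReal (L * N ^ p * ((1 / 2) ^ (j + 1)) ^ (1 - p / 2))
          * ENNReal.ofReal ((‖h‖ ^ ((d : ℝ) + ε * p))⁻¹
            * min 1 ((‖h‖ / (1 / 2) ^ (j + 1)) ^ (ε * p + κ)))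
        ≤ ENNReal.ofReal (L * c * N ^ p)
          * ENNReal.ofReal (((1 / 2 : ℝ) ^ (j + 1)) ^ (1 - p / 2 - ε * p)) := by
      intro j
      have b0 : (0 : ℝ) < (1 / 2) ^ (j + 1) := by positivity
      rw [lintegral_const_mul _ (by fun_prop)]
      refine (mul_le_mul_right (hc p _ hp.le b0) _).trans (le_of_eq ?_)
      rw [← ENNReal.ofReal_mul (by positivity), ← ENNReal.ofReal_mul (by positivity),
        sub_eq_add_neg (1 - p / 2), Real.rpow_add b0]
      congr 1
      ring
    refine (ENNReal.tsum_le_tsum each).trans ?_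
    rw [ENNReal.tsum_mul_left]
    refine (mul_le_mul_right (tsum_ofReal_pow_half_le a₀0 ha) _).trans (le_of_eq ?_)
    rw [← ENNReal.ofReal_mul (by positivity)]
    congr 1
    ring
  unfold seminormX
  refine (ENNReal.rpow_le_rpow ((lintegral_slices_le H.measurable_f hp0.le z₀).trans total)
    (by positivity)).trans ?_
  rw [ENNReal.ofReal_rpow_of_nonneg (by positivity) (by positivity)]
  refine ENNReal.ofReal_le_ofReal ?_
  rw [Real.mul_rpow (by positivity) (by positivity), ← Real.rpow_mul hN, mul_one_div_cancel hp0.ne',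
    Real.rpow_one]
  refine mul_le_mul_of_nonneg_right ?_ hN
  have hK : 0 ≤ L * c * s := by positivity
  calc (L * c * s) ^ (1 / p) ≤ (L * c * s + 1) ^ (1 / p) :=
        Real.rpow_le_rpow hK (by linarith) (by positivity)
    _ ≤ (L * c * s + 1) ^ (1 : ℝ) :=
        Real.rpow_le_rpow_of_exponent_le (by linarith) (by rw [div_le_one hp0]; exact hp.le)
    _ = _ := Real.rpow_one _

/-! ### Reduction to data on the whole space. -/

/-- A measurable representative, cut off by the indicator of `Q`, does this. It is integrable
because `Q` has finite measure. Extending by zero may destroy the equation across the boundary of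
`Q`, but only test functions supported inside are used. -/
theorem exists_extension {X V : Type*} [MeasurableSpace X] {μ : Measure X} [NormedAddCommGroup V]
    [MeasurableSpace V] [BorelSpace V] {Q : Set X} (hQ : MeasurableSet Q) (hfin : μ Q ≠ ⊤)
    {g : X → V} (hg : MemLp g 2 (μ.restrict Q)) :
    ∃ g' : X → V, Measurable g' ∧ Integrable g' μ ∧ (∀ z, z ∉ Q → g' z = 0) ∧
      (∀ᵐ z ∂μ.restrict Q, g z = g' z) ∧
      ∫⁻ z, ‖g' z‖ₑ ^ 2 ∂μ = eLpNorm g 2 (μ.restrict Q) ^ 2 := by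
  have : IsFiniteMeasure (μ.restrict Q) := ⟨by simpa using hfin.lt_top⟩
  set m := hg.1.mk g with hm
  have hgm : g =ᵐ[μ.restrict Q] m := hg.1.ae_eq_mk
  refine ⟨Q.indicator m, hg.1.stronglyMeasurable_mk.measurable.indicator hQ, ?_,
    fun z hz => indicator_of_notMem hz _, ?_, ?_⟩
  · rw [integrable_indicator_iff hQ]
    exact (hg.integrable one_le_two).congr hgm
  · filter_upwards [hgm, ae_restrict_mem hQ] with z h1 h2
    rw [h1, indicator_of_mem h2]
  · rw [eLpNorm_congr_ae hgm, ← eLpNorm_indicator_eq_eLpNorm_restrict hQ,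
      eLpNorm_eq_lintegral_rpow_enorm_toReal two_ne_zero ENNReal.ofNat_ne_top,
      ← ENNReal.rpow_natCast, ← ENNReal.rpow_mul]
    simp

theorem setIntegral_eq_integral_of_ae_eq {X V : Type*} [MeasurableSpace X] {μ : Measure X}
    [NormedAddCommGroup V] [NormedSpace ℝ V] {Q Ω : Set X} (hQ : MeasurableSet Q) (hQΩ : Q ⊆ Ω)
    {g g' : X → V} (h0 : ∀ z, z ∉ Q → g z = 0) (h0' : ∀ z, z ∉ Q → g' z = 0)
    (h : ∀ᵐ z ∂μ.restrict Q, g z = g' z) : ∫ z in Ω, g z ∂μ = ∫ z, g' z ∂μ := by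
  have e : Q.indicator g = g := indicator_eq_self.2 fun z hz => by
    by_contra hn
    exact hz (h0 z hn)
  rw [← e, setIntegral_indicator hQ, inter_eq_right.2 hQΩ,
    ← setIntegral_eq_integral_of_forall_compl_eq_zero h0']
  exact integral_congr_ae h

theorem inner_act_comm {A : Matrix (Fin d) (Fin d) ℝ} (hA : A.IsSymm) (u w : E d) :
    inner ℝ (act A u) w = inner ℝ u (act A w) := by
  rw [inner_eq_sum, inner_eq_sum]
  simp only [act, Matrix.mulVec, dotProduct, Finset.sum_mul, Finset.mul_sum]
  rw [Finset.sum_comm]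
  refine Finset.sum_congr rfl fun i _ => Finset.sum_congr rfl fun j _ => ?_
  rw [hA.apply i j]
  ring

theorem act_sub_smul (A : Matrix (Fin d) (Fin d) ℝ) (u w : E d) (s : ℝ) :
    act A (u - s • w) = act A u - s • act A w := by
  unfold act
  rw [WithLp.ofLp_sub, WithLp.ofLp_smul, Matrix.mulVec_sub, Matrix.mulVec_smul, WithLp.toLp_sub,
    WithLp.toLp_smul]

/-- A symmetric matrix between `0` and `Λ` has operator norm at most `Λ`. -/
theorem norm_act_le {A : Matrix (Fin d) (Fin d) ℝ} (hA : A.IsSymm) {Lam : ℝ} (hLam : 0 < Lam)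
    (h0 : ∀ ξ : E d, 0 ≤ inner ℝ (act A ξ) ξ)
    (h1 : ∀ ξ : E d, inner ℝ (act A ξ) ξ ≤ Lam * ‖ξ‖ ^ 2) (ξ : E d) : ‖act A ξ‖ ≤ Lam * ‖ξ‖ := by
  set η := act A ξ with hη
  -- Positivity of the form at `ξ - Λ⁻¹ A ξ`, expanded by symmetry and bounded above at `ξ` and at
  -- `A ξ`, gives `‖A ξ‖² ≤ Λ² ‖ξ‖²` without diagonalization.
  have h2 := h0 (ξ - Lam⁻¹ • η)
  have h3 : inner ℝ (act A η) ξ = ‖η‖ ^ 2 := by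
    rw [inner_act_comm hA, ← hη, real_inner_self_eq_norm_sq]
  rw [act_sub_smul, ← hη, inner_sub_left, inner_sub_right, inner_sub_right, real_inner_smul_left,
    real_inner_smul_left, real_inner_smul_right, real_inner_smul_right, h3,
    real_inner_self_eq_norm_sq] at h2
  have h4 := h1 η
  have h5 := h1 ξ
  rw [← hη] at h5
  have h6 : Lam⁻¹ * (Lam⁻¹ * inner ℝ (act A η) η) ≤ Lam⁻¹ * ‖η‖ ^ 2 := by
    have : Lam⁻¹ * (Lam⁻¹ * inner ℝ (act A η) η) ≤ Lam⁻¹ * (Lam⁻¹ * (Lam * ‖η‖ ^ 2)) := by gcongr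
    rwa [inv_mul_cancel_left₀ hLam.ne'] at this
  have h7 : Lam⁻¹ * ‖η‖ ^ 2 ≤ Lam * ‖ξ‖ ^ 2 := by linarith
  have h8 : ‖η‖ ^ 2 ≤ (Lam * ‖ξ‖) ^ 2 := by
    have := mul_le_mul_of_nonneg_left h7 hLam.le
    rw [mul_inv_cancel_left₀ hLam.ne'] at this
    linarith [this, mul_pow Lam ‖ξ‖ 2]
  exact (sq_le_sq₀ (norm_nonneg _) (by positivity)).1 h8

theorem continuous_act : Continuous fun p : Matrix (Fin d) (Fin d) ℝ × E d => act p.1 p.2 := by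
  unfold act; fun_prop

theorem cylinder_subset {r R : ℝ} (hr : 0 < r) (hrR : r ≤ R) (z₀ : Phase d) :
    cylinder r z₀ ⊆ cylinder R z₀ := by
  rintro z ⟨h1, h2, h3, h4⟩
  have : r ^ 2 ≤ R ^ 2 := pow_le_pow_left₀ hr.le hrR 2
  exact ⟨by linarith, h2, h3.trans_le (pow_le_pow_left₀ hr.le hrR 3), h4.trans_le hrR⟩

/-- The semi-norm does not see modifications on null sets of the cylinder. -/
theorem seminormX_congr {ε p r : ℝ} {z₀ : Phase d} {f f' : Phase d → ℝ}
    (h : ∀ᵐ z ∂volume.restrict (cylinder r z₀), f z = f' z) :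
    seminormX ε p r z₀ f = seminormX ε p r z₀ f' := by
  rw [ae_restrict_iff' (measurableSet_cylinder r z₀)] at h
  -- A measurable null superset of the exceptional set has, by Tonelli, null position slices for
  -- almost every time and velocity. On such a slice both points of almost every pair avoid it.
  obtain ⟨Z, hZ, hZm, hZ0⟩ := exists_measurable_superset_of_null (ae_iff.1 h)
  have mJ : Measurable (Z.indicator fun _ => (1 : ℝ≥0∞)) := measurable_const.indicator hZm
  have e := lintegral_prod_rotate (volume : Measure ℝ) (volume : Measure (E d))
    (volume : Measure (E d)) mJ
  have m1 : Measurable fun q : ℝ × E d => ∫⁻ y, Z.indicator (fun _ => (1 : ℝ≥0∞)) (q.1, y, q.2) := by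
    have : Measurable fun p : (ℝ × E d) × E d =>
        Z.indicator (fun _ => (1 : ℝ≥0∞)) (p.1.1, p.2, p.1.2) := mJ.comp (by fun_prop)
    exact this.lintegral_prod_right'
  have e0 : ∫⁻ z, Z.indicator (fun _ => (1 : ℝ≥0∞)) z ∂((volume : Measure ℝ).prod
      ((volume : Measure (E d)).prod (volume : Measure (E d)))) = 0 := by
    rw [lintegral_indicator_const hZm, one_mul]
    exact hZ0
  rw [e0, lintegral_eq_zero_iff m1] at e
  have key : ∀ᵐ q : ℝ × E d, ∀ᵐ y : E d, (q.1, y, q.2) ∈ cylinder r z₀ →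
      f (q.1, y, q.2) = f' (q.1, y, q.2) := by
    refine Filter.Eventually.mono e fun q hq => ?_
    have m2 : Measurable fun y : E d => Z.indicator (fun _ => (1 : ℝ≥0∞)) (q.1, y, q.2) :=
      mJ.comp (by fun_prop)
    refine Filter.Eventually.mono ((lintegral_eq_zero_iff m2).1 hq) fun y hy => ?_
    by_contra hn
    have hy2 : ((q.1, y, q.2) : Phase d) ∈ Z := hZ hn
    simp [indicator_of_mem hy2] at hy
  unfold seminormX
  congr 1
  refine setLIntegral_congr_fun_ae (measurableSet_Ioc.prod measurableSet_ball) ?_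
  refine Filter.Eventually.mono key fun q hq hqm => ?_
  refine setLIntegral_congr_fun_ae (measurableSet_ball.prod measurableSet_ball) ?_
  have a1 : ∀ᵐ s : E d × E d, (q.1, s.1, q.2) ∈ cylinder r z₀ →
      f (q.1, s.1, q.2) = f' (q.1, s.1, q.2) :=
    (Measure.quasiMeasurePreserving_fst (μ := (volume : Measure (E d)))
      (ν := (volume : Measure (E d)))).ae hq
  have a2 : ∀ᵐ s : E d × E d, (q.1, s.2, q.2) ∈ cylinder r z₀ →
      f (q.1, s.2, q.2) = f' (q.1, s.2, q.2) :=
    (Measure.quasiMeasurePreserving_snd (μ := (volume : Measure (E d)))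
      (ν := (volume : Measure (E d)))).ae hq
  filter_upwards [a1, a2] with s h1 h2 hs
  have hm : ∀ x ∈ Metric.ball (z₀.2.1 + (q.1 - z₀.1) • z₀.2.2) (r ^ 3),
      (q.1, x, q.2) ∈ cylinder r z₀ := by
    intro x hx
    refine ⟨by linarith [hqm.1.1], by linarith [hqm.1.2], ?_, by simpa [dist_eq_norm] using hqm.2⟩
    simpa [dist_eq_norm, sub_sub] using hx
  rw [h1 (hm _ hs.1), h2 (hm _ hs.2)]

/-- A test function in `O` vanishes outside `Q` together with its derivatives. The integrals over
`Ω` and over the whole space therefore both reduce to `Q`, where the data agree almost everywhere.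
-/
theorem IsWeakSubsolution.isSubsolutionOn {Ω Q O : Set (Phase d)}
    {A : Phase d → Matrix (Fin d) (Fin d) ℝ} {B : Phase d → E d} {S f : Phase d → ℝ}
    {G : Phase d → E d} (H : IsWeakSubsolution Ω A B S f G) (hQ : MeasurableSet Q) (hQΩ : Q ⊆ Ω)
    (hOQ : O ⊆ Q) {f' b' : Phase d → ℝ} {F' G' : Phase d → E d}
    (mf : Measurable f') (mb : Measurable b') (mF : Measurable F') (mG : Measurable G')
    (if' : Integrable f') (ib : Integrable b') (iF : Integrable F') (iG : Integrable G')
    (ef : ∀ᵐ z ∂volume.restrict Q, f z = f' z)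
    (eb : ∀ᵐ z ∂volume.restrict Q, inner ℝ (B z) (G z) + S z = b' z)
    (eF : ∀ᵐ z ∂volume.restrict Q, act (A z) (G z) = F' z)
    (eG : ∀ᵐ z ∂volume.restrict Q, G z = G' z) : IsSubsolutionOn O f' b' F' G' := by
  have tr : ∀ φ, IsTest O φ → IsTest Ω φ := fun φ hφ =>
    ⟨hφ.1, hφ.2, hφ.3.trans (interior_mono (hOQ.trans hQΩ))⟩
  have z0 : ∀ φ, IsTest O φ → ∀ z, z ∉ Q → z ∉ tsupport φ := fun φ hφ z hz hm =>
    hz (hOQ (interior_subset (hφ.3 hm)))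
  have zφ : ∀ φ, IsTest O φ → ∀ z, z ∉ Q → φ z = 0 := fun φ hφ z hz =>
    image_eq_zero_of_notMem_tsupport (z0 φ hφ z hz)
  have zT : ∀ φ, IsTest O φ → ∀ z, z ∉ Q → transport φ z = 0 := fun φ hφ z hz => by
    unfold transport; rw [fderiv_of_notMem_tsupport ℝ (z0 φ hφ z hz)]; rfl
  have zV : ∀ φ, IsTest O φ → ∀ z, z ∉ Q → gradV φ z = 0 := fun φ hφ z hz => by
    ext i
    rw [gradV_apply (hφ.1.differentiable (by simp) z)]
    unfold derivV; rw [fderiv_of_notMem_tsupport ℝ (z0 φ hφ z hz)]; rfl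
  refine ⟨mf, mb, mF, mG, if', ib, iF, iG, fun φ hφ i => ?_, fun φ hφ hφ0 => ?_⟩
  · have h := H.hasWeakGradV φ (tr φ hφ)
    rw [setIntegral_eq_integral_of_ae_eq (g' := fun z => f' z • gradV φ z) hQ hQΩ
        (fun z hz => by rw [zV φ hφ z hz, smul_zero]) (fun z hz => by rw [zV φ hφ z hz, smul_zero])
        (ef.mono fun z hz => by rw [hz]),
      setIntegral_eq_integral_of_ae_eq (g' := fun z => φ z • G' z) hQ hQΩ
        (fun z hz => by rw [zφ φ hφ z hz, zero_smul]) (fun z hz => by rw [zφ φ hφ z hz, zero_smul])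
        (eG.mono fun z hz => by rw [hz])] at h
    have h2 := congrArg (fun v : E d => v i) h
    have e1 : ∀ (z : Phase d) (i : Fin d), (f' z • gradV φ z) i
        = f' z * derivV (EuclideanSpace.single i 1) φ z := fun z i => by
      rw [PiLp.smul_apply, gradV_apply (hφ.1.differentiable (by simp) z), smul_eq_mul]
    have e2 : ∀ (z : Phase d) (i : Fin d), (φ z • G' z) i = G' z i * φ z := fun z i => by
      rw [PiLp.smul_apply, smul_eq_mul, mul_comm]
    have e3 := eval_integral_piLp (f := fun z => f' z • gradV φ z) (μ := volume)
      (fun i => by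
        simp only [e1]
        exact integrable_mul_of_hasCompactSupport if' (contDiff_derivV hφ.1 _).continuous
          (hasCompactSupport_derivV hφ.2 _)) i
    have e4 := eval_integral_piLp (f := fun z => φ z • G' z) (μ := volume)
      (fun i => by
        simp only [e2]
        exact integrable_mul_of_hasCompactSupport (integrable_apply iG i) hφ.1.continuous hφ.2) i
    simp only [PiLp.neg_apply, e3, e4, e1, e2] at h2
    exact h2
  · have h := H.inequality φ (tr φ hφ) hφ0
    rw [setIntegral_eq_integral_of_ae_eq (g' := fun z => inner ℝ (F' z) (gradV φ z)) hQ hQΩ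
        (fun z hz => by rw [zV φ hφ z hz, inner_zero_right])
        (fun z hz => by rw [zV φ hφ z hz, inner_zero_right]) (eF.mono fun z hz => by rw [hz]),
      setIntegral_eq_integral_of_ae_eq (g' := fun z => b' z * φ z) hQ hQΩ
        (fun z hz => by rw [zφ φ hφ z hz, mul_zero]) (fun z hz => by rw [zφ φ hφ z hz, mul_zero])
        (eb.mono fun z hz => by rw [hz]),
      setIntegral_eq_integral_of_ae_eq (g' := fun z => f' z * transport φ z) hQ hQΩ
        (fun z hz => by rw [zT φ hφ z hz, mul_zero]) (fun z hz => by rw [zT φ hφ z hz, mul_zero])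
        (ef.mono fun z hz => by rw [hz])] at h
    have e : ∫ z, inner ℝ (F' z) (gradV φ z)
        = ∑ i, ∫ z, F' z i * derivV (EuclideanSpace.single i 1) φ z := by
      rw [← integral_finsetSum _ fun i _ => integrable_mul_of_hasCompactSupport
        (integrable_apply iF i) (contDiff_derivV hφ.1 _).continuous (hasCompactSupport_derivV hφ.2 _)]
      congr 1 with z
      rw [inner_eq_sum]
      simp only [gradV_apply (hφ.1.differentiable (by simp) z)]
    rw [functional_eq if' ib iF hφ.1 hφ.2, ← e]
    linarith

end Kinetic

end

theorem propositionp (d : ℕ) (hd : 1 ≤ d) (Lam : ℝ) (hLam : 0 < Lam)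
    (ε : ℝ) (hε : 0 < ε) (hε' : ε < 1 / 3) :
    ∃ C : ℝ≥0, ∀ p : ℝ, 1 < p → p < 1 + (2 - 3 * ε) / (4 * (d : ℝ) + 3 * ε) →
      ∀ lam : ℝ, 0 < lam → lam ≤ Lam →
      ∀ (a b : ℝ) (Ωx Ωv : Set (Kinetic.E d)), IsOpen Ωx → IsOpen Ωv →
      ∀ (A : Kinetic.Phase d → Matrix (Fin d) (Fin d) ℝ) (B : Kinetic.Phase d → Kinetic.E d)
        (S : Kinetic.Phase d → ℝ) (f : Kinetic.Phase d → ℝ) (G : Kinetic.Phase d → Kinetic.E d),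
        Kinetic.IsElliptic (Kinetic.domain a b Ωx Ωv) lam Lam A →
        AEStronglyMeasurable B (volume.restrict (Kinetic.domain a b Ωx Ωv)) →
        (∀ᵐ z ∂(volume.restrict (Kinetic.domain a b Ωx Ωv)), ‖B z‖ ≤ Lam) →
        MemLp S 2 (volume.restrict (Kinetic.domain a b Ωx Ωv)) →
        Kinetic.IsWeakSubsolution (Kinetic.domain a b Ωx Ωv) A B S f G →
        ∀ (z₀ : Kinetic.Phase d) (r R : ℝ), 0 < r → r < R → R < 1 →
          Kinetic.cylinder R z₀ ⊆ Kinetic.domain a b Ωx Ωv →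
          Kinetic.seminormX ε p r z₀ f ≤
            C * ENNReal.ofReal (R - r)⁻¹
                * eLpNorm G 2 (volume.restrict (Kinetic.cylinder R z₀))
              + C * ENNReal.ofReal ((R - r)⁻¹ ^ 2)
                * eLpNorm f 2 (volume.restrict (Kinetic.cylinder R z₀))
              + C * eLpNorm S 2 (volume.restrict (Kinetic.cylinder R z₀)) := by
  obtain ⟨M, hM0, hM⟩ := Kinetic.exists_seminormX_le d hd hε hε'
  -- `M` depends only on `d` and `ε`; the factor `Lam + 1` comes from bounding `A ∇_v f` and `B ·
  -- ∇_v f` by `Lam` times the gradient.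
  refine ⟨(M * (Lam + 1)).toNNReal, ?_⟩
  intro p hp hp2 lam hlam _ a b Ωx Ωv _ _ A B S f G hA hB hBb hS H z₀ r R hr hrR hR hQΩ
  have hp3 : p < 6 / (4 + 3 * ε) := by
    refine hp2.trans_le ?_
    have hd' : (1 : ℝ) ≤ d := by exact_mod_cast hd
    -- The admissible range of `p` shrinks with `d`, so its endpoint at `d = 1`, equal to `6 / (4 +
    -- 3 ε)`, covers all dimensions.
    have h1 : (2 - 3 * ε) / (4 * (d : ℝ) + 3 * ε) ≤ (2 - 3 * ε) / (4 + 3 * ε) :=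
      div_le_div_of_nonneg_left (by linarith) (by linarith) (by linarith)
    have h2 : 1 + (2 - 3 * ε) / (4 + 3 * ε) = 6 / (4 + 3 * ε) := by
      have : 4 + 3 * ε ≠ 0 := by positivity
      field_simp
      ring
    linarith
  set Q := Kinetic.cylinder R z₀ with hQd
  have hQ : MeasurableSet Q := Kinetic.measurableSet_cylinder R z₀
  have hR0 : 0 < R := hr.trans hrR
  have hfin : volume Q ≠ ⊤ := Kinetic.volume_cylinder_ne_top hR0.le hR.le z₀
  have hμ : volume.restrict Q ≤ volume.restrict (Kinetic.domain a b Ωx Ωv) :=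
    Measure.restrict_mono hQΩ le_rfl
  have lf := H.memLp.mono_measure hμ
  have lG := H.memLp_grad.mono_measure hμ
  have lS := hS.mono_measure hμ
  have hB' := hB.mono_measure hμ
  have hA' := hA.aestronglyMeasurable.mono_measure hμ
  have bA : ∀ᵐ z ∂volume.restrict Q, ‖Kinetic.act (A z) (G z)‖ ≤ Lam * ‖G z‖ := by
    filter_upwards [ae_mono hμ hA.isSymm, ae_mono hμ hA.bounds] with z h1 h2
    exact Kinetic.norm_act_le h1 hLam (fun ξ => (by positivity : 0 ≤ lam * ‖ξ‖ ^ 2).trans (h2 ξ).1)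
      (fun ξ => (h2 ξ).2) _
  have bB : ∀ᵐ z ∂volume.restrict Q, ‖(inner ℝ (B z) (G z) : ℝ)‖ ≤ Lam * ‖G z‖ := by
    filter_upwards [ae_mono hμ hBb] with z h1
    exact (norm_inner_le_norm _ _).trans (mul_le_mul_of_nonneg_right h1 (norm_nonneg _))
  have lF : MemLp (fun z => Kinetic.act (A z) (G z)) 2 (volume.restrict Q) :=
    lG.of_le_mul (Kinetic.continuous_act.comp_aestronglyMeasurable (hA'.prodMk lG.1)) bA
  have lBG : MemLp (fun z => (inner ℝ (B z) (G z) : ℝ)) 2 (volume.restrict Q) :=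
    lG.of_le_mul (hB'.inner lG.1) bB
  have lb := lBG.add lS
  obtain ⟨f', mf, if', zf, ef, nf⟩ := Kinetic.exists_extension hQ hfin lf
  obtain ⟨G', mG, iG, zG, eG, nG⟩ := Kinetic.exists_extension hQ hfin lG
  obtain ⟨F', mF, iF, zF, eF, nF⟩ := Kinetic.exists_extension hQ hfin lF
  obtain ⟨b', mb, ib, zb, eb, nb⟩ := Kinetic.exists_extension hQ hfin lb
  have Hs : Kinetic.IsSubsolutionOn (Kinetic.openCylinder R z₀) f' b' F' G' :=
    H.isSubsolutionOn hQ hQΩ (Kinetic.openCylinder_subset R z₀) mf mb mF mG if' ib iF iG ef eb eF eG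
  set xf := (eLpNorm f 2 (volume.restrict Q)).toReal with hxf
  set xG := (eLpNorm G 2 (volume.restrict Q)).toReal with hxG
  set xS := (eLpNorm S 2 (volume.restrict Q)).toReal with hxS
  have of : eLpNorm f 2 (volume.restrict Q) = ENNReal.ofReal xf := (ENNReal.ofReal_toReal lf.2.ne).symm
  have oG : eLpNorm G 2 (volume.restrict Q) = ENNReal.ofReal xG := (ENNReal.ofReal_toReal lG.2.ne).symm
  have oS : eLpNorm S 2 (volume.restrict Q) = ENNReal.ofReal xS := (ENNReal.ofReal_toReal lS.2.ne).symm
  have xf0 : 0 ≤ xf := ENNReal.toReal_nonneg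
  have xG0 : 0 ≤ xG := ENNReal.toReal_nonneg
  have xS0 : 0 ≤ xS := ENNReal.toReal_nonneg
  have hD : 0 < R - r := sub_pos.2 hrR
  set D := R - r with hDd
  have hD1 : 1 ≤ D⁻¹ := (one_le_inv₀ hD).2 (by linarith)
  -- `N` is the right side of the estimate up to `M`. Its powers of `D` make all four bounds of
  -- `IsControlled` hold, using `D ≤ 1` to bound `‖b‖`.
  set N := (Lam + 1) * (D⁻¹ * xG + D⁻¹ ^ 2 * xf + xS) with hN
  have hN0 : 0 ≤ N := by positivity
  have N1 : D * N = (Lam + 1) * (xG + D⁻¹ * xf + D * xS) := by rw [hN]; field_simp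
  have N2 : D ^ 2 * N = (Lam + 1) * (D * xG + xf + D ^ 2 * xS) := by rw [hN]; field_simp
  have p1 : 0 ≤ Lam * (D * xG) + Lam * xf + Lam * (D ^ 2 * xS) + D * xG + D ^ 2 * xS := by positivity
  have p2 : 0 ≤ D⁻¹ * xf + Lam * (D⁻¹ * xf) + D * xS + Lam * (D * xS) := by positivity
  have p3 : 0 ≤ D⁻¹ ^ 2 * xf + Lam * (D⁻¹ ^ 2 * xf) + Lam * xS + xG := by positivity
  have p4 : 0 ≤ Lam * xG := by positivity
  have p5 : (Lam + 1) * xG ≤ (Lam + 1) * (D⁻¹ * xG) := by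
    gcongr
    exact le_mul_of_one_le_left xG0 hD1
  have nF' : eLpNorm (fun z => Kinetic.act (A z) (G z)) 2 (volume.restrict Q)
      ≤ ENNReal.ofReal (Lam * xG) := by
    refine (eLpNorm_le_mul_eLpNorm_of_ae_le_mul bA 2).trans (le_of_eq ?_)
    rw [oG, ENNReal.ofReal_mul hLam.le]
  have nb' : eLpNorm ((fun z => (inner ℝ (B z) (G z) : ℝ)) + S) 2 (volume.restrict Q)
      ≤ ENNReal.ofReal (Lam * xG + xS) := by
    refine (eLpNorm_add_le lBG.1 lS.1 one_le_two).trans ?_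
    rw [ENNReal.ofReal_add p4 xS0, oS]
    refine add_le_add ((eLpNorm_le_mul_eLpNorm_of_ae_le_mul bB 2).trans (le_of_eq ?_)) le_rfl
    rw [oG, ENNReal.ofReal_mul hLam.le]
  have Hc : Kinetic.IsControlled z₀ r R N f' b' F' G' := by
    refine ⟨hN0, zf, zb, zF, ?_, ?_, ?_, ?_⟩
    · rw [nf, of]
      exact pow_le_pow_left' (ENNReal.ofReal_le_ofReal (by rw [N2]; linarith)) 2
    · rw [nb]
      exact pow_le_pow_left' (nb'.trans (ENNReal.ofReal_le_ofReal (by rw [hN]; linarith))) 2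
    · rw [nF]
      exact pow_le_pow_left' (nF'.trans (ENNReal.ofReal_le_ofReal (by rw [N1]; linarith))) 2
    · rw [nG, oG]
      exact pow_le_pow_left' (ENNReal.ofReal_le_ofReal (by rw [N1]; linarith)) 2
  have key := hM z₀ r R N f' b' F' G' Hs Hc hr hrR hR p hp hp3
  rw [Kinetic.seminormX_congr (ae_mono
    (Measure.restrict_mono (Kinetic.cylinder_subset hr hrR.le z₀) le_rfl) ef)]
  refine key.trans (le_of_eq ?_)
  have hK : 0 ≤ M * (Lam + 1) := by positivity
  rw [of, oG, oS]
  change _ = ENNReal.ofReal (M * (Lam + 1)) * _ * _ + ENNReal.ofReal (M * (Lam + 1)) * _ * _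
    + ENNReal.ofReal (M * (Lam + 1)) * _
  rw [← ENNReal.ofReal_mul hK, ← ENNReal.ofReal_mul (by positivity), ← ENNReal.ofReal_mul hK,
    ← ENNReal.ofReal_mul (by positivity), ← ENNReal.ofReal_mul hK,
    ← ENNReal.ofReal_add (by positivity) (by positivity),
    ← ENNReal.ofReal_add (by positivity) (by positivity)]
  congr 1
  rw [hN]
  ring
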